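/- The background theory is $\mathsf{ZF}$, without the axiom of choice; so let $N$ be an arbitrary transitive class (a set or a proper class, for example $N=V$) such that $(N,\in)\models\mathsf{ZF}$, where the formulas in the Separation and Collection schemata are the first-order formulas of the language $\{\in\}$ with parameters from $N$. For an ordinal $\alpha\in N$ write $V_\alpha$ for the $\alpha$-th level of the cumulative hierarchy as computed in $N$, that is, the set of all $x\in N$ of rank less than $\alpha$. Let $\delta\in N$ be a limit ordinal, and let $j:V_\delta\to V_\delta$, $j\in N$, be $\Sigma_1$-elementary and not the identity; that is, $j\neq\mathrm{id}$ and for all $\Sigma_1$ formulas $\varphi$ of the language $\{\in\}$ and all finite tuples $\vec x$ from $V_\delta$, $(V_\delta,\in)\models\varphi(\vec x)$ iff $(V_\delta,\in)\models\varphi(j(\vec x))$. For $A\subseteq V_\delta$ with $A\in N$ let $j^+(A)=\bigcup_{\alpha<\delta}j(A\cap V_\alpha)$. For a function $f:V_\delta\to V_{\delta+1}$ with $f\in N$, code $f$ by the relation $\tilde f=\{(x,y): x\in V_\delta,\ y\in f(x)\}\subseteq V_\delta\times V_\delta$, and let $j^+(f)$ be the function on $V_\delta$ with $j^+(f)(a)=\{y\in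 V_\delta:(a,y)\in j^+(\tilde f)\}$. Then: 1. $j$ is not definable from parameters over $V_\delta$; that is, the relation $j(x)=y$ on $V_\delta$ is not defined over $(V_\delta,\in)$ by any first-order formula of the language $\{\in\}$ with parameters from $V_\delta$. 2. There are no $a\in V_\delta$ and $f:V_\delta\to V_{\delta+1}$ with $f\in N$ such that $j^+(f)(a)=j$, where $j$ is identified with its graph $\{(x,j(x)):x\in V_\delta\}\subseteq V_\delta$. -/

import Mathlib

open FirstOrder

universe u

namespace RankEmbedding

/-! ## The language of set theory and the classes of bounded and existential formulas -/

/-- The relation symbols of the language of set theory: a single binary symbol. -/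
inductive SetRel : ℕ → Type
  | mem : SetRel 2

/-- The first-order language of set theory, with the membership symbol as its only symbol
(equality is logical). -/
def LSet : Language := ⟨fun _ => Empty, SetRel⟩

/-- Every collection of sets is a structure for the language of set theory, the symbol being
interpreted by true membership. -/
instance memStructure (p : ZFSet.{u} → Prop) : LSet.Structure (Subtype p) where
  funMap := fun f _ => Empty.elim f
  RelMap := fun {_} r => match r with
    | SetRel.mem => fun xs => (xs 0 : ZFSet.{u}) ∈ (xs 1 : ZFSet.{u})

/-- The atomic formula `t₁ ∈ t₂`. -/
def memFormula {α : Type} {n : ℕ} (t₁ t₂ : LSet.Term (α ⊕ Fin n)) : LSet.BoundedFormula α n :=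
  Language.Relations.boundedFormula₂ (L := LSet) SetRel.mem t₁ t₂

/-- The atomic formula `z ∈ x`, where `z` is the variable that the next quantifier binds and `x` is
a variable that was there before it. -/
def newMem {α : Type} {n : ℕ} (x : α ⊕ Fin n) : LSet.BoundedFormula α (n + 1) :=
  memFormula (Language.Term.var (Sum.inr (Fin.last n)))
    (Language.Term.var (Sum.map id Fin.castSucc x))

/-- `Σ₀` formulas: all quantifiers are bounded, `∀ z ∈ x` or `∃ z ∈ x`. The other connectives are
built from implication and falsity. -/
inductive IsSigma0 {α : Type} : ∀ {n : ℕ}, LSet.BoundedFormula α n → Prop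
  | falsum {n : ℕ} : IsSigma0 (Language.BoundedFormula.falsum : LSet.BoundedFormula α n)
  | equal {n : ℕ} (t₁ t₂ : LSet.Term (α ⊕ Fin n)) :
      IsSigma0 (Language.BoundedFormula.equal t₁ t₂)
  | mem {n : ℕ} (t₁ t₂ : LSet.Term (α ⊕ Fin n)) : IsSigma0 (memFormula t₁ t₂)
  | imp {n : ℕ} {φ ψ : LSet.BoundedFormula α n} :
      IsSigma0 φ → IsSigma0 ψ → IsSigma0 (φ.imp ψ)
  | ball {n : ℕ} (x : α ⊕ Fin n) {φ : LSet.BoundedFormula α (n + 1)} :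
      IsSigma0 φ → IsSigma0 ((newMem x).imp φ).all
  | bex {n : ℕ} (x : α ⊕ Fin n) {φ : LSet.BoundedFormula α (n + 1)} :
      IsSigma0 φ → IsSigma0 (newMem x ⊓ φ).ex

/-- `Σ₁` formulas: a block of existential quantifiers in front of a `Σ₀` formula. -/
inductive IsSigma1 {α : Type} : ∀ {n : ℕ}, LSet.BoundedFormula α n → Prop
  | of_sigma0 {n : ℕ} {φ : LSet.BoundedFormula α n} : IsSigma0 φ → IsSigma1 φ
  | ex {n : ℕ} {φ : LSet.BoundedFormula α (n + 1)} : IsSigma1 φ → IsSigma1 φ.ex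

/-- `j : v → v` is `Σ₁`-elementary, for the structure `(v, ∈)`. -/
def IsSigma1Elementary {v : ZFSet.{u}} (j : v → v) : Prop :=
  ∀ (k : ℕ) (φ : LSet.Formula (Fin k)), IsSigma1 φ →
    ∀ s : Fin k → v, φ.Realize s ↔ φ.Realize (j ∘ s)

/-- The function `j : v → v` is definable over `(v, ∈)` from parameters in `v`. -/
def IsDefinableFromParameters {v : ZFSet.{u}} (j : v → v) : Prop :=
  (Set.univ : Set v).Definable₂ LSet {p : v × v | j p.1 = p.2}

/-! ## Transitive models of ZF, without the axiom of choice -/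

/-- `(N, ∈)` is a model of the first-order theory ZF. The class `N` may be a set or a proper class.
Separation and Collection are the schemata for the classes and class relations that are definable
over `(N, ∈)` by a first-order formula with parameters from `N`. -/
structure IsZFModel (N : Set ZFSet.{u}) : Prop where
  extensionality : ∀ x y : N, (∀ z : N, z.1 ∈ x.1 ↔ z.1 ∈ y.1) → x = y
  foundation : ∀ x : N, (∃ y : N, y.1 ∈ x.1) → ∃ y : N, y.1 ∈ x.1 ∧ ∀ z : N, z.1 ∈ y.1 → z.1 ∉ x.1
  pairing : ∀ x y : N, ∃ p : N, ∀ z : N, z.1 ∈ p.1 ↔ z = x ∨ z = y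
  union : ∀ x : N, ∃ w : N, ∀ z : N, z.1 ∈ w.1 ↔ ∃ y : N, y.1 ∈ x.1 ∧ z.1 ∈ y.1
  power : ∀ x : N, ∃ p : N, ∀ y : N, y.1 ∈ p.1 ↔ ∀ z : N, z.1 ∈ y.1 → z.1 ∈ x.1
  infinity : ∃ w : N, (∃ e : N, e.1 ∈ w.1 ∧ ∀ z : N, z.1 ∉ e.1) ∧
    ∀ x : N, x.1 ∈ w.1 → ∃ y : N, y.1 ∈ w.1 ∧ ∀ z : N, z.1 ∈ y.1 ↔ z.1 ∈ x.1 ∨ z = x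
  separation : ∀ S : Set N, (Set.univ : Set N).Definable₁ LSet S →
    ∀ x : N, ∃ y : N, ∀ z : N, z.1 ∈ y.1 ↔ z.1 ∈ x.1 ∧ z ∈ S
  collection : ∀ R : Set (N × N), (Set.univ : Set N).Definable₂ LSet R →
    ∀ x : N, (∀ y : N, y.1 ∈ x.1 → ∃ z : N, (y, z) ∈ R) →
      ∃ w : N, ∀ y : N, y.1 ∈ x.1 → ∃ z : N, z.1 ∈ w.1 ∧ (y, z) ∈ R

/-- `N` is a transitive class that is a model of ZF. The class of all sets is one; others need not
satisfy the axiom of choice. -/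
structure IsTransitiveZFModel (N : Set ZFSet.{u}) : Prop where
  transitive : ∀ x ∈ N, ∀ y ∈ x, y ∈ N
  isZFModel : IsZFModel N

/-- The level `V_α` of the cumulative hierarchy as computed in a transitive model `N`: the sets in
`N` of rank less than `α`. -/
noncomputable def level (N : Set ZFSet.{u}) (α : Ordinal.{u}) : ZFSet.{u} :=
  ZFSet.sep (fun x => x ∈ N) (ZFSet.vonNeumann α)

/-! ## Functions as sets, and the canonical extension -/

/-- The graph `{(x, f(x)) : x ∈ v}` of a function, as a set. -/
noncomputable def graph {v w : ZFSet.{u}} (f : v → w) : ZFSet.{u} :=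
  ZFSet.range fun x : v => ZFSet.pair x.1 (f x).1

/-- The canonical extension of `j : v → v`, for `v` the level of limit height `δ` of the cumulative
hierarchy of a transitive model `N` of ZF: the value at `A ⊆ v` (with `A ∈ N`) is the union of the
sets `j(A ∩ V_α)`, for `α < δ`. The sets `j(A ∩ V_α)` are subsets of `v`, as `v` is transitive. -/
noncomputable def canonicalExtension (δ : Ordinal.{u}) {v : ZFSet.{u}} (j : v → v)
    (A : ZFSet.{u}) : ZFSet.{u} :=
  ZFSet.sep (fun y => ∃ α < δ, ∃ x : v, x.1 = A ∩ ZFSet.vonNeumann α ∧ y ∈ (j x).1) v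

/-- A function `f` from `v` to subsets of `v`, coded by the relation `{(x, y) : x ∈ v, y ∈ f(x)}`
on `v`. -/
noncomputable def codeRel {v w : ZFSet.{u}} (f : v → w) : ZFSet.{u} :=
  ZFSet.sep (fun p => ∃ x : v, ∃ y ∈ (f x).1, p = ZFSet.pair x.1 y) (ZFSet.prod v v)

/-- The value at `a` of the canonical extension of `j` at a function `f` from `v` to subsets
of `v`: apply the canonical extension to the relation that codes `f`, and take the section of the
result at `a`. -/
noncomputable def canonicalExtensionFun (δ : Ordinal.{u}) {v w : ZFSet.{u}} (j : v → v) (f : v → w)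
    (a : v) : ZFSet.{u} :=
  ZFSet.sep (fun y => ZFSet.pair a.1 y ∈ canonicalExtension δ j (codeRel f)) v

end RankEmbedding

namespace RankEmbedding

open ZFSet

/-! ## Classes of definable predicates, closed under bounded quantification -/

/-! Write `V` for `V_δ`, `k^+` for the canonical extension of `k`, and `F_a` for the section of a
relation `F` at `a`. All that is used of `j` is that it lies in `N` and commutes with a few set
operations (`Emb`). This already transfers statements with bounded quantifiers from `(V, A)` to `(V,
k^+(A))` (`lift`). Hence embeddings apply to each other: `k · l` is the embedding with graph
`k^+(l)`, and `k^+(l^+(A)) = (k · l)^+(k^+(A))` (`Emb.ext_ext`). The iterates are `k_0 = k` and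
`k_{n+1} = k_n · k_n`; they satisfy `k · k_n = k_{n+1}`.

The core is an infinite descent (`Emb.not_section_of_iso`). Suppose that `k : (V, A) → (V, k^+(A))`
is elementary for all formulas and all `A`, and that `k = k^+(f)_a`. Let `κ` be the least level that
`k` moves. Then `(V, k^+(f))` sees a section of `k^+(f)`, namely `k`, that is an embedding, moves a
level in `k(κ)`, and has `k^+(f)` in the range of its canonical extension. By elementarity some
section `i = f_x` is an embedding that moves a level in `κ`, and `f = i^+(g)` for some `g`. So `i =
i^+(g)_x` is a counterexample with a smaller critical level.

Full elementarity can fail, because existential quantifiers are projections and `k^+(dom C)` may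
differ from `dom (k^+(C))` (`Exact`). It cannot fail if `V` satisfies Collection for all `C ⊆ V` in
`N`. Otherwise a failure of Collection yields a set `S ∈ V` that is well-ordered by inclusion
(`exists_isUnboundedChain`), such that `k` is exact as soon as `k(S) ≅ S` (`Emb.exact_of_iso`).
Least-counterexample arguments show that some iterate of any nontrivial `k` fixes `S` up to
isomorphism (`Emb.NonTriv.exists_it_eq`, `Emb.NonTriv.exists_iso_it`). The descent carries the
condition `i(S) ≅ S` along, so that `i` is exact too.

For the second claim, being a section of one's own canonical extension passes from `k_n` to
`k_{n+1}`, hence to an exact iterate. For the first claim, let `k_n` be exact. If `k` is definable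
from parameters, then every `k_m` is a section of a relation that is invariant under `k_n^+`. For `m
= n` this contradicts the core argument. -/

/-- A context: a base of type `B`, followed by finitely many elements of `M`. -/
class Cxt (B M : Type (u + 1)) (Γ : Type (u + 1)) where
  size : ℕ
  base : Γ → B
  tail : Γ → Fin size → M
  -- Lets every tuple be read back as a context, so that a set of codes of tuples is determined by
  -- the predicate that it codes (`exists_tup`).
  surj : Nonempty B → ∀ v, ∃ g, tail g = v

instance Cxt.nil (B M : Type (u + 1)) : Cxt B M B :=
  ⟨0, id, fun _ => Fin.elim0, fun ⟨b⟩ _ => ⟨b, funext fun i => i.elim0⟩⟩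

instance Cxt.cons (B M Γ : Type (u + 1)) [c : Cxt B M Γ] : Cxt B M (Γ × M) :=
  ⟨c.size + 1, fun h => c.base h.1, fun h => Fin.snoc (c.tail h.1) h.2, fun b v =>
    let ⟨g, hg⟩ := c.surj b (Fin.init v)
    ⟨(g, v (Fin.last _)), by rw [hg, Fin.snoc_init_self]⟩⟩

/-- A family of pairs of predicates (and of pairs of terms) over the sets satisfying `p`, which has
the closure properties of the predicates that are given by `Σ₀` formulas. -/
structure Logic (p : ZFSet.{u} → Prop) (B : Type (u + 1)) where
  -- Predicates come in pairs for the sake of `lift`, where the second one speaks about the images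
  -- under an embedding. In `definable` and `sigma0` the two members are equal, so that one set of
  -- instances serves all three logics.
  Rel : ∀ {Γ : Type (u + 1)} [Cxt B (Subtype p) Γ], (Γ → Prop) → (Γ → Prop) → Prop
  Trm : ∀ {Γ : Type (u + 1)} [Cxt B (Subtype p) Γ], (Γ → Subtype p) → (Γ → Subtype p) → Prop
  last : ∀ {Γ : Type (u + 1)} [Cxt B (Subtype p) Γ],
    Trm (fun h : Γ × Subtype p => h.2) (fun h : Γ × Subtype p => h.2)
  weak : ∀ {Γ : Type (u + 1)} [Cxt B (Subtype p) Γ] {t t' : Γ → Subtype p},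
    Trm t t' → Trm (fun h : Γ × Subtype p => t h.1) (fun h : Γ × Subtype p => t' h.1)
  mem : ∀ {Γ : Type (u + 1)} [Cxt B (Subtype p) Γ] {s s' t t' : Γ → Subtype p},
    Trm s s' → Trm t t' → Rel (fun g => (s g).1 ∈ (t g).1) (fun g => (s' g).1 ∈ (t' g).1)
  not : ∀ {Γ : Type (u + 1)} [Cxt B (Subtype p) Γ] {P P' : Γ → Prop},
    Rel P P' → Rel (fun g => ¬ P g) (fun g => ¬ P' g)
  and : ∀ {Γ : Type (u + 1)} [Cxt B (Subtype p) Γ] {P P' Q Q' : Γ → Prop},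
    Rel P P' → Rel Q Q' → Rel (fun g => P g ∧ Q g) (fun g => P' g ∧ Q' g)
  bex : ∀ {Γ : Type (u + 1)} [Cxt B (Subtype p) Γ] {t t' : Γ → Subtype p}
    {P P' : Γ × Subtype p → Prop}, Trm t t' → Rel P P' →
    Rel (fun g => ∃ x : Subtype p, x.1 ∈ (t g).1 ∧ P (g, x))
      (fun g => ∃ x : Subtype p, x.1 ∈ (t' g).1 ∧ P' (g, x))

variable {p : ZFSet.{u} → Prop} {B : Type (u + 1)}

/-- Type class form of `Logic.Rel`. -/
class Logic.R (𝓛 : Logic p B) {Γ : Type (u + 1)} [Cxt B (Subtype p) Γ] (P P' : Γ → Prop) :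
    Prop where
  out : 𝓛.Rel P P'

/-- Type class form of `Logic.Trm`. -/
class Logic.T (𝓛 : Logic p B) {Γ : Type (u + 1)} [Cxt B (Subtype p) Γ] (t t' : Γ → Subtype p) :
    Prop where
  out : 𝓛.Trm t t'

/-- Projections from a context to an initial segment of it. -/
class Prj (B : Type (u + 1)) (p : ZFSet.{u} → Prop) {Γ Γ' : Type (u + 1)} [Cxt B (Subtype p) Γ]
    [Cxt B (Subtype p) Γ'] (f : Γ → Γ') : Prop where
  out : ∀ (𝓛 : Logic p B) {t t' : Γ' → Subtype p}, 𝓛.Trm t t' →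
    𝓛.Trm (fun g => t (f g)) (fun g => t' (f g))

instance Prj.id {Γ : Type (u + 1)} [Cxt B (Subtype p) Γ] : Prj B p (fun g : Γ => g) :=
  ⟨fun _ _ _ h => h⟩

instance Prj.fst {Γ Γ' : Type (u + 1)} [Cxt B (Subtype p) Γ] [Cxt B (Subtype p) Γ']
    (f : Γ → Γ' × Subtype p) [h : Prj B p f] : Prj B p (fun g => (f g).1) :=
  ⟨fun 𝓛 _ _ ht => h.out 𝓛 (𝓛.weak ht)⟩

/-- Every element of a member of the class is in the class. -/
class TransCl (p : ZFSet.{u} → Prop) : Prop where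
  out : ∀ {x y : ZFSet.{u}}, p x → y ∈ x → p y

namespace Logic

variable {𝓛 : Logic p B} {Γ : Type (u + 1)} [Cxt B (Subtype p) Γ]

instance T.snd {Γ' : Type (u + 1)} [Cxt B (Subtype p) Γ']
    (f : Γ → Γ' × Subtype p) [h : Prj B p f] : 𝓛.T (fun g => (f g).2) (fun g => (f g).2) :=
  ⟨h.out 𝓛 𝓛.last⟩

/-- Tried last, since with `f` the identity the pattern fits every term. -/
instance (priority := low) T.comp {Γ' : Type (u + 1)} [Cxt B (Subtype p) Γ']
    (f : Γ → Γ') [h : Prj B p f] {t t' : Γ' → Subtype p} [ht : 𝓛.T t t'] :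
    𝓛.T (fun g => t (f g)) (fun g => t' (f g)) :=
  ⟨h.out 𝓛 ht.out⟩

variable {s s' t t' r r' q q' : Γ → Subtype p} {P P' Q Q' : Γ → Prop}

instance R.mem [hs : 𝓛.T s s'] [ht : 𝓛.T t t'] :
    𝓛.R (fun g => (s g).1 ∈ (t g).1) (fun g => (s' g).1 ∈ (t' g).1) := ⟨𝓛.mem hs.out ht.out⟩

instance R.not [h : 𝓛.R P P'] : 𝓛.R (fun g => ¬ P g) (fun g => ¬ P' g) := ⟨𝓛.not h.out⟩

instance R.and [h : 𝓛.R P P'] [h' : 𝓛.R Q Q'] :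
    𝓛.R (fun g => P g ∧ Q g) (fun g => P' g ∧ Q' g) := ⟨𝓛.and h.out h'.out⟩

instance R.bex {P P' : Γ → Subtype p → Prop} [ht : 𝓛.T t t']
    [h : 𝓛.R (fun h : Γ × Subtype p => P h.1 h.2) (fun h : Γ × Subtype p => P' h.1 h.2)] :
    𝓛.R (fun g => ∃ x : Subtype p, x.1 ∈ (t g).1 ∧ P g x)
      (fun g => ∃ x : Subtype p, x.1 ∈ (t' g).1 ∧ P' g x) := ⟨𝓛.bex ht.out h.out⟩

theorem R.congr (h : 𝓛.R P P') (e : ∀ g, Q g ↔ P g) (e' : ∀ g, Q' g ↔ P' g) : 𝓛.R Q Q' := by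
  rw [funext fun g => propext (e g), funext fun g => propext (e' g)]; exact h

instance R.imp [𝓛.R P P'] [𝓛.R Q Q'] :
    𝓛.R (fun g => P g → Q g) (fun g => P' g → Q' g) :=
  (inferInstance : 𝓛.R (fun g => ¬ (P g ∧ ¬ Q g)) (fun g => ¬ (P' g ∧ ¬ Q' g))).congr
    (fun g => by tauto) (fun g => by tauto)

instance R.or [𝓛.R P P'] [𝓛.R Q Q'] :
    𝓛.R (fun g => P g ∨ Q g) (fun g => P' g ∨ Q' g) :=
  (inferInstance : 𝓛.R (fun g => ¬ (¬ P g ∧ ¬ Q g)) (fun g => ¬ (¬ P' g ∧ ¬ Q' g))).congr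
    (fun g => by tauto) (fun g => by tauto)

instance R.iff [𝓛.R P P'] [𝓛.R Q Q'] :
    𝓛.R (fun g => P g ↔ Q g) (fun g => P' g ↔ Q' g) :=
  (inferInstance : 𝓛.R (fun g => (P g → Q g) ∧ (Q g → P g))
    (fun g => (P' g → Q' g) ∧ (Q' g → P' g))).congr (fun g => by tauto) (fun g => by tauto)

instance R.ball {P P' : Γ → Subtype p → Prop} [𝓛.T t t']
    [𝓛.R (fun h : Γ × Subtype p => P h.1 h.2) (fun h : Γ × Subtype p => P' h.1 h.2)] :
    𝓛.R (fun g => ∀ x : Subtype p, x.1 ∈ (t g).1 → P g x)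
      (fun g => ∀ x : Subtype p, x.1 ∈ (t' g).1 → P' g x) :=
  (inferInstance : 𝓛.R (fun g => ¬ ∃ x : Subtype p, x.1 ∈ (t g).1 ∧ ¬ P g x)
    (fun g => ¬ ∃ x : Subtype p, x.1 ∈ (t' g).1 ∧ ¬ P' g x)).congr
    (fun g => by push Not; rfl) (fun g => by push Not; rfl)

variable [tc : TransCl p]

theorem subset_iff (x y : Subtype p) : x.1 ⊆ y.1 ↔ ∀ z : Subtype p, z.1 ∈ x.1 → z.1 ∈ y.1 :=
  ⟨fun h _ hz => h hz, fun h z hz => h ⟨z, tc.out x.2 hz⟩ hz⟩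

instance R.subset [𝓛.T s s'] [𝓛.T t t'] :
    𝓛.R (fun g => (s g).1 ⊆ (t g).1) (fun g => (s' g).1 ⊆ (t' g).1) :=
  (inferInstance : 𝓛.R (fun g => ∀ x : Subtype p, x.1 ∈ (s g).1 → x.1 ∈ (t g).1)
    (fun g => ∀ x : Subtype p, x.1 ∈ (s' g).1 → x.1 ∈ (t' g).1)).congr
    (fun _ => subset_iff _ _) (fun _ => subset_iff _ _)

theorem eq_iff_subset (x y : ZFSet.{u}) : x = y ↔ x ⊆ y ∧ y ⊆ x :=
  ⟨by rintro rfl; exact ⟨fun _ h => h, fun _ h => h⟩, fun h => ZFSet.ext fun z => ⟨@h.1 z, @h.2 z⟩⟩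

instance R.eqv [𝓛.T s s'] [𝓛.T t t'] :
    𝓛.R (fun g => (s g).1 = (t g).1) (fun g => (s' g).1 = (t' g).1) :=
  (inferInstance : 𝓛.R (fun g => (s g).1 ⊆ (t g).1 ∧ (t g).1 ⊆ (s g).1)
    (fun g => (s' g).1 ⊆ (t' g).1 ∧ (t' g).1 ⊆ (s' g).1)).congr
    (fun _ => eq_iff_subset _ _) (fun _ => eq_iff_subset _ _)

instance R.eq [𝓛.T s s'] [𝓛.T t t'] :
    𝓛.R (fun g => s g = t g) (fun g => s' g = t' g) :=
  (inferInstance : 𝓛.R (fun g => (s g).1 = (t g).1) (fun g => (s' g).1 = (t' g).1)).congr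
    (fun _ => Subtype.ext_iff) (fun _ => Subtype.ext_iff)

theorem eq_singleton_iff (x y : Subtype p) :
    x.1 = {y.1} ↔ y.1 ∈ x.1 ∧ ∀ z : Subtype p, z.1 ∈ x.1 → z = y := by
  refine ⟨fun h => by rw [h]; simp [Subtype.ext_iff], fun h => ZFSet.ext fun z => ?_⟩
  rw [mem_singleton]
  exact ⟨fun hz => congrArg Subtype.val (h.2 ⟨z, tc.out x.2 hz⟩ hz), fun hz => hz ▸ h.1⟩

instance R.singleton [𝓛.T s s'] [𝓛.T t t'] :
    𝓛.R (fun g => (s g).1 = {(t g).1}) (fun g => (s' g).1 = {(t' g).1}) :=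
  (inferInstance : 𝓛.R
    (fun g => (t g).1 ∈ (s g).1 ∧ ∀ z : Subtype p, z.1 ∈ (s g).1 → z = t g)
    (fun g => (t' g).1 ∈ (s' g).1 ∧ ∀ z : Subtype p, z.1 ∈ (s' g).1 → z = t' g)).congr
    (fun _ => eq_singleton_iff _ _) (fun _ => eq_singleton_iff _ _)

theorem eq_upair_iff (x y z : Subtype p) :
    x.1 = {y.1, z.1} ↔ (y.1 ∈ x.1 ∧ z.1 ∈ x.1) ∧ ∀ w : Subtype p, w.1 ∈ x.1 → w = y ∨ w = z := by
  refine ⟨fun h => by rw [h]; simp [Subtype.ext_iff], fun h => ZFSet.ext fun w => ?_⟩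
  rw [ZFSet.mem_pair]
  refine ⟨fun hw => (h.2 ⟨w, tc.out x.2 hw⟩ hw).imp (congrArg Subtype.val) (congrArg Subtype.val), ?_⟩
  rintro (rfl | rfl)
  exacts [h.1.1, h.1.2]

instance R.upair [𝓛.T s s'] [𝓛.T t t'] [𝓛.T r r'] :
    𝓛.R (fun g => (s g).1 = {(t g).1, (r g).1}) (fun g => (s' g).1 = {(t' g).1, (r' g).1}) :=
  (inferInstance : 𝓛.R
    (fun g => ((t g).1 ∈ (s g).1 ∧ (r g).1 ∈ (s g).1) ∧
      ∀ w : Subtype p, w.1 ∈ (s g).1 → w = t g ∨ w = r g)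
    (fun g => ((t' g).1 ∈ (s' g).1 ∧ (r' g).1 ∈ (s' g).1) ∧
      ∀ w : Subtype p, w.1 ∈ (s' g).1 → w = t' g ∨ w = r' g)).congr
    (fun _ => eq_upair_iff _ _ _) (fun _ => eq_upair_iff _ _ _)

theorem eq_pair_iff (x y z : Subtype p) :
    x.1 = pair y.1 z.1 ↔ ∃ a : Subtype p, a.1 ∈ x.1 ∧ ∃ b : Subtype p, b.1 ∈ x.1 ∧
      (a.1 = {y.1} ∧ b.1 = {y.1, z.1}) ∧ x.1 = {a.1, b.1} := by
  constructor
  · intro h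
    have ha : ({y.1} : ZFSet) ∈ x.1 := by simp [h, pair]
    have hb : ({y.1, z.1} : ZFSet) ∈ x.1 := by simp [h, pair]
    exact ⟨⟨_, tc.out x.2 ha⟩, ha, ⟨_, tc.out x.2 hb⟩, hb, ⟨rfl, rfl⟩, h⟩
  · rintro ⟨a, -, b, -, ⟨ha, hb⟩, h⟩
    rw [h, ha, hb, pair]

instance R.pair [𝓛.T s s'] [𝓛.T t t'] [𝓛.T r r'] :
    𝓛.R (fun g => (s g).1 = pair (t g).1 (r g).1) (fun g => (s' g).1 = pair (t' g).1 (r' g).1) :=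
  (inferInstance : 𝓛.R
    (fun g => ∃ a : Subtype p, a.1 ∈ (s g).1 ∧ ∃ b : Subtype p, b.1 ∈ (s g).1 ∧
      (a.1 = {(t g).1} ∧ b.1 = {(t g).1, (r g).1}) ∧ (s g).1 = {a.1, b.1})
    (fun g => ∃ a : Subtype p, a.1 ∈ (s' g).1 ∧ ∃ b : Subtype p, b.1 ∈ (s' g).1 ∧
      (a.1 = {(t' g).1} ∧ b.1 = {(t' g).1, (r' g).1}) ∧ (s' g).1 = {a.1, b.1})).congr
    (fun _ => eq_pair_iff _ _ _) (fun _ => eq_pair_iff _ _ _)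

/-- Both components of a Kuratowski pair are elements of its element `{a, b}`, so the quantifiers
over them can be bounded. -/
theorem exists_pair_iff (x : Subtype p) (P : Subtype p → Subtype p → Prop) :
    (∃ a b : Subtype p, x.1 = ZFSet.pair a.1 b.1 ∧ P a b) ↔
      ∃ c : Subtype p, c.1 ∈ x.1 ∧ ∃ a : Subtype p, a.1 ∈ c.1 ∧ ∃ b : Subtype p, b.1 ∈ c.1 ∧
        x.1 = ZFSet.pair a.1 b.1 ∧ P a b := by
  constructor
  · rintro ⟨a, b, h, hP⟩
    have hb : ({a.1, b.1} : ZFSet) ∈ x.1 := by simp [h, ZFSet.pair]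
    exact ⟨⟨_, tc.out x.2 hb⟩, hb, a, by simp, b, by simp, h, hP⟩
  · rintro ⟨_, _, a, _, b, _, h⟩
    exact ⟨a, b, h⟩

instance R.exists_pair {P P' : Γ → Subtype p → Subtype p → Prop} [𝓛.T t t']
    [𝓛.R (fun h : ((Γ × Subtype p) × Subtype p) × Subtype p => P h.1.1.1 h.1.2 h.2)
      (fun h : ((Γ × Subtype p) × Subtype p) × Subtype p => P' h.1.1.1 h.1.2 h.2)] :
    𝓛.R (fun g => ∃ a b : Subtype p, (t g).1 = ZFSet.pair a.1 b.1 ∧ P g a b)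
      (fun g => ∃ a b : Subtype p, (t' g).1 = ZFSet.pair a.1 b.1 ∧ P' g a b) :=
  (inferInstance : 𝓛.R
    (fun g => ∃ c : Subtype p, c.1 ∈ (t g).1 ∧ ∃ a : Subtype p, a.1 ∈ c.1 ∧
      ∃ b : Subtype p, b.1 ∈ c.1 ∧ (t g).1 = ZFSet.pair a.1 b.1 ∧ P g a b)
    (fun g => ∃ c : Subtype p, c.1 ∈ (t' g).1 ∧ ∃ a : Subtype p, a.1 ∈ c.1 ∧
      ∃ b : Subtype p, b.1 ∈ c.1 ∧ (t' g).1 = ZFSet.pair a.1 b.1 ∧ P' g a b)).congr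
    (fun _ => exists_pair_iff _ _) (fun _ => exists_pair_iff _ _)

theorem pair_mem_iff (x y z : Subtype p) : ZFSet.pair x.1 y.1 ∈ z.1 ↔
    ∃ w : Subtype p, w.1 ∈ z.1 ∧ w.1 = ZFSet.pair x.1 y.1 :=
  ⟨fun h => ⟨⟨_, tc.out z.2 h⟩, h, rfl⟩, fun ⟨_, h, e⟩ => e ▸ h⟩

instance R.pair_mem [𝓛.T s s'] [𝓛.T t t'] [𝓛.T r r'] :
    𝓛.R (fun g => ZFSet.pair (s g).1 (t g).1 ∈ (r g).1)
      (fun g => ZFSet.pair (s' g).1 (t' g).1 ∈ (r' g).1) :=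
  (inferInstance : 𝓛.R
    (fun g => ∃ w : Subtype p, w.1 ∈ (r g).1 ∧ w.1 = ZFSet.pair (s g).1 (t g).1)
    (fun g => ∃ w : Subtype p, w.1 ∈ (r' g).1 ∧ w.1 = ZFSet.pair (s' g).1 (t' g).1)).congr
    (fun _ => pair_mem_iff _ _ _) (fun _ => pair_mem_iff _ _ _)

theorem exists_pair_mem_iff (x : Subtype p) (P : Subtype p → Subtype p → Prop) :
    (∃ a b : Subtype p, ZFSet.pair a.1 b.1 ∈ x.1 ∧ P a b) ↔
      ∃ w : Subtype p, w.1 ∈ x.1 ∧ ∃ a b : Subtype p, w.1 = ZFSet.pair a.1 b.1 ∧ P a b :=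
  ⟨fun ⟨a, b, h, hP⟩ => ⟨⟨_, tc.out x.2 h⟩, h, a, b, rfl, hP⟩,
    fun ⟨_, h, a, b, e, hP⟩ => ⟨a, b, e ▸ h, hP⟩⟩

instance R.exists_pair_mem {P P' : Γ → Subtype p → Subtype p → Prop} [𝓛.T t t']
    [𝓛.R (fun h : (((Γ × Subtype p) × Subtype p) × Subtype p) × Subtype p =>
        P h.1.1.1.1 h.1.2 h.2)
      (fun h : (((Γ × Subtype p) × Subtype p) × Subtype p) × Subtype p =>
        P' h.1.1.1.1 h.1.2 h.2)] :
    𝓛.R (fun g => ∃ a b : Subtype p, ZFSet.pair a.1 b.1 ∈ (t g).1 ∧ P g a b)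
      (fun g => ∃ a b : Subtype p, ZFSet.pair a.1 b.1 ∈ (t' g).1 ∧ P' g a b) :=
  (inferInstance : 𝓛.R
    (fun g => ∃ w : Subtype p, w.1 ∈ (t g).1 ∧
      ∃ a b : Subtype p, w.1 = ZFSet.pair a.1 b.1 ∧ P g a b)
    (fun g => ∃ w : Subtype p, w.1 ∈ (t' g).1 ∧
      ∃ a b : Subtype p, w.1 = ZFSet.pair a.1 b.1 ∧ P' g a b)).congr
    (fun _ => exists_pair_mem_iff _ _) (fun _ => exists_pair_mem_iff _ _)

instance R.forall_pair_mem {P P' : Γ → Subtype p → Subtype p → Prop} [𝓛.T t t']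
    [𝓛.R (fun h : (((Γ × Subtype p) × Subtype p) × Subtype p) × Subtype p =>
        P h.1.1.1.1 h.1.2 h.2)
      (fun h : (((Γ × Subtype p) × Subtype p) × Subtype p) × Subtype p =>
        P' h.1.1.1.1 h.1.2 h.2)] :
    𝓛.R (fun g => ∀ a b : Subtype p, ZFSet.pair a.1 b.1 ∈ (t g).1 → P g a b)
      (fun g => ∀ a b : Subtype p, ZFSet.pair a.1 b.1 ∈ (t' g).1 → P' g a b) :=
  (inferInstance : 𝓛.R
    (fun g => ¬ ∃ a b : Subtype p, ZFSet.pair a.1 b.1 ∈ (t g).1 ∧ ¬ P g a b)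
    (fun g => ¬ ∃ a b : Subtype p, ZFSet.pair a.1 b.1 ∈ (t' g).1 ∧ ¬ P' g a b)).congr
    (fun _ => by push Not; rfl) (fun _ => by push Not; rfl)

end Logic

/-! ## The basic set operations -/

theorem left_mem_of_pair_mem [tc : TransCl p] {x y z : ZFSet.{u}} (hz : p z)
    (h : pair x y ∈ z) : p x :=
  tc.out (tc.out (tc.out hz h) (show ({x} : ZFSet) ∈ pair x y by simp [pair])) (by simp)

theorem right_mem_of_pair_mem [tc : TransCl p] {x y z : ZFSet.{u}} (hz : p z)
    (h : pair x y ∈ z) : p y :=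
  tc.out (tc.out (tc.out hz h) (show ({x, y} : ZFSet) ∈ pair x y by simp [pair])) (by simp)

/-- The domain of a relation. -/
noncomputable def dom (x : ZFSet.{u}) : ZFSet.{u} :=
  ZFSet.sep (fun a => ∃ b, pair a b ∈ x) (⋃₀ (⋃₀ x : ZFSet))

@[simp] theorem mem_dom {x a : ZFSet.{u}} : a ∈ dom x ↔ ∃ b, pair a b ∈ x := by
  simp only [dom, mem_sep, and_iff_right_iff_imp, mem_sUnion]
  rintro ⟨b, h⟩
  exact ⟨{a}, ⟨_, h, by simp [pair]⟩, by simp⟩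

/-- The part of `x` that consists of the triples `((a, b), c)` with `b ∈ c`. -/
noncomputable def memPart (x : ZFSet.{u}) : ZFSet.{u} :=
  ZFSet.sep (fun w => ∃ a b c, w = pair (pair a b) c ∧ b ∈ c) x

@[simp] theorem pair_mem_memPart {x a b c : ZFSet.{u}} :
    pair (pair a b) c ∈ memPart x ↔ pair (pair a b) c ∈ x ∧ b ∈ c := by
  simp only [memPart, mem_sep, pair_inj, and_congr_right_iff]
  exact fun _ => ⟨fun ⟨_, _, _, h, h'⟩ => by simp_all, fun h => ⟨a, b, c, by simp_all⟩⟩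

/-- The part of `x` that consists of the triples `((a, b), b)`. -/
noncomputable def eqPart (x : ZFSet.{u}) : ZFSet.{u} :=
  ZFSet.sep (fun w => ∃ a b c, w = pair (pair a b) c ∧ b = c) x

@[simp] theorem pair_mem_eqPart {x a b c : ZFSet.{u}} :
    pair (pair a b) c ∈ eqPart x ↔ pair (pair a b) c ∈ x ∧ b = c := by
  simp only [eqPart, mem_sep, pair_inj, and_congr_right_iff]
  exact fun _ => ⟨fun ⟨_, _, _, h, h'⟩ => by simp_all, fun h => ⟨a, b, c, by simp_all⟩⟩

/-- The part of `x` that consists of the triples `((a, b), c)` with `(a, c) ∈ y`. -/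
noncomputable def insPart (x y : ZFSet.{u}) : ZFSet.{u} :=
  ZFSet.sep (fun w => ∃ a b c, w = pair (pair a b) c ∧ pair a c ∈ y) x

-- This is how a dummy variable is inserted: if tuples are coded by left-nested pairs, the entry `b`
-- before the last one is ignored. In the same way `memPart` and `eqPart` code the atomic formulas
-- in the last two variables.
@[simp] theorem pair_mem_insPart {x y a b c : ZFSet.{u}} :
    pair (pair a b) c ∈ insPart x y ↔ pair (pair a b) c ∈ x ∧ pair a c ∈ y := by
  simp only [insPart, mem_sep, pair_inj, and_congr_right_iff]
  exact fun _ => ⟨fun ⟨_, _, _, h, h'⟩ => by simp_all, fun h => ⟨a, b, c, by simp_all⟩⟩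

namespace Logic

variable {𝓛 : Logic p B} {Γ : Type (u + 1)} [Cxt B (Subtype p) Γ]
variable {s s' t t' r r' : Γ → Subtype p} [tc : TransCl p]

theorem eq_sdiff_iff (x y z : Subtype p) : x.1 = y.1 \ z.1 ↔
    (∀ w : Subtype p, w.1 ∈ x.1 → w.1 ∈ y.1 ∧ w.1 ∉ z.1) ∧
      ∀ w : Subtype p, w.1 ∈ y.1 → w.1 ∉ z.1 → w.1 ∈ x.1 := by
  refine ⟨fun h => by rw [h]; simp +contextual, fun h => ZFSet.ext fun w => ?_⟩
  rw [mem_sdiff]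
  exact ⟨fun hw => h.1 ⟨w, tc.out x.2 hw⟩ hw, fun hw => h.2 ⟨w, tc.out y.2 hw.1⟩ hw.1 hw.2⟩

instance R.sdiff [𝓛.T s s'] [𝓛.T t t'] [𝓛.T r r'] :
    𝓛.R (fun g => (s g).1 = (t g).1 \ (r g).1) (fun g => (s' g).1 = (t' g).1 \ (r' g).1) :=
  (inferInstance : 𝓛.R
    (fun g => (∀ w : Subtype p, w.1 ∈ (s g).1 → w.1 ∈ (t g).1 ∧ ¬ w.1 ∈ (r g).1) ∧
      ∀ w : Subtype p, w.1 ∈ (t g).1 → ¬ w.1 ∈ (r g).1 → w.1 ∈ (s g).1)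
    (fun g => (∀ w : Subtype p, w.1 ∈ (s' g).1 → w.1 ∈ (t' g).1 ∧ ¬ w.1 ∈ (r' g).1) ∧
      ∀ w : Subtype p, w.1 ∈ (t' g).1 → ¬ w.1 ∈ (r' g).1 → w.1 ∈ (s' g).1)).congr
    (fun _ => eq_sdiff_iff _ _ _) (fun _ => eq_sdiff_iff _ _ _)

theorem eq_prod_iff (x y z : Subtype p) : x.1 = prod y.1 z.1 ↔
    (∀ w : Subtype p, w.1 ∈ x.1 → ∃ a : Subtype p, a.1 ∈ y.1 ∧ ∃ b : Subtype p, b.1 ∈ z.1 ∧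
      w.1 = ZFSet.pair a.1 b.1) ∧
    ∀ a : Subtype p, a.1 ∈ y.1 → ∀ b : Subtype p, b.1 ∈ z.1 → ZFSet.pair a.1 b.1 ∈ x.1 := by
  constructor
  · intro h
    rw [h]
    refine ⟨fun w hw => ?_, fun a ha b hb => by simp [ha, hb]⟩
    obtain ⟨a, ha, b, hb, e⟩ := mem_prod.1 hw
    exact ⟨⟨a, tc.out y.2 ha⟩, ha, ⟨b, tc.out z.2 hb⟩, hb, e⟩
  · refine fun h => ZFSet.ext fun w => ⟨fun hw => ?_, fun hw => ?_⟩
    · obtain ⟨a, ha, b, hb, e⟩ := h.1 ⟨w, tc.out x.2 hw⟩ hw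
      exact mem_prod.2 ⟨_, ha, _, hb, e⟩
    · obtain ⟨a, ha, b, hb, rfl⟩ := mem_prod.1 hw
      exact h.2 ⟨a, tc.out y.2 ha⟩ ha ⟨b, tc.out z.2 hb⟩ hb

instance R.prod [𝓛.T s s'] [𝓛.T t t'] [𝓛.T r r'] :
    𝓛.R (fun g => (s g).1 = ZFSet.prod (t g).1 (r g).1)
      (fun g => (s' g).1 = ZFSet.prod (t' g).1 (r' g).1) :=
  (inferInstance : 𝓛.R
    (fun g => (∀ w : Subtype p, w.1 ∈ (s g).1 → ∃ a : Subtype p, a.1 ∈ (t g).1 ∧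
        ∃ b : Subtype p, b.1 ∈ (r g).1 ∧ w.1 = ZFSet.pair a.1 b.1) ∧
      ∀ a : Subtype p, a.1 ∈ (t g).1 → ∀ b : Subtype p, b.1 ∈ (r g).1 →
        ZFSet.pair a.1 b.1 ∈ (s g).1)
    (fun g => (∀ w : Subtype p, w.1 ∈ (s' g).1 → ∃ a : Subtype p, a.1 ∈ (t' g).1 ∧
        ∃ b : Subtype p, b.1 ∈ (r' g).1 ∧ w.1 = ZFSet.pair a.1 b.1) ∧
      ∀ a : Subtype p, a.1 ∈ (t' g).1 → ∀ b : Subtype p, b.1 ∈ (r' g).1 →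
        ZFSet.pair a.1 b.1 ∈ (s' g).1)).congr
    (fun _ => eq_prod_iff _ _ _) (fun _ => eq_prod_iff _ _ _)

theorem eq_dom_iff (x y : Subtype p) : x.1 = dom y.1 ↔
    (∀ a : Subtype p, a.1 ∈ x.1 → ∃ c d : Subtype p, ZFSet.pair c.1 d.1 ∈ y.1 ∧ a = c) ∧
    ∀ a b : Subtype p, ZFSet.pair a.1 b.1 ∈ y.1 → a.1 ∈ x.1 := by
  constructor
  · intro h
    rw [h]
    refine ⟨fun a ha => ?_, fun a b h => mem_dom.2 ⟨_, h⟩⟩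
    obtain ⟨b, hb⟩ := mem_dom.1 ha
    exact ⟨a, ⟨b, right_mem_of_pair_mem y.2 hb⟩, hb, rfl⟩
  · refine fun h => ZFSet.ext fun a => ⟨fun ha => ?_, fun ha => ?_⟩
    · obtain ⟨c, d, hc, e⟩ := h.1 ⟨a, tc.out x.2 ha⟩ ha
      exact mem_dom.2 ⟨d, by rwa [← e] at hc⟩
    · obtain ⟨b, hb⟩ := mem_dom.1 ha
      exact h.2 ⟨a, left_mem_of_pair_mem y.2 hb⟩ ⟨b, right_mem_of_pair_mem y.2 hb⟩ hb

instance R.dom [𝓛.T s s'] [𝓛.T t t'] :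
    𝓛.R (fun g => (s g).1 = RankEmbedding.dom (t g).1)
      (fun g => (s' g).1 = RankEmbedding.dom (t' g).1) :=
  (inferInstance : 𝓛.R
    (fun g => (∀ a : Subtype p, a.1 ∈ (s g).1 →
        ∃ c d : Subtype p, ZFSet.pair c.1 d.1 ∈ (t g).1 ∧ a = c) ∧
      ∀ a b : Subtype p, ZFSet.pair a.1 b.1 ∈ (t g).1 → a.1 ∈ (s g).1)
    (fun g => (∀ a : Subtype p, a.1 ∈ (s' g).1 →
        ∃ c d : Subtype p, ZFSet.pair c.1 d.1 ∈ (t' g).1 ∧ a = c) ∧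
      ∀ a b : Subtype p, ZFSet.pair a.1 b.1 ∈ (t' g).1 → a.1 ∈ (s' g).1)).congr
    (fun _ => eq_dom_iff _ _) (fun _ => eq_dom_iff _ _)

theorem eq_sep_iff (x y : Subtype p) (P : Subtype p → Prop) (Q : ZFSet.{u} → Prop)
    (hPQ : ∀ w : Subtype p, P w ↔ Q w.1) : x.1 = ZFSet.sep Q y.1 ↔
    (∀ w : Subtype p, w.1 ∈ x.1 → w.1 ∈ y.1 ∧ P w) ∧
      ∀ w : Subtype p, w.1 ∈ y.1 → P w → w.1 ∈ x.1 := by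
  refine ⟨fun h => by rw [h]; simp +contextual [hPQ], fun h => ZFSet.ext fun w => ?_⟩
  rw [mem_sep]
  exact ⟨fun hw => (h.1 ⟨w, tc.out x.2 hw⟩ hw).imp_right (hPQ _).1,
    fun hw => h.2 ⟨w, tc.out y.2 hw.1⟩ hw.1 ((hPQ _).2 hw.2)⟩

theorem R.sep {P P' : Γ → Subtype p → Prop} {Q Q' : Γ → ZFSet.{u} → Prop} [𝓛.T s s'] [𝓛.T t t']
    [𝓛.R (fun h : Γ × Subtype p => P h.1 h.2) (fun h : Γ × Subtype p => P' h.1 h.2)]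
    (hPQ : ∀ (g : Γ) (w : Subtype p), P g w ↔ Q g w.1)
    (hPQ' : ∀ (g : Γ) (w : Subtype p), P' g w ↔ Q' g w.1) :
    𝓛.R (fun g => (s g).1 = ZFSet.sep (Q g) (t g).1)
      (fun g => (s' g).1 = ZFSet.sep (Q' g) (t' g).1) :=
  (inferInstance : 𝓛.R
    (fun g => (∀ w : Subtype p, w.1 ∈ (s g).1 → w.1 ∈ (t g).1 ∧ P g w) ∧
      ∀ w : Subtype p, w.1 ∈ (t g).1 → P g w → w.1 ∈ (s g).1)
    (fun g => (∀ w : Subtype p, w.1 ∈ (s' g).1 → w.1 ∈ (t' g).1 ∧ P' g w) ∧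
      ∀ w : Subtype p, w.1 ∈ (t' g).1 → P' g w → w.1 ∈ (s' g).1)).congr
    (fun g => eq_sep_iff _ _ _ _ (hPQ g)) (fun g => eq_sep_iff _ _ _ _ (hPQ' g))

theorem exists_triple_iff (w : Subtype p) (P : ZFSet.{u} → ZFSet.{u} → ZFSet.{u} → Prop) :
    (∃ q c : Subtype p, w.1 = ZFSet.pair q.1 c.1 ∧
      ∃ a b : Subtype p, q.1 = ZFSet.pair a.1 b.1 ∧ P a.1 b.1 c.1) ↔
    ∃ a b c, w.1 = ZFSet.pair (ZFSet.pair a b) c ∧ P a b c := by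
  constructor
  · rintro ⟨q, c, hw, a, b, hq, h⟩
    exact ⟨a, b, c, by rw [hw, hq], h⟩
  · rintro ⟨a, b, c, hw, h⟩
    have h1 : ({ZFSet.pair a b, c} : ZFSet) ∈ w.1 := by rw [hw]; simp [ZFSet.pair]
    have h2 : p (ZFSet.pair a b) := tc.out (tc.out w.2 h1) (by simp)
    have h3 : p ({a, b} : ZFSet) := tc.out h2 (by simp [ZFSet.pair])
    exact ⟨⟨_, h2⟩, ⟨c, tc.out (tc.out w.2 h1) (by simp)⟩, hw, ⟨a, tc.out h3 (by simp)⟩,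
      ⟨b, tc.out h3 (by simp)⟩, rfl, h⟩

instance R.memPart [𝓛.T s s'] [𝓛.T t t'] :
    𝓛.R (fun g => (s g).1 = RankEmbedding.memPart (t g).1)
      (fun g => (s' g).1 = RankEmbedding.memPart (t' g).1) :=
  R.sep (fun _ _ => exists_triple_iff _ fun _ b c => b ∈ c)
    (fun _ _ => exists_triple_iff _ fun _ b c => b ∈ c)

instance R.eqPart [𝓛.T s s'] [𝓛.T t t'] :
    𝓛.R (fun g => (s g).1 = RankEmbedding.eqPart (t g).1)
      (fun g => (s' g).1 = RankEmbedding.eqPart (t' g).1) :=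
  R.sep (fun _ _ => exists_triple_iff _ fun _ b c => b = c)
    (fun _ _ => exists_triple_iff _ fun _ b c => b = c)

instance R.insPart [𝓛.T s s'] [𝓛.T t t'] [𝓛.T r r'] :
    𝓛.R (fun g => (s g).1 = RankEmbedding.insPart (t g).1 (r g).1)
      (fun g => (s' g).1 = RankEmbedding.insPart (t' g).1 (r' g).1) :=
  R.sep (fun g _ => exists_triple_iff _ fun a _ c => ZFSet.pair a c ∈ (r g).1)
    (fun g _ => exists_triple_iff _ fun a _ c => ZFSet.pair a c ∈ (r' g).1)

end Logic
end RankEmbedding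

namespace RankEmbedding

open ZFSet

variable {p : ZFSet.{u} → Prop}

/-! ## Predicates that are definable from parameters -/

section Definable

open Language

/-- The valuation of parameters and variables. -/
def paramVal {k : ℕ} (v : Fin k → Subtype p) : (Set.univ : Set (Subtype p)) ⊕ Fin k → Subtype p :=
  Sum.elim (↑) v

/-- The membership symbol. -/
def memSymb : LSet.Relations 2 := SetRel.mem

theorem realize_mem {α : Type*} {n : ℕ} (s t : LSet.Term (α ⊕ Fin n)) (v : α → Subtype p)
    (xs : Fin n → Subtype p) :
    (memSymb.boundedFormula₂ s t).Realize v xs ↔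
      (s.realize (Sum.elim v xs)).1 ∈ (t.realize (Sum.elim v xs)).1 := by
  exact BoundedFormula.realize_rel₂

theorem term_realize_snoc {α : Type*} {n : ℕ} (t : LSet.Term (α ⊕ Fin n)) (v : α → Subtype p)
    (xs : Fin n → Subtype p) (x : Subtype p) :
    (t.relabel (Sum.map id Fin.castSucc)).realize (Sum.elim v (Fin.snoc xs x)) =
      t.realize (Sum.elim v xs) := by
  rw [Term.realize_relabel]
  congr 1
  ext i
  cases i <;> simp

/-- The predicates in `k` free variables that are definable from parameters. -/
def definable (p : ZFSet.{u} → Prop) (k : ℕ) : Logic p (Fin k → Subtype p) where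
  Rel {Γ} c P P' := (P = P') ∧
    ∃ φ : LSet.BoundedFormula ((Set.univ : Set (Subtype p)) ⊕ Fin k) c.size,
      ∀ g : Γ, φ.Realize (paramVal (c.base g)) (c.tail g) ↔ P g
  Trm {Γ} c t t' := (t = t') ∧
    ∃ τ : LSet.Term (((Set.univ : Set (Subtype p)) ⊕ Fin k) ⊕ Fin c.size),
      ∀ g : Γ, τ.realize (Sum.elim (paramVal (c.base g)) (c.tail g)) = t g
  last {Γ} c := ⟨rfl, Term.var (Sum.inr (Fin.last c.size)), fun g => by
    simp [Cxt.tail]⟩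
  weak {Γ} c t t' := by
    rintro ⟨rfl, τ, h⟩
    exact ⟨rfl, τ.relabel (Sum.map id Fin.castSucc), fun g =>
      (term_realize_snoc τ _ _ _).trans (h g.1)⟩
  mem {Γ} c s s' t t' := by
    rintro ⟨rfl, σ, h⟩ ⟨rfl, τ, h'⟩
    exact ⟨rfl, memSymb.boundedFormula₂ σ τ, fun g => by
      rw [realize_mem, h, h']⟩
  not {Γ} c P P' := by
    rintro ⟨rfl, φ, h⟩
    exact ⟨rfl, φ.not, fun g => by rw [BoundedFormula.realize_not, h]⟩
  and {Γ} c P P' Q Q' := by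
    rintro ⟨rfl, φ, h⟩ ⟨rfl, ψ, h'⟩
    exact ⟨rfl, φ ⊓ ψ, fun g => by rw [BoundedFormula.realize_inf, h, h']⟩
  bex {Γ} c t t' P P' := by
    rintro ⟨rfl, τ, h⟩ ⟨rfl, φ, h'⟩
    refine ⟨rfl, (memSymb.boundedFormula₂
      (Term.var (Sum.inr (Fin.last c.size))) (τ.relabel (Sum.map id Fin.castSucc)) ⊓ φ).ex,
      fun g => ?_⟩
    rw [BoundedFormula.realize_ex]
    refine exists_congr fun x => ?_
    rw [BoundedFormula.realize_inf, realize_mem, term_realize_snoc, h]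
    exact and_congr (by simp) (h' (g, x))

variable {k : ℕ} {Γ : Type (u + 1)} [c : Cxt (Fin k → Subtype p) (Subtype p) Γ]

instance definable.const (x : Subtype p) : (definable p k).T (fun _ : Γ => x) (fun _ : Γ => x) :=
  ⟨rfl, Term.var (Sum.inl (Sum.inl ⟨x, trivial⟩)), fun _ => rfl⟩

instance definable.var (f : Γ → Fin k → Subtype p) [h : Prj (Fin k → Subtype p) p f] (i : Fin k) :
    (definable p k).T (fun g => f g i) (fun g => f g i) :=
  ⟨h.out (definable p k) (t := fun g => g i) (t' := fun g => g i)
    ⟨rfl, Term.var (Sum.inl (Sum.inr i)), fun _ => rfl⟩⟩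

instance definable.ex {P P' : Γ → Subtype p → Prop}
    [h : (definable p k).R (fun h : Γ × Subtype p => P h.1 h.2)
      (fun h : Γ × Subtype p => P' h.1 h.2)] :
    (definable p k).R (fun g => ∃ x, P g x) (fun g => ∃ x, P' g x) := by
  obtain ⟨e, φ, h⟩ := h.out
  refine ⟨funext fun g => propext (exists_congr fun x => iff_of_eq (congrFun e (g, x))), φ.ex,
    fun g => ?_⟩
  rw [BoundedFormula.realize_ex]
  exact exists_congr fun x => h (g, x)

instance definable.all {P P' : Γ → Subtype p → Prop}
    [h : (definable p k).R (fun h : Γ × Subtype p => P h.1 h.2)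
      (fun h : Γ × Subtype p => P' h.1 h.2)] :
    (definable p k).R (fun g => ∀ x, P g x) (fun g => ∀ x, P' g x) := by
  obtain ⟨e, φ, h⟩ := h.out
  refine ⟨funext fun g => propext (forall_congr' fun x => iff_of_eq (congrFun e (g, x))), φ.all,
    fun g => ?_⟩
  rw [BoundedFormula.realize_all]
  exact forall_congr' fun x => h (g, x)

theorem definable_of_rel {P P' : (Fin k → Subtype p) → Prop} (h : (definable p k).R P P') :
    (Set.univ : Set (Subtype p)).Definable LSet {v | P v} := by
  obtain ⟨_, φ, h⟩ := h.out
  rw [Set.definable_iff_exists_formula_sum]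
  refine ⟨φ, Set.ext fun v => ((h v).symm.trans (iff_of_eq ?_))⟩
  exact congrArg _ (Subsingleton.elim (α := Fin 0 → Subtype p) _ _)

end Definable

/-! ## Predicates that are given by `Σ₀` formulas -/

section Sigma0

open Language

/-- The predicates in `k` free variables that are given by `Σ₀` formulas. -/
def sigma0 (p : ZFSet.{u} → Prop) (k : ℕ) : Logic p (Fin k → Subtype p) where
  Rel {Γ} c P P' := (P = P') ∧ ∃ φ : LSet.BoundedFormula (Fin k) c.size,
    IsSigma0 φ ∧ ∀ g : Γ, φ.Realize (c.base g) (c.tail g) ↔ P g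
  Trm {Γ} c t t' := (t = t') ∧ ∃ a : Fin k ⊕ Fin c.size,
    ∀ g : Γ, Sum.elim (c.base g) (c.tail g) a = t g
  last {Γ} c := ⟨rfl, Sum.inr (Fin.last c.size), fun g => by simp [Cxt.tail]⟩
  weak {Γ} c t t' := by
    rintro ⟨rfl, a, h⟩
    refine ⟨rfl, Sum.map id Fin.castSucc a, fun g => ?_⟩
    refine Eq.trans ?_ (h g.1)
    cases a <;> simp [Cxt.tail, Cxt.base]
  mem {Γ} c s s' t t' := by
    rintro ⟨rfl, a, h⟩ ⟨rfl, b, h'⟩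
    refine ⟨rfl, memFormula (Term.var a) (Term.var b), .mem _ _, fun g => ?_⟩
    exact (realize_mem _ _ _ _).trans (by rw [Term.realize_var, Term.realize_var, h, h'])
  not {Γ} c P P' := by
    rintro ⟨rfl, φ, hφ, h⟩
    exact ⟨rfl, φ.not, .imp hφ .falsum, fun g => by rw [BoundedFormula.realize_not, h]⟩
  and {Γ} c P P' Q Q' := by
    rintro ⟨rfl, φ, hφ, h⟩ ⟨rfl, ψ, hψ, h'⟩
    exact ⟨rfl, φ ⊓ ψ, .imp (.imp hφ (.imp hψ .falsum)) .falsum, fun g => by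
      rw [BoundedFormula.realize_inf, h, h']⟩
  bex {Γ} c t t' P P' := by
    rintro ⟨rfl, a, h⟩ ⟨rfl, φ, hφ, h'⟩
    refine ⟨rfl, (newMem a ⊓ φ).ex, .bex a hφ, fun g => ?_⟩
    rw [BoundedFormula.realize_ex]
    refine exists_congr fun x => ?_
    rw [BoundedFormula.realize_inf]
    refine and_congr ((realize_mem _ _ _ _).trans ?_) (h' (g, x))
    rw [Term.realize_var, Term.realize_var, ← h]
    cases a <;> simp

variable {k : ℕ} {Γ : Type (u + 1)} [c : Cxt (Fin k → Subtype p) (Subtype p) Γ]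

instance sigma0.var (f : Γ → Fin k → Subtype p) [h : Prj (Fin k → Subtype p) p f] (i : Fin k) :
    (sigma0 p k).T (fun g => f g i) (fun g => f g i) :=
  ⟨h.out (sigma0 p k) (t := fun g => g i) (t' := fun g => g i) ⟨rfl, Sum.inl i, fun _ => rfl⟩⟩

end Sigma0

end RankEmbedding

namespace RankEmbedding

open ZFSet

/-! ## Sets in a transitive model of ZF -/

variable {N : Set ZFSet.{u}}

/-- The elements of the class `N`, as a type. -/
abbrev El (N : Set ZFSet.{u}) : Type (u + 1) := Subtype fun x : ZFSet.{u} => x ∈ N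

instance [hN : Fact (IsTransitiveZFModel N)] : TransCl (fun x => x ∈ N) :=
  ⟨fun hx hy => hN.out.transitive _ hx _ hy⟩

/-- The power set in the sense of `N`. -/
noncomputable def pw (N : Set ZFSet.{u}) (x : ZFSet.{u}) : ZFSet.{u} :=
  ZFSet.sep (fun y => y ∈ N) (powerset x)

@[simp] theorem mem_pw {x y : ZFSet.{u}} : y ∈ pw N x ↔ y ⊆ x ∧ y ∈ N := by simp [pw]

variable [hN : Fact (IsTransitiveZFModel N)]

/-- Every use of Separation passes through here. The instance argument finds the formula from the
shape of `P`, and `hQ` replaces quantifiers over all sets by quantifiers over `N`. -/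
theorem sep_mem_of_definable {x : ZFSet.{u}} (hx : x ∈ N) (Q : ZFSet.{u} → Prop)
    (P : El N → Prop)
    [h : (definable (fun x => x ∈ N) 1).R (fun v : Fin 1 → El N => P (v 0))
      (fun v : Fin 1 → El N => P (v 0))]
    (hQ : ∀ w : El N, w.1 ∈ x → (Q w.1 ↔ P w)) : ZFSet.sep Q x ∈ N := by
  obtain ⟨y, hy⟩ := hN.out.isZFModel.separation {w | P w} (definable_of_rel h) ⟨x, hx⟩
  have : ZFSet.sep Q x = y.1 := by
    ext z
    rw [mem_sep]
    constructor
    · intro hz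
      have hzN : z ∈ N := TransCl.out (p := fun x => x ∈ N) hx hz.1
      exact (hy ⟨z, hzN⟩).2 ⟨hz.1, (hQ ⟨z, hzN⟩ hz.1).1 hz.2⟩
    · intro hz
      have hzN : z ∈ N := TransCl.out (p := fun x => x ∈ N) y.2 hz
      have := (hy ⟨z, hzN⟩).1 hz
      exact ⟨this.1, (hQ ⟨z, hzN⟩ this.1).2 this.2⟩
  exact this ▸ y.2

theorem mem_of_mem {x y : ZFSet.{u}} (hx : x ∈ N) (hy : y ∈ x) : y ∈ N :=
  hN.out.transitive _ hx _ hy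

theorem upair_mem {x y : ZFSet.{u}} (hx : x ∈ N) (hy : y ∈ N) : ({x, y} : ZFSet) ∈ N := by
  obtain ⟨z, hz⟩ := hN.out.isZFModel.pairing ⟨x, hx⟩ ⟨y, hy⟩
  have : ({x, y} : ZFSet) = z.1 := by
    ext w
    rw [ZFSet.mem_pair]
    constructor
    · rintro (rfl | rfl)
      exacts [(hz ⟨_, hx⟩).2 (Or.inl rfl), (hz ⟨_, hy⟩).2 (Or.inr rfl)]
    · intro hw
      simpa [Subtype.ext_iff] using (hz ⟨w, mem_of_mem z.2 hw⟩).1 hw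
  exact this ▸ z.2

theorem singleton_mem {x : ZFSet.{u}} (hx : x ∈ N) : ({x} : ZFSet) ∈ N := by
  have := upair_mem hx hx; rwa [pair_eq_singleton] at this

theorem pair_mem {x y : ZFSet.{u}} (hx : x ∈ N) (hy : y ∈ N) : pair x y ∈ N :=
  upair_mem (singleton_mem hx) (upair_mem hx hy)

theorem sUnion_mem {x : ZFSet.{u}} (hx : x ∈ N) : (⋃₀ x : ZFSet) ∈ N := by
  obtain ⟨z, hz⟩ := hN.out.isZFModel.union ⟨x, hx⟩
  have : (⋃₀ x : ZFSet) = z.1 := by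
    ext w
    rw [mem_sUnion]
    constructor
    · rintro ⟨y, hy, hw⟩
      have hyN := mem_of_mem hx hy
      exact (hz ⟨w, mem_of_mem hyN hw⟩).2 ⟨⟨y, hyN⟩, hy, hw⟩
    · intro hw
      obtain ⟨y, hy, hw⟩ := (hz ⟨w, mem_of_mem z.2 hw⟩).1 hw
      exact ⟨y, hy, hw⟩
  exact this ▸ z.2

theorem union_mem {x y : ZFSet.{u}} (hx : x ∈ N) (hy : y ∈ N) : x ∪ y ∈ N :=
  sUnion_mem (upair_mem hx hy)

theorem pw_mem {x : ZFSet.{u}} (hx : x ∈ N) : pw N x ∈ N := by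
  obtain ⟨z, hz⟩ := hN.out.isZFModel.power ⟨x, hx⟩
  have : pw N x = z.1 := by
    ext w
    rw [mem_pw]
    constructor
    · rintro ⟨h, hw⟩
      exact (hz ⟨w, hw⟩).2 fun v hv => h hv
    · intro hw
      have hwN := mem_of_mem z.2 hw
      exact ⟨fun v hv => (hz ⟨w, hwN⟩).1 hw ⟨v, mem_of_mem hwN hv⟩ hv, hwN⟩
  exact this ▸ z.2

theorem sdiff_mem {x y : ZFSet.{u}} (hx : x ∈ N) (hy : y ∈ N) : x \ y ∈ N :=
  sep_mem_of_definable hx (fun w => w ∉ y) (fun w => ¬ w.1 ∈ (⟨y, hy⟩ : El N).1)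
    fun _ _ => Iff.rfl

theorem inter_mem {x y : ZFSet.{u}} (hx : x ∈ N) (hy : y ∈ N) : x ∩ y ∈ N :=
  sep_mem_of_definable hx (fun w => w ∈ y) (fun w => w.1 ∈ (⟨y, hy⟩ : El N).1)
    fun _ _ => Iff.rfl

theorem dom_mem {x : ZFSet.{u}} (hx : x ∈ N) : dom x ∈ N :=
  sep_mem_of_definable (sUnion_mem (sUnion_mem hx)) _
    (fun a => ∃ c d : El N, pair c.1 d.1 ∈ (⟨x, hx⟩ : El N).1 ∧ a = c) fun a _ =>
    ⟨fun ⟨_, hb⟩ => ⟨a, ⟨_, right_mem_of_pair_mem (p := fun x => x ∈ N) hx hb⟩, hb, rfl⟩,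
      fun ⟨_, _, h, e⟩ => ⟨_, e ▸ h⟩⟩

/-- A pair of elements of `x` and `y` is a set of subsets of `x ∪ y`, so Power Set and Separation
give the product. -/
theorem prod_subset_pw {x y : ZFSet.{u}} (hx : x ∈ N) (hy : y ∈ N) :
    prod x y ⊆ pw N (pw N (x ∪ y)) := by
  intro w hw
  obtain ⟨a, ha, b, hb, rfl⟩ := mem_prod.1 hw
  have haN := mem_of_mem hx ha
  have hbN := mem_of_mem hy hb
  rw [mem_pw]
  refine ⟨fun c hc => ?_, pair_mem haN hbN⟩
  rw [mem_pw]
  rw [pair, ZFSet.mem_pair] at hc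
  rcases hc with rfl | rfl
  · exact ⟨by intro d hd; simp_all, singleton_mem haN⟩
  · exact ⟨by intro d hd; rw [ZFSet.mem_pair] at hd; rcases hd with rfl | rfl <;> simp_all,
      upair_mem haN hbN⟩

theorem prod_mem {x y : ZFSet.{u}} (hx : x ∈ N) (hy : y ∈ N) : prod x y ∈ N := by
  have h := sep_mem_of_definable (pw_mem (pw_mem (union_mem hx hy))) (fun w => w ∈ prod x y)
    (fun w => ∃ a : El N, a.1 ∈ (⟨x, hx⟩ : El N).1 ∧ ∃ b : El N, b.1 ∈ (⟨y, hy⟩ : El N).1 ∧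
      w.1 = pair a.1 b.1) fun w _ => by
    rw [mem_prod]
    constructor
    · rintro ⟨a, ha, b, hb, e⟩
      exact ⟨⟨a, mem_of_mem hx ha⟩, ha, ⟨b, mem_of_mem hy hb⟩, hb, e⟩
    · rintro ⟨a, ha, b, hb, e⟩
      exact ⟨_, ha, _, hb, e⟩
  convert h
  ext w
  rw [mem_sep]
  exact ⟨fun hw => ⟨prod_subset_pw hx hy hw, hw⟩, fun hw => hw.2⟩

theorem memPart_mem {x : ZFSet.{u}} (hx : x ∈ N) : memPart x ∈ N :=
  sep_mem_of_definable hx _ (fun w => ∃ q c : El N, w.1 = pair q.1 c.1 ∧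
    ∃ a b : El N, q.1 = pair a.1 b.1 ∧ b.1 ∈ c.1) fun w _ =>
    (Logic.exists_triple_iff w fun _ b c => b ∈ c).symm

theorem eqPart_mem {x : ZFSet.{u}} (hx : x ∈ N) : eqPart x ∈ N :=
  sep_mem_of_definable hx _ (fun w => ∃ q c : El N, w.1 = pair q.1 c.1 ∧
    ∃ a b : El N, q.1 = pair a.1 b.1 ∧ b.1 = c.1) fun w _ =>
    (Logic.exists_triple_iff w fun _ b c => b = c).symm

theorem insPart_mem {x y : ZFSet.{u}} (hx : x ∈ N) (hy : y ∈ N) : insPart x y ∈ N :=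
  sep_mem_of_definable hx _ (fun w => ∃ q c : El N, w.1 = pair q.1 c.1 ∧
    ∃ a b : El N, q.1 = pair a.1 b.1 ∧ pair a.1 c.1 ∈ (⟨y, hy⟩ : El N).1) fun w _ =>
    (Logic.exists_triple_iff w fun a _ c => pair a c ∈ y).symm

end RankEmbedding

namespace RankEmbedding

open ZFSet

set_option synthInstance.maxSize 5000
set_option synthInstance.maxHeartbeats 400000

variable {N : Set ZFSet.{u}}

/-! ## Levels of the cumulative hierarchy -/

theorem mem_level {γ : Ordinal.{u}} {x : ZFSet.{u}} : x ∈ level N γ ↔ rank x < γ ∧ x ∈ N := by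
  simp [level, mem_vonNeumann]

theorem level_mono {γ γ' : Ordinal.{u}} (h : γ ≤ γ') : level N γ ⊆ level N γ' := fun x hx => by
  rw [mem_level] at *
  exact ⟨hx.1.trans_le h, hx.2⟩

theorem level_mem_level {γ γ' : Ordinal.{u}} (h : γ < γ') (hγ : level N γ ∈ N) :
    level N γ ∈ level N γ' :=
  mem_level.2 ⟨(rank_le_iff.2 fun _ hx => (mem_level.1 hx).1).trans_lt h, hγ⟩

theorem lt_of_level_mem_level {γ γ' : Ordinal.{u}} (h : level N γ ∈ level N γ') : γ < γ' := by
  by_contra h'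
  exact mem_irrefl _ (level_mono (not_lt.1 h') h)

/-- The levels of the cumulative hierarchy of `N`. -/
def IsLevel (N : Set ZFSet.{u}) (x : ZFSet.{u}) : Prop := ∃ γ, x = level N γ

theorem IsLevel.subset_of_mem {x v : ZFSet.{u}} (hv : IsLevel N v)
    (hN : ∀ x ∈ N, ∀ y ∈ x, y ∈ N) (h : x ∈ v) : x ⊆ v := by
  obtain ⟨γ, rfl⟩ := hv
  intro y hy
  rw [mem_level] at *
  exact ⟨(rank_lt_of_mem hy).trans h.1, hN _ h.2 _ hy⟩

theorem IsLevel.mem_of_subset {x y v : ZFSet.{u}} (hv : IsLevel N v) (h : x ∈ v) (hy : y ∈ N)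
    (hyx : y ⊆ x) : y ∈ v := by
  obtain ⟨γ, rfl⟩ := hv
  rw [mem_level] at *
  exact ⟨(rank_mono hyx).trans_lt h.1, hy⟩

theorem IsLevel.total {v w : ZFSet.{u}} (hv : IsLevel N v) (hw : IsLevel N w) : v ⊆ w ∨ w ⊆ v := by
  obtain ⟨γ, rfl⟩ := hv
  obtain ⟨γ', rfl⟩ := hw
  exact (le_total γ γ').imp level_mono level_mono

theorem IsLevel.mem_or_eq_or_mem {v w : ZFSet.{u}} (hv : IsLevel N v) (hw : IsLevel N w)
    (hv' : v ∈ N) (hw' : w ∈ N) : v ∈ w ∨ v = w ∨ w ∈ v := by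
  obtain ⟨γ, rfl⟩ := hv
  obtain ⟨γ', rfl⟩ := hw
  rcases lt_trichotomy γ γ' with h | rfl | h
  exacts [Or.inl (level_mem_level h hv'), Or.inr (Or.inl rfl), Or.inr (Or.inr (level_mem_level h hw'))]

theorem IsLevel.mem_of_ssubset {v w : ZFSet.{u}} (hv : IsLevel N v) (hw : IsLevel N w)
    (hv' : v ∈ N) (hw' : w ∈ N) (h : v ⊆ w) (hne : v ≠ w) : v ∈ w := by
  rcases hv.mem_or_eq_or_mem hw hv' hw' with h' | h' | h'
  · exact h'
  · exact absurd h' hne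
  · exact absurd (h h') (mem_irrefl _)

/-- The class `V` is a level of `N` of limit height, in `N`, all of whose predecessors are in
`N`. -/
class LimitLevel (N : Set ZFSet.{u}) (V : ZFSet.{u}) : Prop where
  mem : V ∈ N
  exists_eq : ∃ δ : Ordinal.{u}, Order.IsSuccLimit δ ∧ V = level N δ ∧ ∀ γ < δ, γ.toZFSet ∈ N

/-- The rank of `x` for the membership relation between elements of `X`. -/
noncomputable def rk (X x : ZFSet.{u}) : Ordinal.{u} :=
  -- The index type is shrunk so that the supremum exists in `Ordinal.{u}`.
  ⨆ y : {y : Shrink.{u} x // ((equivShrink x).symm y).1 ∈ X},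
    Order.succ (rk X ((equivShrink x).symm y.1).1)
termination_by x
decreasing_by exact ((equivShrink x).symm y.1).2

theorem lt_rk {X x : ZFSet.{u}} {γ : Ordinal.{u}} :
    γ < rk X x ↔ ∃ y ∈ x, y ∈ X ∧ γ ≤ rk X y := by
  rw [rk, Ordinal.lt_iSup_iff]
  constructor
  · rintro ⟨y, hy⟩
    exact ⟨_, ((equivShrink x).symm y.1).2, y.2, Order.lt_succ_iff.1 hy⟩
  · rintro ⟨y, hy, hyX, h⟩
    exact ⟨⟨equivShrink x ⟨y, hy⟩, by simpa using hyX⟩, by simpa using h⟩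

theorem rk_le_rank (X x : ZFSet.{u}) : rk X x ≤ rank x := by
  induction x using ZFSet.inductionOn with
  | _ x ih =>
    refine le_of_forall_lt fun γ hγ => ?_
    obtain ⟨y, hy, -, h⟩ := lt_rk.1 hγ
    exact (h.trans (ih y hy)).trans_lt (rank_lt_of_mem hy)

/-- Besides transitive `X`, the case of interest is a set `X` of levels: there `rk X` gives the
position in the increasing enumeration of `X`, that is, its collapse. -/
theorem rk_eq_rank {X x : ZFSet.{u}} (hX : X.IsTransitive) (hx : x ∈ X) : rk X x = rank x := by
  induction x using ZFSet.inductionOn with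
  | _ x ih =>
    refine (rk_le_rank X x).antisymm (le_of_forall_lt fun γ hγ => ?_)
    obtain ⟨y, hy, h⟩ := lt_rank_iff.1 hγ
    have hyX := hX x hx hy
    exact lt_rk.2 ⟨y, hy, hyX, (ih y hy hyX).symm ▸ h⟩

/-- The level of `N` whose height is the relative rank of `x`. -/
noncomputable def lrank (N : Set ZFSet.{u}) (X x : ZFSet.{u}) : ZFSet.{u} := level N (rk X x)

theorem isLevel_lrank (X x : ZFSet.{u}) : IsLevel N (lrank N X x) := ⟨_, rfl⟩

/-- The graph of the relative rank on `X`. -/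
noncomputable def lrankGraph (N : Set ZFSet.{u}) (X : ZFSet.{u}) : ZFSet.{u} :=
  ZFSet.range fun x : X => pair x.1 (lrank N X x.1)

theorem pair_mem_lrankGraph {X x v : ZFSet.{u}} :
    pair x v ∈ lrankGraph N X ↔ x ∈ X ∧ v = lrank N X x := by
  simp only [lrankGraph, mem_range, pair_inj, Subtype.exists]
  exact ⟨fun ⟨a, ha, h, h'⟩ => by subst h; exact ⟨ha, h'.symm⟩, fun ⟨h, h'⟩ => ⟨x, h, rfl, h'.symm⟩⟩

variable [hN : Fact (IsTransitiveZFModel N)]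

theorem subset_level_iff {γ : Ordinal.{u}} {x : ZFSet.{u}} (hx : x ∈ N) :
    x ⊆ level N γ ↔ rank x ≤ γ := by
  rw [rank_le_iff]
  exact ⟨fun h y hy => (mem_level.1 (h hy)).1, fun h y hy => mem_level.2 ⟨h hy, mem_of_mem hx hy⟩⟩

/-- The recursion `V_α = ⋃_{β < α} P(V_β)` along `rk X`, without mention of ordinals. It makes the
relative rank computable in `N` by approximations. -/
theorem mem_lrank {X x z : ZFSet.{u}} :
    z ∈ lrank N X x ↔ z ∈ N ∧ ∃ y ∈ x, y ∈ X ∧ z ⊆ lrank N X y := by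
  rw [lrank, mem_level, and_comm]
  refine and_congr_right fun hz => ?_
  rw [lt_rk]
  simp only [lrank, subset_level_iff hz]

theorem level_add_one {γ : Ordinal.{u}} : level N (γ + 1) = pw N (level N γ) := by
  ext x
  rw [mem_level, mem_pw, Order.lt_add_one_iff]
  exact and_congr_left fun hx => (subset_level_iff hx).symm

theorem IsLevel.pw {v : ZFSet.{u}} (hv : IsLevel N v) : IsLevel N (pw N v) := by
  obtain ⟨γ, rfl⟩ := hv
  exact ⟨γ + 1, level_add_one.symm⟩

/-- Approximations to the graph of the relative rank. -/
def IsRankApprox (X g : El N) : Prop :=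
  ∀ x v : El N, pair x.1 v.1 ∈ g.1 →
    (∀ y : El N, y.1 ∈ x.1 → y.1 ∈ X.1 → ∃ w : El N, pair y.1 w.1 ∈ g.1) ∧
    ∀ z : El N, z.1 ∈ v.1 ↔
      ∃ y : El N, y.1 ∈ x.1 ∧ ∃ w : El N, (y.1 ∈ X.1 ∧ pair y.1 w.1 ∈ g.1) ∧ z.1 ⊆ w.1

theorem IsRankApprox.eq {X g : El N} (hg : IsRankApprox X g) {x v : ZFSet.{u}}
    (h : pair x v ∈ g.1) : v = lrank N X x := by
  induction x using ZFSet.inductionOn generalizing v with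
  | _ x ih =>
    have hxN : x ∈ N := left_mem_of_pair_mem (p := fun x => x ∈ N) g.2 h
    have hvN : v ∈ N := right_mem_of_pair_mem (p := fun x => x ∈ N) g.2 h
    obtain ⟨h1, h2⟩ := hg ⟨x, hxN⟩ ⟨v, hvN⟩ h
    ext z
    rw [mem_lrank]
    constructor
    · intro hz
      have hzN := mem_of_mem hvN hz
      obtain ⟨y, hy, w, ⟨hyX, hw⟩, hzw⟩ := (h2 ⟨z, hzN⟩).1 hz
      exact ⟨hzN, y, hy, hyX, by rwa [← ih _ hy hw]⟩
    · rintro ⟨hzN, y, hy, hyX, hz⟩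
      have hyN := mem_of_mem hxN hy
      obtain ⟨w, hw⟩ := h1 ⟨y, hyN⟩ hy hyX
      exact (h2 ⟨z, hzN⟩).2 ⟨⟨y, hyN⟩, hy, w, ⟨hyX, hw⟩, by rwa [ih _ hy hw]⟩

theorem isRankApprox_of {X g : El N}
    (h : ∀ x v, pair x v ∈ g.1 → v = lrank N X x ∧
      ∀ y ∈ x, y ∈ X.1 → pair y (lrank N X y) ∈ g.1) : IsRankApprox X g := by
  intro x v hxv
  obtain ⟨hv, hx⟩ := h _ _ hxv
  have key : ∀ y ∈ x.1, y ∈ X.1 → ∃ w : El N, w.1 = lrank N X y ∧ pair y w.1 ∈ g.1 := fun y hy hyX =>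
    ⟨⟨_, right_mem_of_pair_mem (p := fun x => x ∈ N) g.2 (hx y hy hyX)⟩, rfl, hx y hy hyX⟩
  refine ⟨fun y hy hyX => (key _ hy hyX).imp fun _ h => h.2, fun z => ?_⟩
  rw [hv, mem_lrank]
  constructor
  · rintro ⟨-, y, hy, hyX, hz⟩
    obtain ⟨w, hw, hyw⟩ := key y hy hyX
    exact ⟨⟨y, mem_of_mem x.2 hy⟩, hy, w, ⟨hyX, hyw⟩, hw ▸ hz⟩
  · rintro ⟨y, hy, w, ⟨hyX, hyw⟩, hz⟩
    exact ⟨z.2, y, hy, hyX, by rwa [← (h _ _ hyw).1]⟩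

/-- Transfinite recursion inside `N`. The common bound `V` for the values makes the union `E` of all
approximations a subset of `X × P(V)` given by Separation. Every `x ∈ X` is reached, because `E`
with the pair at `x` added is again an approximation. -/
theorem lrankGraph_mem {X V : ZFSet.{u}} (hX : X ∈ N) (hV : V ∈ N)
    (hXV : ∀ x ∈ X, lrank N X x ⊆ V) : lrankGraph N X ∈ N := by
  set K := prod X (pw N V) with hK
  have hKN : K ∈ N := prod_mem hX (pw_mem hV)
  set E := ZFSet.sep (fun q => ∃ g : El N, IsRankApprox ⟨X, hX⟩ g ∧ q ∈ g.1) K with hE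
  have hEN : E ∈ N := sep_mem_of_definable hKN _
    (fun q => ∃ g : El N, (∀ x v : El N, pair x.1 v.1 ∈ g.1 →
    (∀ y : El N, y.1 ∈ x.1 → y.1 ∈ (⟨X, hX⟩ : El N).1 → ∃ w : El N, pair y.1 w.1 ∈ g.1) ∧
    ∀ z : El N, z.1 ∈ v.1 ↔
      ∃ y : El N, y.1 ∈ x.1 ∧ ∃ w : El N, (y.1 ∈ (⟨X, hX⟩ : El N).1 ∧ pair y.1 w.1 ∈ g.1) ∧ z.1 ⊆ w.1) ∧
      q.1 ∈ g.1) fun _ _ => Iff.rfl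
  have sound : ∀ x v, pair x v ∈ E → v = lrank N X x := fun x v h => by
    obtain ⟨-, g, hg, hgq⟩ := mem_sep.1 h
    exact hg.eq hgq
  have closed : ∀ x v, pair x v ∈ E → ∀ y ∈ x, y ∈ X → pair y (lrank N X y) ∈ E := by
    intro x v h y hy hyX
    obtain ⟨hq, g, hg, hgq⟩ := mem_sep.1 h
    have hxN := left_mem_of_pair_mem (p := fun x => x ∈ N) g.2 hgq
    have hvN := right_mem_of_pair_mem (p := fun x => x ∈ N) g.2 hgq
    obtain ⟨w, hw⟩ := (hg ⟨x, hxN⟩ ⟨v, hvN⟩ hgq).1 ⟨y, mem_of_mem hxN hy⟩ hy hyX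
    have e := hg.eq hw
    refine mem_sep.2 ⟨?_, g, hg, e ▸ hw⟩
    rw [hK, pair_mem_prod, mem_pw]
    exact ⟨hyX, hXV y hyX, e ▸ w.2⟩
  have complete : ∀ x ∈ X, pair x (lrank N X x) ∈ E := by
    intro x
    induction x using ZFSet.inductionOn with
    | _ x ih =>
      intro hx
      have hxN := mem_of_mem hX hx
      have hvN : lrank N X x ∈ N := by
        -- The value at `x` is in `N`, since it can be cut out of `V` by means of the values at the
        -- earlier `y`, which are recorded in `E`.
        have h := sep_mem_of_definable hV (fun z => z ∈ lrank N X x)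
          (fun z => ∃ y : El N, y.1 ∈ (⟨x, hxN⟩ : El N).1 ∧ ∃ w : El N,
            pair y.1 w.1 ∈ (⟨E, hEN⟩ : El N).1 ∧ z.1 ⊆ w.1) fun z _ => by
          rw [mem_lrank]
          constructor
          · rintro ⟨_, y, hy, hyX, hz⟩
            have := ih y hy hyX
            exact ⟨⟨y, mem_of_mem hxN hy⟩, hy, ⟨_, right_mem_of_pair_mem (p := fun x => x ∈ N)
              hEN this⟩, this, hz⟩
          · rintro ⟨y, hy, w, hyw, hz⟩
            refine ⟨z.2, y, hy, ?_, by rwa [← sound _ _ hyw]⟩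
            exact (pair_mem_prod.1 (mem_sep.1 (show pair y.1 w.1 ∈ E from hyw)).1).1
        convert h
        ext z
        rw [mem_sep]
        exact ⟨fun hz => ⟨hXV x hx hz, hz⟩, fun hz => hz.2⟩
      have hgN : E ∪ {pair x (lrank N X x)} ∈ N := union_mem hEN (singleton_mem (pair_mem hxN hvN))
      refine mem_sep.2 ⟨?_, ⟨_, hgN⟩, isRankApprox_of ?_, by simp⟩
      · rw [hK, pair_mem_prod, mem_pw]
        exact ⟨hx, hXV x hx, hvN⟩
      · intro x' v' h'
        simp only [mem_union, mem_singleton, pair_inj] at h' ⊢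
        rcases h' with h' | ⟨rfl, rfl⟩
        · exact ⟨sound _ _ h', fun y hy hyX => Or.inl (closed _ _ h' y hy hyX)⟩
        · exact ⟨rfl, fun y hy hyX => Or.inl (ih y hy hyX)⟩
  convert hEN
  ext q
  constructor
  · intro hq
    obtain ⟨x, rfl⟩ := mem_range.1 hq
    exact complete _ x.2
  · intro hq
    obtain ⟨x, hx, v, hv, rfl⟩ := mem_prod.1 (mem_sep.1 hq).1
    exact pair_mem_lrankGraph.2 ⟨hx, sound _ _ hq⟩

end RankEmbedding

namespace RankEmbedding

open ZFSet

set_option linter.unusedSectionVars false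
set_option synthInstance.maxSize 5000
set_option synthInstance.maxHeartbeats 400000

variable {N : Set ZFSet.{u}} {V : ZFSet.{u}}

/-! ## Closure properties of a level of limit height -/

section LimitLevel

variable [hN : Fact (IsTransitiveZFModel N)] [hV : LimitLevel N V]

namespace LimitLevel

variable (N)

include hN hV

theorem trans {x y : ZFSet.{u}} (hx : x ∈ V) (hy : y ∈ x) : y ∈ V := by
  obtain ⟨δ, hδ, rfl, -⟩ := hV.exists_eq
  rw [mem_level] at *
  exact ⟨(rank_lt_of_mem hy).trans hx.1, mem_of_mem hx.2 hy⟩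

theorem mem_of_subset {x y : ZFSet.{u}} (hx : x ∈ V) (hy : y ∈ N) (hyx : y ⊆ x) : y ∈ V := by
  obtain ⟨δ, hδ, rfl, -⟩ := hV.exists_eq
  rw [mem_level] at *
  exact ⟨(rank_mono hyx).trans_lt hx.1, hy⟩

theorem mem_N {x : ZFSet.{u}} (hx : x ∈ V) : x ∈ N := mem_of_mem (hV.mem) hx

theorem upair {x y : ZFSet.{u}} (hx : x ∈ V) (hy : y ∈ V) : ({x, y} : ZFSet) ∈ V := by
  obtain ⟨δ, hδ, rfl, -⟩ := hV.exists_eq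
  rw [mem_level] at *
  rw [rank_pair]
  exact ⟨max_lt (hδ.succ_lt hx.1) (hδ.succ_lt hy.1), upair_mem hx.2 hy.2⟩

theorem singleton {x : ZFSet.{u}} (hx : x ∈ V) : ({x} : ZFSet) ∈ V := by
  have := upair N hx hx; rwa [pair_eq_singleton] at this

theorem pair {x y : ZFSet.{u}} (hx : x ∈ V) (hy : y ∈ V) : ZFSet.pair x y ∈ V :=
  upair N (singleton N hx) (upair N hx hy)

theorem union {x y : ZFSet.{u}} (hx : x ∈ V) (hy : y ∈ V) : x ∪ y ∈ V := by
  obtain ⟨δ, hδ, rfl, -⟩ := hV.exists_eq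
  rw [mem_level] at *
  rw [rank_union]
  exact ⟨max_lt hx.1 hy.1, union_mem hx.2 hy.2⟩

theorem pw {x : ZFSet.{u}} (hx : x ∈ V) : pw N x ∈ V := by
  obtain ⟨δ, hδ, rfl, -⟩ := hV.exists_eq
  rw [mem_level] at *
  refine ⟨lt_of_le_of_lt (rank_mono (y := powerset x) sep_subset) ?_, pw_mem hx.2⟩
  rw [rank_powerset]
  exact hδ.succ_lt hx.1

theorem sdiff {x y : ZFSet.{u}} (hx : x ∈ V) (hy : y ∈ N) : x \ y ∈ V :=
  mem_of_subset N hx (sdiff_mem (mem_N N hx) hy) fun z hz => by simp_all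

theorem inter {x y : ZFSet.{u}} (hx : x ∈ V) (hy : y ∈ N) : x ∩ y ∈ V :=
  mem_of_subset N hx (inter_mem (mem_N N hx) hy) fun z hz => by simp_all

theorem prod {x y : ZFSet.{u}} (hx : x ∈ V) (hy : y ∈ V) : prod x y ∈ V :=
  mem_of_subset N (pw N (pw N (union N hx hy))) (prod_mem (mem_N N hx) (mem_N N hy))
    (prod_subset_pw (mem_N N hx) (mem_N N hy))

theorem pair_mem_iff {x y : ZFSet.{u}} : ZFSet.pair x y ∈ V ↔ x ∈ V ∧ y ∈ V := by
  refine ⟨fun h => ?_, fun h => pair N h.1 h.2⟩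
  have h1 : ({x, y} : ZFSet) ∈ V := trans N h (by simp [ZFSet.pair])
  exact ⟨trans N h1 (by simp), trans N h1 (by simp)⟩

theorem isTransitive : V.IsTransitive := fun _ hx _ hy => trans N hx hy

theorem lrank_subset {X x : ZFSet.{u}} (hx : x ∈ V) : lrank N X x ⊆ V := by
  obtain ⟨δ, hδ, rfl, -⟩ := hV.exists_eq
  exact level_mono ((rk_le_rank X x).trans (mem_level.1 hx).1.le)

theorem lrankGraph_mem {X : ZFSet.{u}} (hX : X ∈ N) (hXV : X ⊆ V) : lrankGraph N X ∈ N :=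
  RankEmbedding.lrankGraph_mem hX hV.mem fun _ hx => lrank_subset N (hXV hx)

theorem lrank_mem_N {X x : ZFSet.{u}} (hX : X ∈ N) (hXV : X ⊆ V) (hx : x ∈ X) :
    lrank N X x ∈ N :=
  right_mem_of_pair_mem (p := fun x => x ∈ N) (lrankGraph_mem N hX hXV)
    (pair_mem_lrankGraph.2 ⟨hx, rfl⟩)

theorem lrank_mem {X x : ZFSet.{u}} (hX : X ∈ N) (hXV : X ⊆ V) (hx : x ∈ X) :
    lrank N X x ∈ V := by
  have h1 := lrank_mem_N N hX hXV hx
  obtain ⟨δ, hδ, rfl, -⟩ := hV.exists_eq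
  refine level_mem_level ((rk_le_rank X x).trans_lt (mem_level.1 (hXV hx)).1) h1

/-- The level of height `γ` is the one attached to the ordinal `γ` itself; this is why `LimitLevel`
asks for the ordinals below `δ` to be in `N`. It defines the set of levels from the graph of the
rank. -/
theorem isLevel_iff {v : ZFSet.{u}} (hv : v ∈ V) : IsLevel N v ↔ ∃ x ∈ V, v = lrank N V x := by
  constructor
  · rintro ⟨γ, rfl⟩
    have ht := isTransitive (V := V) N
    obtain ⟨δ, hδ, e, h⟩ := hV.exists_eq
    have hγ : γ < δ := lt_of_level_mem_level (e ▸ hv)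
    have hγV : γ.toZFSet ∈ V := by rw [e, mem_level]; exact ⟨by simpa using hγ, h γ hγ⟩
    exact ⟨_, hγV, by rw [lrank, rk_eq_rank ht hγV]; simp⟩
  · rintro ⟨x, -, rfl⟩
    exact isLevel_lrank _ _

/-- Every set in `V` is a subset of a level in `V`. -/
theorem exists_level_subset {x : ZFSet.{u}} (hx : x ∈ V) : ∃ v ∈ V, IsLevel N v ∧ x ⊆ v := by
  refine ⟨lrank N V x, lrank_mem N hV.mem (fun _ h => h) hx, isLevel_lrank _ _, ?_⟩
  rw [lrank, subset_level_iff (mem_N N hx)]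
  exact (rk_eq_rank (isTransitive N) hx).ge

/-- Every set in `V` is an element of a level in `V`. -/
theorem exists_level {x : ZFSet.{u}} (hx : x ∈ V) : ∃ v ∈ V, IsLevel N v ∧ x ∈ v := by
  obtain ⟨v, hv, hl, h⟩ := exists_level_subset N hx
  exact ⟨_, pw N hv, hl.pw, mem_pw.2 ⟨h, mem_N N hx⟩⟩

end LimitLevel

/-- The set of the levels in `V`. -/
noncomputable def levels (N : Set ZFSet.{u}) (V : ZFSet.{u}) : ZFSet.{u} := ZFSet.sep (IsLevel N) V

theorem mem_levels {v : ZFSet.{u}} : v ∈ levels N V ↔ v ∈ V ∧ IsLevel N v := by simp [levels]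

theorem levels_mem : levels N V ∈ N :=
  sep_mem_of_definable hV.mem _ (fun v => ∃ x : El N, pair x.1 v.1 ∈
    (⟨lrankGraph N V, LimitLevel.lrankGraph_mem N hV.mem fun _ h => h⟩ : El N).1) fun v hv => by
    rw [LimitLevel.isLevel_iff N hv]
    constructor
    · rintro ⟨x, hx, h⟩
      exact ⟨⟨x, LimitLevel.mem_N N hx⟩, pair_mem_lrankGraph.2 ⟨hx, h⟩⟩
    · rintro ⟨x, hx⟩
      exact ⟨x.1, pair_mem_lrankGraph.1 hx⟩

end LimitLevel

end RankEmbedding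

namespace RankEmbedding

open ZFSet

set_option linter.unusedSectionVars false
set_option synthInstance.maxSize 5000
set_option synthInstance.maxHeartbeats 400000

variable {N : Set ZFSet.{u}} {V : ZFSet.{u}}

/-! ## Embeddings that preserve the basic set operations -/

theorem _root_.ZFSet.IsTransitive.of_pair_mem {b x y : ZFSet.{u}} (hb : b.IsTransitive)
    (h : pair x y ∈ b) : x ∈ b ∧ y ∈ b := by
  have h1 : ({x, y} : ZFSet) ∈ b := hb _ h (by simp [pair])
  exact ⟨hb _ h1 (by simp), hb _ h1 (by simp)⟩

theorem IsLevel.isTransitive [hN : Fact (IsTransitiveZFModel N)] {b : ZFSet.{u}}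
    (hl : IsLevel N b) : b.IsTransitive := fun _ hx => hl.subset_of_mem hN.out.transitive hx

/-- A map from `V` to `V`, in `N`, that preserves the basic set operations. -/
structure Emb (N : Set ZFSet.{u}) (V : ZFSet.{u}) where
  toFun : ZFSet.{u} → ZFSet.{u}
  -- A default value outside `V`, so that an embedding is determined by its graph.
  map_out {x : ZFSet.{u}} : x ∉ V → toFun x = ∅
  map_mem {x : ZFSet.{u}} : x ∈ V → toFun x ∈ V
  graph_mem : (ZFSet.range fun x : V => pair x.1 (toFun x.1)) ∈ N
  map_sdiff {x y : ZFSet.{u}} : x ∈ V → y ∈ V → toFun (x \ y) = toFun x \ toFun y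
  map_prod {x y : ZFSet.{u}} : x ∈ V → y ∈ V → toFun (prod x y) = prod (toFun x) (toFun y)
  map_dom {x : ZFSet.{u}} : x ∈ V → toFun (dom x) = dom (toFun x)
  map_singleton {x : ZFSet.{u}} : x ∈ V → toFun {x} = {toFun x}
  map_memPart {x : ZFSet.{u}} : x ∈ V → toFun (memPart x) = memPart (toFun x)
  map_eqPart {x : ZFSet.{u}} : x ∈ V → toFun (eqPart x) = eqPart (toFun x)
  map_insPart {x y : ZFSet.{u}} : x ∈ V → y ∈ V →
    toFun (insPart x y) = insPart (toFun x) (toFun y)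
  map_pw {x : ZFSet.{u}} : x ∈ V → toFun (pw N x) = pw N (toFun x)

instance : CoeFun (Emb N V) fun _ => ZFSet.{u} → ZFSet.{u} := ⟨Emb.toFun⟩

namespace Emb

/-- The graph of an embedding. -/
noncomputable def gr (k : Emb N V) : ZFSet.{u} := ZFSet.range fun x : V => pair x.1 (k x.1)

theorem gr_mem (k : Emb N V) : k.gr ∈ N := k.graph_mem

theorem pair_mem_gr {k : Emb N V} {x y : ZFSet.{u}} : pair x y ∈ k.gr ↔ x ∈ V ∧ y = k x := by
  simp only [gr, mem_range, pair_inj, Subtype.exists]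
  exact ⟨fun ⟨a, ha, h, h'⟩ => by subst h; exact ⟨ha, h'.symm⟩, fun ⟨h, h'⟩ => ⟨x, h, rfl, h'.symm⟩⟩

theorem toFun_eq_of_gr_eq {k l : Emb N V} (h : k.gr = l.gr) : k = l := by
  have : k.toFun = l.toFun := by
    funext x
    by_cases hx : x ∈ V
    · exact (pair_mem_gr.1 (h ▸ pair_mem_gr.2 ⟨hx, rfl⟩ : pair x (k x) ∈ l.gr)).2
    · rw [k.map_out hx, l.map_out hx]
  cases k; cases l; cases this; rfl

/-- An embedding as a self-map of the type of the elements of `V`. -/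
def sub (k : Emb N V) (x : V) : V := ⟨k x.1, k.map_mem x.2⟩

/-- The canonical extension of an embedding to the subsets of `V`. -/
noncomputable def ext (k : Emb N V) (A : ZFSet.{u}) : ZFSet.{u} :=
  ZFSet.sep (fun y => ∃ z ∈ V, z ⊆ A ∧ y ∈ k z) V

theorem mem_ext {k : Emb N V} {A y : ZFSet.{u}} :
    y ∈ k.ext A ↔ y ∈ V ∧ ∃ z ∈ V, z ⊆ A ∧ y ∈ k z := by simp [ext]

theorem ext_subset (k : Emb N V) (A : ZFSet.{u}) : k.ext A ⊆ V := sep_subset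

theorem ext_mono (k : Emb N V) {A B : ZFSet.{u}} (h : A ⊆ B) : k.ext A ⊆ k.ext B := fun y hy => by
  rw [mem_ext] at *
  exact ⟨hy.1, hy.2.imp fun z hz => ⟨hz.1, fun w hw => h (hz.2.1 hw), hz.2.2⟩⟩

variable [hN : Fact (IsTransitiveZFModel N)] [hV : LimitLevel N V] (k : Emb N V)

include hN hV

/-! ### Consequences of preserving the basic operations -/

theorem empty_mem : ∅ ∈ V := by
  have h : (∅ : ZFSet.{u}) ∈ N := by
    have := sdiff_mem hV.mem hV.mem
    rwa [show V \ V = ∅ from (eq_empty _).2 fun y => by simp] at this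
  obtain ⟨δ, hδ, rfl, -⟩ := hV.exists_eq
  exact mem_level.2 ⟨by simpa using hδ.bot_lt, h⟩

theorem map_empty : k ∅ = ∅ := by
  have h := k.map_sdiff (empty_mem (N := N)) (empty_mem (N := N))
  have e : ∀ x : ZFSet.{u}, x \ x = ∅ := fun x => (eq_empty _).2 fun y => by simp
  rwa [e, e] at h

/-- Inclusion is the equation `x \ y = ∅`. -/
theorem map_subset {x y : ZFSet.{u}} (hx : x ∈ V) (hy : y ∈ V) (h : x ⊆ y) : k x ⊆ k y := by
  have h1 := k.map_sdiff hx hy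
  rw [show x \ y = ∅ from (eq_empty _).2 fun z hz => (mem_sdiff.1 hz).2 (h (mem_sdiff.1 hz).1),
    map_empty] at h1
  intro z hz
  by_contra hzy
  exact notMem_empty z (h1 ▸ mem_sdiff.2 ⟨hz, hzy⟩)

theorem map_mem_map {x y : ZFSet.{u}} (hx : x ∈ V) (hy : y ∈ V) : k x ∈ k y ↔ x ∈ y := by
  have hs := LimitLevel.singleton N hx
  constructor
  · intro h
    by_contra hxy
    have e : ({x} : ZFSet) \ y = {x} := by
      ext z
      rw [mem_sdiff, mem_singleton]
      exact ⟨fun h => h.1, fun h => ⟨h, h ▸ hxy⟩⟩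
    have h1 := k.map_sdiff hs hy
    rw [e, k.map_singleton hx] at h1
    have : k x ∈ ({k x} : ZFSet) := by simp
    rw [h1] at this
    exact (mem_sdiff.1 this).2 h
  · intro h
    refine k.map_subset hs hy (fun z hz => (mem_singleton.1 hz) ▸ h) ?_
    rw [k.map_singleton hx]; simp

theorem map_inj {x y : ZFSet.{u}} (hx : x ∈ V) (hy : y ∈ V) : k x = k y ↔ x = y := by
  refine ⟨fun h => ?_, fun h => h ▸ rfl⟩
  have h1 : k x ∈ k {y} := by rw [k.map_singleton hy, h]; simp
  exact mem_singleton.1 ((k.map_mem_map hx (LimitLevel.singleton N hy)).1 h1)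

theorem map_inter {x y : ZFSet.{u}} (hx : x ∈ V) (hy : y ∈ V) : k (x ∩ y) = k x ∩ k y := by
  have e : ∀ x y : ZFSet.{u}, x ∩ y = x \ (x \ y) := fun x y => by
    ext z; simp only [mem_inter, mem_sdiff]; tauto
  rw [e, e, k.map_sdiff hx (LimitLevel.sdiff N hx (LimitLevel.mem_N N hy)), k.map_sdiff hx hy]

theorem map_union {x y : ZFSet.{u}} (hx : x ∈ V) (hy : y ∈ V) : k (x ∪ y) = k x ∪ k y := by
  have hu := LimitLevel.union N hx hy
  have h1 := k.map_sdiff hu hx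
  rw [show (x ∪ y) \ x = y \ x by ext z; simp only [mem_sdiff, mem_union]; tauto,
    k.map_sdiff hy hx] at h1
  have h2 := k.map_subset hx hu fun z hz => mem_union.2 (Or.inl hz)
  have h3 := k.map_subset hy hu fun z hz => mem_union.2 (Or.inr hz)
  ext z
  rw [mem_union]
  constructor
  · intro hz
    by_cases hzx : z ∈ k x
    · exact Or.inl hzx
    · have : z ∈ k y \ k x := h1 ▸ mem_sdiff.2 ⟨hz, hzx⟩
      exact Or.inr (mem_sdiff.1 this).1
  · rintro (h | h)
    exacts [h2 h, h3 h]

theorem map_upair {x y : ZFSet.{u}} (hx : x ∈ V) (hy : y ∈ V) : k {x, y} = {k x, k y} := by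
  have e : ∀ x y : ZFSet.{u}, ({x, y} : ZFSet) = {x} ∪ {y} := fun x y => by ext z; simp
  rw [e, e, k.map_union (LimitLevel.singleton N hx) (LimitLevel.singleton N hy),
    k.map_singleton hx, k.map_singleton hy]

theorem map_pair {x y : ZFSet.{u}} (hx : x ∈ V) (hy : y ∈ V) :
    k (pair x y) = pair (k x) (k y) := by
  rw [pair, k.map_upair (LimitLevel.singleton N hx) (LimitLevel.upair N hx hy),
    k.map_singleton hx, k.map_upair hx hy, pair]

theorem isTransitive_map {b : ZFSet.{u}} (hb : b ∈ V) (h : b.IsTransitive) :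
    (k b).IsTransitive := by
  have h1 : b ⊆ pw N b := fun x hx => mem_pw.2 ⟨h x hx, LimitLevel.mem_N N (LimitLevel.trans N hb hx)⟩
  have h2 := k.map_subset hb (LimitLevel.pw N hb) h1
  rw [k.map_pw hb] at h2
  exact fun x hx => (mem_pw.1 (h2 hx)).1

/-- An element `x` of `v` is a subset of an earlier level `e`. By induction `e ⊆ k e`, so `x` is in
`P(k e) = k (P(e)) ⊆ k v`. Hence the images of the levels cover `V`, which is what makes canonical
extensions computable level by level. -/
theorem level_subset_map {v : ZFSet.{u}} (hv : v ∈ V) (hl : IsLevel N v) : v ⊆ k v := by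
  obtain ⟨γ, rfl⟩ := hl
  induction γ using WellFoundedLT.induction with
  | _ γ ih =>
    intro x hx
    have hxV := LimitLevel.trans N hv hx
    have e : level N (rk V x) ∈ V := LimitLevel.lrank_mem N hV.mem (fun _ h => h) hxV
    have hr : rk V x < γ := by
      rw [rk_eq_rank (LimitLevel.isTransitive N) hxV]
      exact (mem_level.1 hx).1
    have hxe : x ⊆ level N (rk V x) := by
      rw [subset_level_iff (LimitLevel.mem_N N hxV)]
      exact (rk_eq_rank (LimitLevel.isTransitive N) hxV).ge
    have h1 := ih _ hr e
    have h2 : k (pw N (level N (rk V x))) ⊆ k (level N γ) := by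
      refine k.map_subset (LimitLevel.pw N e) hv fun y hy => ?_
      rw [mem_pw] at hy
      exact IsLevel.mem_of_subset ⟨γ, rfl⟩ (level_mem_level hr (LimitLevel.mem_N N e)) hy.2 hy.1
    rw [k.map_pw e] at h2
    exact h2 (mem_pw.2 ⟨fun y hy => h1 (hxe hy), LimitLevel.mem_N N hxV⟩)

/-- Every set in `V` is in the image of a transitive set in `V`, even of a level. -/
theorem exists_mem_map {x : ZFSet.{u}} (hx : x ∈ V) :
    ∃ b ∈ V, IsLevel N b ∧ x ∈ b ∧ x ∈ k b := by
  obtain ⟨b, hb, hl, h⟩ := LimitLevel.exists_level N hx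
  exact ⟨b, hb, hl, h, k.level_subset_map hb hl h⟩

/-! ### Canonical extensions of Boolean combinations, products and coded formulas -/

/-- Membership in the canonical extension is decided locally. -/
theorem mem_ext_iff {A u y : ZFSet.{u}} (hA : A ∈ N) (hu : u ∈ V) (hy : y ∈ k u) :
    y ∈ k.ext A ↔ y ∈ k (A ∩ u) := by
  have hAu : A ∩ u ∈ V := LimitLevel.mem_of_subset N hu
    (inter_mem hA (LimitLevel.mem_N N hu)) fun z hz => (mem_inter.1 hz).2
  rw [mem_ext]
  constructor
  · rintro ⟨-, z, hz, hzA, hyz⟩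
    have : y ∈ k (z ∩ u) := by rw [k.map_inter hz hu]; exact mem_inter.2 ⟨hyz, hy⟩
    refine k.map_subset (LimitLevel.inter N hz (LimitLevel.mem_N N hu)) hAu (fun w hw => ?_) this
    rw [mem_inter] at *
    exact ⟨hzA hw.1, hw.2⟩
  · intro h
    exact ⟨LimitLevel.trans N (k.map_mem hu) hy, _, hAu, fun w hw => (mem_inter.1 hw).1, h⟩

theorem inter_mem_V {A u : ZFSet.{u}} (hA : A ∈ N) (hu : u ∈ V) : A ∩ u ∈ V :=
  LimitLevel.mem_of_subset N hu (inter_mem hA (LimitLevel.mem_N N hu)) fun _ hz => (mem_inter.1 hz).2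

theorem ext_mem {A : ZFSet.{u}} (hA : A ∈ N) : k.ext A ∈ N :=
  sep_mem_of_definable hV.mem _ (fun y => ∃ z : El N, z.1 ⊆ (⟨A, hA⟩ : El N).1 ∧ ∃ z' : El N,
    pair z.1 z'.1 ∈ (⟨k.gr, k.gr_mem⟩ : El N).1 ∧ y.1 ∈ z'.1) fun y _ => by
    constructor
    · rintro ⟨z, hz, hzA, h⟩
      exact ⟨⟨z, LimitLevel.mem_N N hz⟩, hzA, ⟨k z, LimitLevel.mem_N N (k.map_mem hz)⟩,
        pair_mem_gr.2 ⟨hz, rfl⟩, h⟩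
    · rintro ⟨z, hzA, z', hz, h⟩
      obtain ⟨hz, e⟩ := pair_mem_gr.1 hz
      exact ⟨z, hz, hzA, e ▸ h⟩

theorem ext_of_mem {x : ZFSet.{u}} (hx : x ∈ V) : k.ext x = k x := by
  ext y
  rw [mem_ext]
  exact ⟨fun ⟨_, z, hz, hzx, h⟩ => k.map_subset hz hx hzx h,
    fun h => ⟨LimitLevel.trans N (k.map_mem hx) h, x, hx, fun _ h => h, h⟩⟩

theorem map_mem_ext {A x : ZFSet.{u}} (hA : A ∈ N) (hx : x ∈ V) : k x ∈ k.ext A ↔ x ∈ A := by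
  have hs := LimitLevel.singleton N hx
  rw [k.mem_ext_iff hA hs (by rw [k.map_singleton hx]; simp), k.map_mem_map hx (inter_mem_V hA hs)]
  simp

theorem ext_univ : k.ext V = V := by
  ext y
  refine ⟨fun h => k.ext_subset _ h, fun hy => ?_⟩
  obtain ⟨b, hb, -, -, h⟩ := k.exists_mem_map hy
  exact mem_ext.2 ⟨hy, b, hb, fun _ hz => LimitLevel.trans N hb hz, h⟩

/-- To compute a canonical extension it suffices to compute it on levels. -/
theorem ext_eq_of {A C : ZFSet.{u}} (hA : A ∈ N) (hC : C ⊆ V)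
    (h : ∀ b ∈ V, b.IsTransitive → (k b).IsTransitive → ∀ y ∈ k b, y ∈ k (A ∩ b) ↔ y ∈ C) :
    k.ext A = C := by
  ext y
  by_cases hy : y ∈ V
  · obtain ⟨b, hb, hl, -, hyb⟩ := k.exists_mem_map hy
    rw [k.mem_ext_iff hA hb hyb, h b hb hl.isTransitive (k.isTransitive_map hb hl.isTransitive) y hyb]
  · exact ⟨fun h => absurd (k.ext_subset _ h) hy, fun h => absurd (hC h) hy⟩

theorem ext_compl {A : ZFSet.{u}} (hA : A ∈ N) : k.ext (V \ A) = V \ k.ext A := by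
  refine k.ext_eq_of (sdiff_mem hV.mem hA) (fun z hz => (mem_sdiff.1 hz).1) fun b hb _ _ y hy => ?_
  rw [mem_sdiff, k.mem_ext_iff hA hb hy,
    show (V \ A) ∩ b = b \ (A ∩ b) by
      ext z; simp only [mem_inter, mem_sdiff]
      exact ⟨fun h => ⟨h.2, fun h' => h.1.2 h'.1⟩,
        fun h => ⟨⟨LimitLevel.trans N hb h.1, fun h' => h.2 ⟨h', h.1⟩⟩, h.1⟩⟩,
    k.map_sdiff hb (inter_mem_V hA hb), mem_sdiff]
  exact and_congr_left fun _ => ⟨fun h => LimitLevel.trans N (k.map_mem hb) h, fun _ => hy⟩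

theorem ext_inter {A B : ZFSet.{u}} (hA : A ∈ N) (hB : B ∈ N) :
    k.ext (A ∩ B) = k.ext A ∩ k.ext B := by
  refine k.ext_eq_of (inter_mem hA hB) (fun z hz => k.ext_subset _ (mem_inter.1 hz).1)
    fun b hb _ _ y hy => ?_
  rw [mem_inter, k.mem_ext_iff hA hb hy, k.mem_ext_iff hB hb hy, ← mem_inter,
    ← k.map_inter (inter_mem_V hA hb) (inter_mem_V hB hb),
    show A ∩ B ∩ b = A ∩ b ∩ (B ∩ b) by ext z; simp only [mem_inter]; tauto]

theorem ext_prod {A B : ZFSet.{u}} (hA : A ∈ N) (hB : B ∈ N) :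
    k.ext (prod A B) = prod (k.ext A) (k.ext B) := by
  refine k.ext_eq_of (prod_mem hA hB) (fun z hz => ?_) fun b hb ht ht' y hy => ?_
  · obtain ⟨a, ha, b, hb, rfl⟩ := mem_prod.1 hz
    exact LimitLevel.pair N (k.ext_subset _ ha) (k.ext_subset _ hb)
  · rw [show prod A B ∩ b = prod (A ∩ b) (B ∩ b) ∩ b by
      ext z; simp only [mem_inter, mem_prod]
      constructor
      · rintro ⟨⟨c, hc, d, hd, rfl⟩, h⟩
        obtain ⟨h1, h2⟩ := ht.of_pair_mem h
        exact ⟨⟨c, ⟨hc, h1⟩, d, ⟨hd, h2⟩, rfl⟩, h⟩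
      · rintro ⟨⟨c, hc, d, hd, rfl⟩, h⟩
        exact ⟨⟨c, hc.1, d, hd.1, rfl⟩, h⟩,
      k.map_inter (LimitLevel.prod N (inter_mem_V hA hb) (inter_mem_V hB hb)) hb,
      k.map_prod (inter_mem_V hA hb) (inter_mem_V hB hb), mem_inter, mem_prod, mem_prod]
    constructor
    · rintro ⟨⟨c, hc, d, hd, rfl⟩, h⟩
      obtain ⟨h1, h2⟩ := ht'.of_pair_mem h
      exact ⟨c, (k.mem_ext_iff hA hb h1).2 hc, d, (k.mem_ext_iff hB hb h2).2 hd, rfl⟩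
    · rintro ⟨c, hc, d, hd, rfl⟩
      obtain ⟨h1, h2⟩ := ht'.of_pair_mem hy
      exact ⟨⟨c, (k.mem_ext_iff hA hb h1).1 hc, d, (k.mem_ext_iff hB hb h2).1 hd, rfl⟩, hy⟩

theorem ext_singleton {x : ZFSet.{u}} (hx : x ∈ V) : k.ext {x} = {k x} := by
  rw [k.ext_of_mem (LimitLevel.singleton N hx), k.map_singleton hx]

theorem ext_memPart : k.ext (memPart V) = memPart V := by
  refine k.ext_eq_of (memPart_mem hV.mem) sep_subset fun b hb _ _ y hy => ?_
  rw [show memPart V ∩ b = memPart b by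
    ext z; simp only [mem_inter, memPart, mem_sep]
    exact ⟨fun h => ⟨h.2, h.1.2⟩, fun h => ⟨⟨LimitLevel.trans N hb h.1, h.2⟩, h.1⟩⟩,
    k.map_memPart hb, memPart, memPart, mem_sep, mem_sep]
  exact and_congr_left fun _ => ⟨fun h => LimitLevel.trans N (k.map_mem hb) h, fun _ => hy⟩

theorem ext_eqPart : k.ext (eqPart V) = eqPart V := by
  refine k.ext_eq_of (eqPart_mem hV.mem) sep_subset fun b hb _ _ y hy => ?_
  rw [show eqPart V ∩ b = eqPart b by
    ext z; simp only [mem_inter, eqPart, mem_sep]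
    exact ⟨fun h => ⟨h.2, h.1.2⟩, fun h => ⟨⟨LimitLevel.trans N hb h.1, h.2⟩, h.1⟩⟩,
    k.map_eqPart hb, eqPart, eqPart, mem_sep, mem_sep]
  exact and_congr_left fun _ => ⟨fun h => LimitLevel.trans N (k.map_mem hb) h, fun _ => hy⟩

theorem ext_insPart {A : ZFSet.{u}} (hA : A ∈ N) :
    k.ext (insPart V A) = insPart V (k.ext A) := by
  refine k.ext_eq_of (insPart_mem hV.mem hA) sep_subset fun b hb ht ht' y hy => ?_
  have hbb := LimitLevel.prod N hb hb
  -- For a transitive `b` that contains `((a, c), d)`, the pair `(a, d)` need not be in `b`; so `A`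
  -- is cut off at `b × b` and not at `b`.
  rw [show insPart V A ∩ b = insPart b (A ∩ prod b b) by
    ext z; simp only [mem_inter, insPart, mem_sep, pair_mem_prod]
    constructor
    · rintro ⟨⟨h1, a, c, d, rfl, h⟩, h3⟩
      obtain ⟨h4, h5⟩ := ht.of_pair_mem h3
      exact ⟨h3, a, c, d, rfl, h, (ht.of_pair_mem h4).1, h5⟩
    · rintro ⟨h1, a, c, d, rfl, h, -⟩
      exact ⟨⟨LimitLevel.trans N hb h1, a, c, d, rfl, h⟩, h1⟩,
    k.map_insPart hb (inter_mem_V hA hbb), insPart, insPart, mem_sep, mem_sep]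
  refine and_congr ⟨fun h => LimitLevel.trans N (k.map_mem hb) h, fun _ => hy⟩ ?_
  have key : ∀ a c d, y = pair (pair a c) d →
      (pair a d ∈ k.ext A ↔ pair a d ∈ k (A ∩ prod b b)) := by
    rintro a c d rfl
    obtain ⟨h1, h2⟩ := ht'.of_pair_mem hy
    refine k.mem_ext_iff hA hbb ?_
    rw [k.map_prod hb hb, pair_mem_prod]
    exact ⟨(ht'.of_pair_mem h1).1, h2⟩
  constructor
  · rintro ⟨a, c, d, h, h'⟩
    exact ⟨a, c, d, h, (key a c d h).2 h'⟩
  · rintro ⟨a, c, d, h, h'⟩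
    exact ⟨a, c, d, h, (key a c d h).1 h'⟩

/-! ### Canonical extensions and projections -/

/-- The canonical extension is compatible with the domain of `C`. -/
def DomExact (k : Emb N V) (C : ZFSet.{u}) : Prop := k.ext (dom C) = dom (k.ext C)

/-- This inclusion holds for every embedding, since domains of sets in `V` are preserved. Exactness
concerns the other one, where the witnesses for the elements of a set in `V` may be unbounded in
`V`. -/
theorem dom_ext_subset {C : ZFSet.{u}} : dom (k.ext C) ⊆ k.ext (dom C) := by
  intro t ht
  obtain ⟨x, hx⟩ := mem_dom.1 ht
  obtain ⟨hV', z, hz, hzC, hx⟩ := mem_ext.1 hx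
  have hd : dom z ∈ V := by
    obtain ⟨b, hb, hl, hzb⟩ := LimitLevel.exists_level N hz
    refine LimitLevel.mem_of_subset N hb (dom_mem (LimitLevel.mem_N N hz)) fun a ha => ?_
    obtain ⟨c, hc⟩ := mem_dom.1 ha
    exact (hl.isTransitive.of_pair_mem (hl.isTransitive _ hzb hc)).1
  refine mem_ext.2 ⟨((LimitLevel.pair_mem_iff N).1 hV').1, dom z, hd, fun a ha => ?_, ?_⟩
  · obtain ⟨c, hc⟩ := mem_dom.1 ha
    exact mem_dom.2 ⟨c, hzC hc⟩
  · rw [k.map_dom hz]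
    exact mem_dom.2 ⟨x, hx⟩

/-- With witnesses in a single `w ∈ V`, the set `y` is the domain of `C ∩ (y × w)`, which is in `V`,
so that `map_dom` applies. -/
theorem mem_dom_ext_of_bounded {C y w t : ZFSet.{u}} (hC : C ∈ N) (hy : y ∈ V) (hw : w ∈ V)
    (h : ∀ t ∈ y, ∃ x ∈ w, pair t x ∈ C) (ht : t ∈ k y) : t ∈ dom (k.ext C) := by
  have hz := LimitLevel.prod N hy hw
  have e : dom (C ∩ prod y w) = y := by
    ext a
    simp only [mem_dom, mem_inter, pair_mem_prod]
    refine ⟨fun ⟨_, _, h, _⟩ => h, fun ha => ?_⟩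
    obtain ⟨x, hx, hax⟩ := h a ha
    exact ⟨x, hax, ha, hx⟩
  have hCz := inter_mem_V hC hz
  rw [← e, k.map_dom hCz] at ht
  obtain ⟨x, hx⟩ := mem_dom.1 ht
  exact mem_dom.2 ⟨x, mem_ext.2 ⟨LimitLevel.trans N (k.map_mem hCz) hx, _, hCz,
    fun _ h => (mem_inter.1 h).1, hx⟩⟩

theorem domExact_of_bounded {C : ZFSet.{u}} (hC : C ∈ N)
    (h : ∀ y ∈ V, ∃ w ∈ V, ∀ t ∈ y, t ∈ dom C → ∃ x ∈ w, pair t x ∈ C) : k.DomExact C := by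
  ext t
  refine ⟨fun ht => ?_, fun ht => k.dom_ext_subset ht⟩
  obtain ⟨-, y, hy, hyC, ht⟩ := mem_ext.1 ht
  obtain ⟨w, hw, hyw⟩ := h y hy
  exact k.mem_dom_ext_of_bounded hC hy hw (fun t ht => hyw t ht (hyC ht)) ht

end Emb

end RankEmbedding

namespace RankEmbedding

open ZFSet

set_option linter.unusedSectionVars false
set_option synthInstance.maxSize 5000
set_option synthInstance.maxHeartbeats 400000

variable {N : Set ZFSet.{u}} {V : ZFSet.{u}}

/-! ## Transfer along an embedding and its canonical extension -/

/-- The code of a finite tuple. -/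
noncomputable def tupF : ∀ {n : ℕ}, (Fin n → V) → ZFSet.{u}
  | 0, _ => ∅
  | _ + 1, v => pair (tupF (Fin.init v)) (v (Fin.last _)).1

/-- The set of the codes of the tuples of length `n`. -/
noncomputable def tuples (V : ZFSet.{u}) : ℕ → ZFSet.{u}
  | 0 => {∅}
  | n + 1 => prod (tuples V n) V

theorem mem_tuples {n : ℕ} {w : ZFSet.{u}} :
    w ∈ tuples V n ↔ ∃ v : Fin n → V, w = tupF v := by
  induction n generalizing w with
  | zero =>
    simp only [tuples, mem_singleton, tupF, exists_const_iff]
    exact ⟨fun h => ⟨⟨Fin.elim0⟩, h⟩, fun h => h.2⟩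
  | succ n ih =>
    simp only [tuples, mem_prod, tupF]
    constructor
    · rintro ⟨a, ha, b, hb, rfl⟩
      obtain ⟨v, rfl⟩ := ih.1 ha
      exact ⟨Fin.snoc v ⟨b, hb⟩, by simp⟩
    · rintro ⟨v, rfl⟩
      exact ⟨_, ih.2 ⟨_, rfl⟩, _, (v (Fin.last n)).2, rfl⟩

/-- The code of the tuple given by a context. -/
noncomputable def tup (V : ZFSet.{u}) {Γ : Type (u + 1)} [c : Cxt PUnit.{u + 2} V Γ] (g : Γ) : ZFSet.{u} :=
  tupF (c.tail g)

theorem tup_cons {Γ : Type (u + 1)} [c : Cxt PUnit.{u + 2} V Γ] (h : Γ × V) :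
    tup V h = pair (tup V h.1) h.2.1 := by
  simp [tup, Cxt.tail, tupF]

section

variable [hN : Fact (IsTransitiveZFModel N)] [hV : LimitLevel N V]

variable (N) in
include hN hV in
theorem tuples_subset (n : ℕ) : tuples V n ⊆ V := by
  induction n with
  | zero =>
    intro w hw
    rw [tuples, mem_singleton] at hw
    exact hw ▸ Emb.empty_mem (N := N)
  | succ n ih =>
    intro w hw
    obtain ⟨a, ha, b, hb, rfl⟩ := mem_prod.1 hw
    exact LimitLevel.pair N (ih ha) hb

theorem tuples_mem (n : ℕ) : tuples V n ∈ N := by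
  induction n with
  | zero => exact singleton_mem (mem_of_mem hV.mem (Emb.empty_mem (N := N)))
  | succ n ih => exact prod_mem ih hV.mem

theorem Emb.ext_tuples (k : Emb N V) (n : ℕ) : k.ext (tuples V n) = tuples V n := by
  induction n with
  | zero => rw [tuples, k.ext_singleton (Emb.empty_mem (N := N)), k.map_empty]
  | succ n ih => rw [tuples, k.ext_prod (tuples_mem n) hV.mem, ih, k.ext_univ]

variable {Γ : Type (u + 1)} [c : Cxt PUnit.{u + 2} V Γ]

theorem tup_mem_tuples (g : Γ) : tup V g ∈ tuples V c.size := mem_tuples.2 ⟨_, rfl⟩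

theorem exists_tup {w : ZFSet.{u}} (h : w ∈ tuples V c.size) : ∃ g : Γ, w = tup V g := by
  obtain ⟨v, rfl⟩ := mem_tuples.1 h
  obtain ⟨g, rfl⟩ := c.surj ⟨⟨⟩⟩ v
  exact ⟨g, rfl⟩

variable (k : Emb N V)

/-! ### Predicates coded by a set and by its canonical extension -/

/-- The predicate `P` on `V` is coded by a set in `N`, and `P'` is coded by the canonical extension
of the embedding `k` at this set. -/
def LiftRel (P P' : Γ → Prop) : Prop :=
  ∃ C ∈ N, C ⊆ tuples V c.size ∧ (∀ g, P g ↔ tup V g ∈ C) ∧ ∀ g, P' g ↔ tup V g ∈ k.ext C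

namespace LiftRel

variable {k} {P P' Q Q' : Γ → Prop}

/-- A valid predicate is coded by the set of all tuples, which canonical extensions fix. This
transfers leading universal quantifiers over all of `V` without exactness. -/
theorem forall_of_forall (h : LiftRel k P P') (hP : ∀ g, P g) (g : Γ) : P' g := by
  obtain ⟨C, hC, hCt, h1, h2⟩ := h
  have : C = tuples V c.size := by
    ext w
    refine ⟨fun hw => hCt hw, fun hw => ?_⟩
    obtain ⟨g, rfl⟩ := exists_tup hw
    exact (h1 g).1 (hP g)
  rw [h2, this, k.ext_tuples]
  exact tup_mem_tuples g

theorem iff {P P' : PUnit.{u + 2} → Prop} (h : LiftRel k P P') : P ⟨⟩ ↔ P' ⟨⟩ := by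
  obtain ⟨C, hC, hCt, h1, h2⟩ := h
  have e : tup V (⟨⟩ : PUnit.{u + 2}) = ∅ := rfl
  rw [h1, h2, e, ← k.map_mem_ext hC (Emb.empty_mem (N := N)), k.map_empty]

theorem not (h : LiftRel k P P') : LiftRel k (fun g => ¬ P g) (fun g => ¬ P' g) := by
  obtain ⟨C, hC, hCt, h1, h2⟩ := h
  have ht := tuples_mem (N := N) (V := V) c.size
  refine ⟨tuples V c.size ∩ (V \ C), inter_mem ht (sdiff_mem hV.mem hC),
    fun w hw => (mem_inter.1 hw).1, fun g => ?_, fun g => ?_⟩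
  · beta_reduce
    rw [h1, mem_inter, mem_sdiff]
    exact ⟨fun h => ⟨tup_mem_tuples g, tuples_subset N _ (tup_mem_tuples g), h⟩, fun h => h.2.2⟩
  · beta_reduce
    rw [k.ext_inter ht (sdiff_mem hV.mem hC), k.ext_compl hC, k.ext_tuples, h2, mem_inter, mem_sdiff]
    exact ⟨fun h => ⟨tup_mem_tuples g, tuples_subset N _ (tup_mem_tuples g), h⟩, fun h => h.2.2⟩

theorem and (h : LiftRel k P P') (h' : LiftRel k Q Q') :
    LiftRel k (fun g => P g ∧ Q g) (fun g => P' g ∧ Q' g) := by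
  obtain ⟨C, hC, hCt, h1, h2⟩ := h
  obtain ⟨D, hD, hDt, h3, h4⟩ := h'
  refine ⟨C ∩ D, inter_mem hC hD, fun w hw => hCt (mem_inter.1 hw).1, fun g => ?_, fun g => ?_⟩
  · beta_reduce
    rw [h1, h3, mem_inter]
  · beta_reduce
    rw [h2, h4, k.ext_inter hC hD, mem_inter]

/-- The last variable is the second component of the outermost pair, so quantifying it existentially
is taking the domain of the code. -/
theorem ex_of_domExact {P P' : Γ × V → Prop}
    (h : ∃ C ∈ N, C ⊆ tuples V (c.size + 1) ∧ (∀ g, P g ↔ tup V g ∈ C) ∧ (∀ g, P' g ↔ tup V g ∈ k.ext C) ∧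
      k.DomExact C) :
    LiftRel k (fun g => ∃ x, P (g, x)) (fun g => ∃ x, P' (g, x)) := by
  obtain ⟨C, hC, hCt, h1, h2, h3⟩ := h
  refine ⟨dom C, dom_mem hC, fun w hw => ?_, fun g => ?_, fun g => ?_⟩
  · obtain ⟨b, hb⟩ := mem_dom.1 hw
    have := hCt hb
    rw [tuples, pair_mem_prod] at this
    exact this.1
  · rw [mem_dom]
    constructor
    · rintro ⟨x, hx⟩
      exact ⟨x.1, by simpa [tup_cons] using (h1 _).1 hx⟩
    · rintro ⟨x, hx⟩
      have hxV := ((LimitLevel.pair_mem_iff N).1 (tuples_subset N _ (hCt hx))).2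
      exact ⟨⟨x, hxV⟩, (h1 _).2 (by simpa [tup_cons] using hx)⟩
  · rw [h3, mem_dom]
    constructor
    · rintro ⟨x, hx⟩
      exact ⟨x.1, by simpa [tup_cons] using (h2 _).1 hx⟩
    · rintro ⟨x, hx⟩
      have hxV := ((LimitLevel.pair_mem_iff N).1 (k.ext_subset _ hx)).2
      exact ⟨⟨x, hxV⟩, (h2 _).2 (by simpa [tup_cons] using hx)⟩

/-- Closure under existential quantifiers that are bounded locally. -/
theorem ex_of_bounded {P P' : Γ × V → Prop} (h : LiftRel k P P')
    (hb : ∀ y ∈ V, ∃ w ∈ V, ∀ g : Γ, tup V g ∈ y → (∃ x, P (g, x)) → ∃ x : V, x.1 ∈ w ∧ P (g, x)) :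
    LiftRel k (fun g => ∃ x, P (g, x)) (fun g => ∃ x, P' (g, x)) := by
  obtain ⟨C, hC, hCt, h1, h2⟩ := h
  refine ex_of_domExact ⟨C, hC, hCt, h1, h2, k.domExact_of_bounded hC fun y hy => ?_⟩
  obtain ⟨w, hw, h⟩ := hb y hy
  refine ⟨w, hw, fun t ht htC => ?_⟩
  obtain ⟨x, hx⟩ := mem_dom.1 htC
  have hx' := hCt hx
  replace hx' := pair_mem_prod.1 (show pair t x ∈ prod (tuples V c.size) V from hx')
  obtain ⟨g, rfl⟩ := exists_tup (Γ := Γ) hx'.1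
  obtain ⟨x', hx'w, hx'⟩ := h g ht ⟨⟨x, hx'.2⟩, (h1 _).2 (by simpa [tup_cons] using hx)⟩
  exact ⟨x'.1, hx'w, by simpa [tup_cons] using (h1 _).1 hx'⟩

theorem of_inter {C : ZFSet.{u}} (hC : C ∈ N) (h1 : ∀ g, P g ↔ tup V g ∈ C)
    (h2 : ∀ g, P' g ↔ tup V g ∈ k.ext C) : LiftRel k P P' := by
  have ht := tuples_mem (N := N) (V := V) c.size
  refine ⟨C ∩ tuples V c.size, inter_mem hC ht, fun w hw => (mem_inter.1 hw).2, fun g => ?_,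
    fun g => ?_⟩
  · rw [h1, mem_inter, and_iff_left (tup_mem_tuples g)]
  · rw [h2, k.ext_inter hC ht, mem_inter, k.ext_tuples, and_iff_left (tup_mem_tuples g)]

variable (N) in
include hN hV in
theorem tup_mem_V (g : Γ) : tup V g ∈ V :=
  tuples_subset N _ (tup_mem_tuples g)

theorem ins {P P' : Γ × V → Prop} (h : LiftRel k P P') :
    LiftRel k (fun h : (Γ × V) × V => P (h.1.1, h.2)) (fun h : (Γ × V) × V => P' (h.1.1, h.2)) := by
  obtain ⟨C, hC, hCt, h1, h2⟩ := h
  have hm : ∀ g : (Γ × V) × V, tup V g ∈ V := fun g => tup_mem_V (V := V) N g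
  refine of_inter (insPart_mem hV.mem hC) (fun g => ?_) (fun g => ?_)
  · have := hm g
    rw [tup_cons, tup_cons] at this ⊢
    rw [pair_mem_insPart, h1, tup_cons, and_iff_right this]
  · have := hm g
    rw [k.ext_insPart hC]
    rw [tup_cons, tup_cons] at this ⊢
    rw [pair_mem_insPart, h2, tup_cons, and_iff_right this]

theorem topMem : LiftRel k (fun h : (Γ × V) × V => h.1.2.1 ∈ h.2.1)
    (fun h : (Γ × V) × V => h.1.2.1 ∈ h.2.1) := by
  have : ∀ g : (Γ × V) × V, g.1.2.1 ∈ g.2.1 ↔ tup V g ∈ memPart V := fun g => by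
    have := tup_mem_V (V := V) N g
    rw [tup_cons, tup_cons] at this ⊢
    rw [pair_mem_memPart, and_iff_right this]
  exact of_inter (memPart_mem hV.mem) this (by rwa [k.ext_memPart])

theorem topEq : LiftRel k (fun h : (Γ × V) × V => h.2 = h.1.2)
    (fun h : (Γ × V) × V => h.2 = h.1.2) := by
  have : ∀ g : (Γ × V) × V, g.2 = g.1.2 ↔ tup V g ∈ eqPart V := fun g => by
    have := tup_mem_V (V := V) N g
    rw [tup_cons, tup_cons] at this ⊢
    rw [pair_mem_eqPart, and_iff_right this, Subtype.ext_iff, eq_comm]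
  exact of_inter (eqPart_mem hV.mem) this (by rwa [k.ext_eqPart])

theorem topPred {A : ZFSet.{u}} (hA : A ∈ N) :
    LiftRel k (fun h : Γ × V => h.2.1 ∈ A) (fun h : Γ × V => h.2.1 ∈ k.ext A) := by
  have ht := tuples_mem (N := N) (V := V) c.size
  refine of_inter (prod_mem ht hA) (fun g => ?_) (fun g => ?_)
  · rw [tup_cons, pair_mem_prod, and_iff_right (tup_mem_tuples g.1)]
  · rw [k.ext_prod ht hA, tup_cons, pair_mem_prod, k.ext_tuples,
      and_iff_right (tup_mem_tuples g.1)]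

end LiftRel

/-! ### Terms, substitution and bounded quantifiers -/

/-- The pair of terms `t`, `t'` corresponds under the embedding `k`. -/
def LiftTrm (t t' : Γ → V) : Prop :=
  LiftRel k (fun h : Γ × V => h.2 = t h.1) (fun h : Γ × V => h.2 = t' h.1) ∧
    ∀ y ∈ V, ∃ w ∈ V, ∀ g : Γ, tup V g ∈ y → (t g).1 ∈ w

variable {k}

/-- Substitution is read as `∃ x, x = t g ∧ P (g, x)`. The local bound in `LiftTrm` makes this
quantifier harmless for embeddings that are not exact. -/
theorem LiftRel.subst {t t' : Γ → V} {P P' : Γ × V → Prop} (ht : LiftTrm k t t')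
    (h : LiftRel k P P') : LiftRel k (fun g => P (g, t g)) (fun g => P' (g, t' g)) := by
  have h1 : LiftRel k (fun g => ∃ x, x = t g ∧ P (g, x)) (fun g => ∃ x, x = t' g ∧ P' (g, x)) := by
    refine ex_of_bounded (ht.1.and h) fun y hy => ?_
    obtain ⟨w, hw, hwy⟩ := ht.2 y hy
    refine ⟨w, hw, ?_⟩
    rintro g hg ⟨x, e, hx⟩
    exact ⟨x, (show x = t g from e) ▸ hwy g hg, e, hx⟩
  simpa only [exists_eq_left] using h1

theorem LiftTrm.last : LiftTrm k (fun h : Γ × V => h.2) (fun h : Γ × V => h.2) := by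
  refine ⟨LiftRel.topEq, fun y hy => ?_⟩
  obtain ⟨b, hb, hl, hyb⟩ := LimitLevel.exists_level N hy
  refine ⟨b, hb, fun g hg => ?_⟩
  rw [tup_cons] at hg
  exact (hl.isTransitive.of_pair_mem (hl.isTransitive _ hyb hg)).2

theorem LiftTrm.weak {t t' : Γ → V} (h : LiftTrm k t t') :
    LiftTrm k (fun h : Γ × V => t h.1) (fun h : Γ × V => t' h.1) := by
  refine ⟨h.1.ins, fun y hy => ?_⟩
  obtain ⟨b, hb, hl, hyb⟩ := LimitLevel.exists_level N hy
  obtain ⟨w, hw, h⟩ := h.2 b hb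
  refine ⟨w, hw, fun g hg => h _ ?_⟩
  rw [tup_cons] at hg
  exact (hl.isTransitive.of_pair_mem (hl.isTransitive _ hyb hg)).1

theorem LiftRel.mem {s s' t t' : Γ → V} (hs : LiftTrm k s s') (ht : LiftTrm k t t') :
    LiftRel k (fun g => (s g).1 ∈ (t g).1) (fun g => (s' g).1 ∈ (t' g).1) :=
  LiftRel.subst hs (P := fun h => h.2.1 ∈ (t h.1).1) (P' := fun h => h.2.1 ∈ (t' h.1).1)
    (LiftRel.subst ht.weak LiftRel.topMem)

theorem LiftRel.bex {t t' : Γ → V} {P P' : Γ × V → Prop} (ht : LiftTrm k t t')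
    (h : LiftRel k P P') : LiftRel k (fun g => ∃ x : V, x.1 ∈ (t g).1 ∧ P (g, x))
      (fun g => ∃ x : V, x.1 ∈ (t' g).1 ∧ P' (g, x)) := by
  refine ex_of_bounded ((LiftRel.mem LiftTrm.last ht.weak).and h) fun y hy => ?_
  obtain ⟨w, hw, hwy⟩ := ht.2 y hy
  obtain ⟨b, hb, hl, hwb⟩ := LimitLevel.exists_level N hw
  exact ⟨b, hb, fun g hg ⟨x, hx, hP⟩ =>
    ⟨x, hl.isTransitive _ (hl.isTransitive _ hwb (hwy g hg)) hx, hx, hP⟩⟩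

variable (k)

/-- The logic of the predicates on `V` that correspond under the embedding `k`. -/
def lift : Logic (fun x => x ∈ V) PUnit.{u + 2} where
  Rel P P' := LiftRel k P P'
  Trm t t' := LiftTrm k t t'
  last := LiftTrm.last
  weak := LiftTrm.weak
  mem := LiftRel.mem
  not := LiftRel.not
  and := LiftRel.and
  bex := LiftRel.bex

variable {k}

/-- A parameter is moved to its image: the code `{x}` has the canonical extension `{k x}`. -/
instance lift.const (x : V) : (lift k).T (fun _ : Γ => x) (fun _ : Γ => k.sub x) := by
  refine ⟨?_, fun y hy => ⟨_, LimitLevel.singleton N x.2, fun g _ => mem_singleton.2 rfl⟩⟩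
  have h := LiftRel.topPred (Γ := Γ) (k := k) (singleton_mem (LimitLevel.mem_N N x.2))
  rw [k.ext_singleton x.2] at h
  convert h using 3
  · rw [mem_singleton, Subtype.ext_iff]
  · rw [mem_singleton, Subtype.ext_iff]; rfl

variable [tV : TransCl fun x => x ∈ V]

/-- The canonical extension of an embedding as a map on the type of the elements of `N`. -/
noncomputable def Emb.extN (k : Emb N V) (A : El N) : El N := ⟨k.ext A.1, k.ext_mem A.2⟩

variable {s s' t t' : Γ → V}

namespace lift

instance pred [ht : (lift k).T t t'] (A : El N) :
    (lift k).R (fun g => (t g).1 ∈ A.1) (fun g => (t' g).1 ∈ (k.extN A).1) :=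
  ⟨LiftRel.subst ht.out (LiftRel.topPred A.2)⟩

/-- The pair of two elements of `V`. -/
noncomputable def pairV (N : Set ZFSet.{u}) [Fact (IsTransitiveZFModel N)] [LimitLevel N V]
    (x y : V) : V := ⟨pair x.1 y.1, LimitLevel.pair N x.2 y.2⟩

instance pair [hs : (lift k).T s s'] [ht : (lift k).T t t'] :
    (lift k).T (fun g => pairV N (s g) (t g)) (fun g => pairV N (s' g) (t' g)) := by
  refine ⟨?_, fun y hy => ?_⟩
  · exact ((inferInstance : (lift k).R
      (fun h : Γ × V => h.2.1 = ZFSet.pair (s h.1).1 (t h.1).1)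
      (fun h : Γ × V => h.2.1 = ZFSet.pair (s' h.1).1 (t' h.1).1)).congr
      (fun _ => Subtype.ext_iff) (fun _ => Subtype.ext_iff)).out
  · obtain ⟨w, hw, h⟩ := hs.out.2 y hy
    obtain ⟨w', hw', h'⟩ := ht.out.2 y hy
    exact ⟨prod w w', LimitLevel.prod N hw hw', fun g hg =>
      pair_mem_prod.2 ⟨h g hg, h' g hg⟩⟩

instance predPair [hs : (lift k).T s s'] [ht : (lift k).T t t'] (A : El N) :
    (lift k).R (fun g => ZFSet.pair (s g).1 (t g).1 ∈ A.1)
      (fun g => ZFSet.pair (s' g).1 (t' g).1 ∈ (k.extN A).1) :=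
  (inferInstance : (lift k).R (fun g => (pairV N (s g) (t g)).1 ∈ A.1)
    (fun g => (pairV N (s' g) (t' g)).1 ∈ (k.extN A).1))

/-- A level contains all subsets in `N` of its elements, so quantifiers over subsets are locally
bounded and need no exactness. -/
instance exists_subset {P P' : Γ → V → Prop} [ht : (lift k).T t t']
    [h : (lift k).R (fun h : Γ × V => P h.1 h.2) (fun h : Γ × V => P' h.1 h.2)] :
    (lift k).R (fun g => ∃ x : V, x.1 ⊆ (t g).1 ∧ P g x)
      (fun g => ∃ x : V, x.1 ⊆ (t' g).1 ∧ P' g x) := by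
  have h1 : (lift k).R (fun h : Γ × V => h.2.1 ⊆ (t h.1).1 ∧ P h.1 h.2)
    (fun h : Γ × V => h.2.1 ⊆ (t' h.1).1 ∧ P' h.1 h.2) := inferInstance
  refine ⟨LiftRel.ex_of_bounded h1.out fun y hy => ?_⟩
  obtain ⟨w, hw, hwy⟩ := ht.out.2 y hy
  obtain ⟨b, hb, hl, hwb⟩ := LimitLevel.exists_level N hw
  exact ⟨b, hb, fun g hg ⟨x, hx, hP⟩ => ⟨x, hl.mem_of_subset
    (hl.isTransitive _ hwb (hwy g hg)) (LimitLevel.mem_N N x.2) hx, hx, hP⟩⟩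

instance forall_subset {P P' : Γ → V → Prop} [(lift k).T t t']
    [(lift k).R (fun h : Γ × V => P h.1 h.2) (fun h : Γ × V => P' h.1 h.2)] :
    (lift k).R (fun g => ∀ x : V, x.1 ⊆ (t g).1 → P g x)
      (fun g => ∀ x : V, x.1 ⊆ (t' g).1 → P' g x) :=
  (inferInstance : (lift k).R (fun g => ¬ ∃ x : V, x.1 ⊆ (t g).1 ∧ ¬ P g x)
    (fun g => ¬ ∃ x : V, x.1 ⊆ (t' g).1 ∧ ¬ P' g x)).congr
    (fun g => by push Not; rfl) (fun g => by push Not; rfl)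

theorem eq_pw_iff (x y : V) : x.1 = pw N y.1 ↔
    (∀ z : V, z.1 ∈ x.1 → z.1 ⊆ y.1) ∧ ∀ z : V, z.1 ⊆ y.1 → z.1 ∈ x.1 := by
  refine ⟨fun h => by rw [h]; exact ⟨fun z hz => (mem_pw.1 hz).1,
    fun z hz => mem_pw.2 ⟨hz, LimitLevel.mem_N N z.2⟩⟩, fun h => ZFSet.ext fun z => ?_⟩
  rw [mem_pw]
  exact ⟨fun hz => ⟨h.1 ⟨z, LimitLevel.trans N x.2 hz⟩ hz,
    LimitLevel.mem_N N (LimitLevel.trans N x.2 hz)⟩,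
    fun hz => h.2 ⟨z, LimitLevel.mem_of_subset N y.2 hz.2 hz.1⟩ hz.1⟩

instance eq_pw [(lift k).T s s'] [(lift k).T t t'] :
    (lift k).R (fun g => (s g).1 = pw N (t g).1) (fun g => (s' g).1 = pw N (t' g).1) :=
  (inferInstance : (lift k).R
    (fun g => (∀ z : V, z.1 ∈ (s g).1 → z.1 ⊆ (t g).1) ∧ ∀ z : V, z.1 ⊆ (t g).1 → z.1 ∈ (s g).1)
    (fun g => (∀ z : V, z.1 ∈ (s' g).1 → z.1 ⊆ (t' g).1) ∧
      ∀ z : V, z.1 ⊆ (t' g).1 → z.1 ∈ (s' g).1)).congr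
    (fun _ => eq_pw_iff _ _) (fun _ => eq_pw_iff _ _)

end lift

/-! ### Exact embeddings and unbounded quantifiers -/

variable {P P' Q Q' : Γ → Prop}

variable (k) in
/-- The canonical extension of `k` is compatible with the domains of all subsets of `V`. -/
class Exact : Prop where
  out : ∀ C ∈ N, C ⊆ V → k.DomExact C

instance lift.ex [he : Exact k] {P P' : Γ → V → Prop}
    [h : (lift k).R (fun h : Γ × V => P h.1 h.2) (fun h : Γ × V => P' h.1 h.2)] :
    (lift k).R (fun g => ∃ x, P g x) (fun g => ∃ x, P' g x) := by
  obtain ⟨C, hC, hCt, h1, h2⟩ := h.out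
  exact ⟨LiftRel.ex_of_domExact ⟨C, hC, hCt, h1, h2,
    he.out C hC fun _ hw => tuples_subset N (c.size + 1) (hCt hw)⟩⟩

instance lift.all [Exact k] {P P' : Γ → V → Prop}
    [(lift k).R (fun h : Γ × V => P h.1 h.2) (fun h : Γ × V => P' h.1 h.2)] :
    (lift k).R (fun g => ∀ x, P g x) (fun g => ∀ x, P' g x) :=
  (inferInstance : (lift k).R (fun g => ¬ ∃ x, ¬ P g x) (fun g => ¬ ∃ x, ¬ P' g x)).congr
    (fun g => by push Not; rfl) (fun g => by push Not; rfl)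

end

theorem transCl_of_limitLevel (N : Set ZFSet.{u}) [hN : Fact (IsTransitiveZFModel N)]
    [hV : LimitLevel N V] : TransCl (fun x => x ∈ V) := ⟨fun hx hy => LimitLevel.trans N hx hy⟩

end RankEmbedding

namespace RankEmbedding

open ZFSet

set_option linter.unusedSectionVars false
set_option synthInstance.maxSize 5000
set_option synthInstance.maxHeartbeats 400000

variable {N : Set ZFSet.{u}} {V : ZFSet.{u}}

/-! ## Embeddings as relations, and the application of an embedding to another one -/

/-- The relation `G` preserves the operation `F`. -/
def PreservesUn (G : V → V → Prop) (F : ZFSet.{u} → ZFSet.{u}) : Prop :=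
  ∀ x x' y y' : V, G x x' → G y y' → y.1 = F x.1 → y'.1 = F x'.1

/-- The relation `G` preserves the binary operation `F`. -/
def PreservesBin (G : V → V → Prop) (F : ZFSet.{u} → ZFSet.{u} → ZFSet.{u}) : Prop :=
  ∀ x x' y y' z z' : V, G x x' → G y y' → G z z' → z.1 = F x.1 y.1 → z'.1 = F x'.1 y'.1

/-- The relation `G` is the graph of a map that preserves the basic set operations. -/
structure IsEmbRel (N : Set ZFSet.{u}) (G : V → V → Prop) : Prop where
  total : ∀ x, ∃ y, G x y
  functional : ∀ x y z, G x y → G x z → y = z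
  sdiff : PreservesBin G fun x y => x \ y
  prod : PreservesBin G fun x y => ZFSet.prod x y
  dom : PreservesUn G fun x => dom x
  singleton : PreservesUn G fun x => {x}
  memPart : PreservesUn G fun x => memPart x
  eqPart : PreservesUn G fun x => eqPart x
  insPart : PreservesBin G fun x y => insPart x y
  pw : PreservesUn G fun x => pw N x

section

variable [hN : Fact (IsTransitiveZFModel N)] [hV : LimitLevel N V] [tV : TransCl fun x => x ∈ V]

variable (N) in
include hN hV in
theorem LimitLevel.dom_mem {x : ZFSet.{u}} (hx : x ∈ V) : dom x ∈ V := by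
  obtain ⟨b, hb, hl, hxb⟩ := LimitLevel.exists_level N hx
  refine LimitLevel.mem_of_subset N hb (RankEmbedding.dom_mem (LimitLevel.mem_N N hx)) fun a ha => ?_
  obtain ⟨c, hc⟩ := mem_dom.1 ha
  exact (hl.isTransitive.of_pair_mem (hl.isTransitive _ hxb hc)).1

theorem Emb.isEmbRel (k : Emb N V) : IsEmbRel N fun x y : V => ZFSet.pair x.1 y.1 ∈ k.gr := by
  have un : ∀ F : ZFSet.{u} → ZFSet.{u}, (∀ {x}, x ∈ V → k (F x) = F (k x)) →
      PreservesUn (fun x y : V => ZFSet.pair x.1 y.1 ∈ k.gr) F := by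
    intro F hF x x' y y' hx hy e
    rw [(pair_mem_gr.1 hx).2, (pair_mem_gr.1 hy).2, e, hF x.2]
  have bin : ∀ F : ZFSet.{u} → ZFSet.{u} → ZFSet.{u},
      (∀ {x y}, x ∈ V → y ∈ V → k (F x y) = F (k x) (k y)) →
      PreservesBin (fun x y : V => ZFSet.pair x.1 y.1 ∈ k.gr) F := by
    intro F hF x x' y y' z z' hx hy hz e
    rw [(pair_mem_gr.1 hx).2, (pair_mem_gr.1 hy).2, (pair_mem_gr.1 hz).2, e, hF x.2 y.2]
  exact
    { total := fun x => ⟨⟨k x.1, k.map_mem x.2⟩, pair_mem_gr.2 ⟨x.2, rfl⟩⟩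
      functional := fun x y z hy hz =>
        Subtype.ext ((pair_mem_gr.1 hy).2.trans (pair_mem_gr.1 hz).2.symm)
      sdiff := bin _ k.map_sdiff
      prod := bin _ k.map_prod
      dom := un _ k.map_dom
      singleton := un _ k.map_singleton
      memPart := un _ k.map_memPart
      eqPart := un _ k.map_eqPart
      insPart := bin _ k.map_insPart
      pw := un _ k.map_pw }

theorem exists_emb_gr_eq {G : ZFSet.{u}} (hG : G ∈ N) (hGV : G ⊆ ZFSet.prod V V)
    (h : IsEmbRel N fun x y : V => ZFSet.pair x.1 y.1 ∈ G) : ∃ k : Emb N V, k.gr = G := by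
  classical
  choose f hf using h.total
  have hf' : ∀ x y : V, ZFSet.pair x.1 y.1 ∈ G ↔ y = f x := fun x y =>
    ⟨fun hy => h.functional _ _ _ hy (hf x), fun e => e ▸ hf x⟩
  set g : ZFSet.{u} → ZFSet.{u} := fun x => if hx : x ∈ V then (f ⟨x, hx⟩).1 else ∅ with hg
  have hgV : ∀ {x} (hx : x ∈ V), g x = (f ⟨x, hx⟩).1 := fun hx => by rw [hg]; exact dif_pos hx
  have un : ∀ {F : ZFSet.{u} → ZFSet.{u}}, PreservesUn (fun x y : V => ZFSet.pair x.1 y.1 ∈ G) F →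
      ∀ {x}, x ∈ V → F x ∈ V → g (F x) = F (g x) := by
    intro F hF x hx hy
    rw [hgV hx, hgV hy]
    exact hF ⟨x, hx⟩ _ ⟨_, hy⟩ _ (hf _) (hf _) rfl
  have bin : ∀ {F : ZFSet.{u} → ZFSet.{u} → ZFSet.{u}},
      PreservesBin (fun x y : V => ZFSet.pair x.1 y.1 ∈ G) F →
      ∀ {x y}, x ∈ V → y ∈ V → F x y ∈ V → g (F x y) = F (g x) (g y) := by
    intro F hF x y hx hy hz
    rw [hgV hx, hgV hy, hgV hz]
    exact hF ⟨x, hx⟩ _ ⟨y, hy⟩ _ ⟨_, hz⟩ _ (hf _) (hf _) (hf _) rfl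
  have sub : ∀ {x y : ZFSet.{u}}, x ∈ V → y ∈ N → y ⊆ x → y ∈ V := fun hx hy hyx =>
    LimitLevel.mem_of_subset N hx hy hyx
  have e : (ZFSet.range fun x : V => ZFSet.pair x.1 (g x.1)) = G := by
    ext p
    rw [mem_range]
    constructor
    · rintro ⟨x, rfl⟩
      simpa only [hgV x.2] using hf x
    · intro hp
      obtain ⟨x, hx, y, hy, rfl⟩ := mem_prod.1 (hGV hp)
      exact ⟨⟨x, hx⟩, by simp only [hgV hx, ← (hf' ⟨x, hx⟩ ⟨y, hy⟩).1 hp]⟩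
  exact ⟨
    { toFun := g
      map_out := fun hx => dif_neg hx
      map_mem := fun hx => by rw [hgV hx]; exact (f _).2
      graph_mem := by rwa [e]
      map_sdiff := fun hx hy => bin h.sdiff hx hy (LimitLevel.sdiff N hx (LimitLevel.mem_N N hy))
      map_prod := fun hx hy => bin h.prod hx hy (LimitLevel.prod N hx hy)
      map_dom := fun hx => un h.dom hx (LimitLevel.dom_mem N hx)
      map_singleton := fun hx => un h.singleton hx (LimitLevel.singleton N hx)
      map_memPart := fun hx => un h.memPart hx
        (sub hx (memPart_mem (LimitLevel.mem_N N hx)) sep_subset)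
      map_eqPart := fun hx => un h.eqPart hx
        (sub hx (eqPart_mem (LimitLevel.mem_N N hx)) sep_subset)
      map_insPart := fun hx hy => bin h.insPart hx hy
        (sub hx (insPart_mem (LimitLevel.mem_N N hx) (LimitLevel.mem_N N hy)) sep_subset)
      map_pw := fun hx => un h.pw hx (LimitLevel.pw N hx) }, e⟩

theorem Emb.gr_subset (k : Emb N V) : k.gr ⊆ ZFSet.prod V V := by
  intro p hp
  obtain ⟨x, rfl⟩ := mem_range.1 hp
  exact pair_mem_prod.2 ⟨x.2, k.map_mem x.2⟩

/-- The graph of an embedding as an element of the type of the elements of `N`. -/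
noncomputable def Emb.grN (k : Emb N V) : El N := ⟨k.gr, k.gr_mem⟩

/-- Functionality and the preservation of each operation are universal statements about the graph of
`k`, so they pass to `j.ext k.gr`. Totality has an existential quantifier, but the values of `k` on
a level `b` lie in `k b`, which bounds it locally. -/
theorem Emb.exists_app (j k : Emb N V) : ∃ l : Emb N V, l.gr = j.ext k.gr := by
  have hk := k.isEmbRel
  refine exists_emb_gr_eq (j.ext_mem k.gr_mem) ?_ ?_
  · have h := j.ext_mono k.gr_subset
    rwa [j.ext_prod hV.mem hV.mem, j.ext_univ] at h
  have un : ∀ {F : ZFSet.{u} → ZFSet.{u}},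
      PreservesUn (fun x y : V => ZFSet.pair x.1 y.1 ∈ k.gr) F →
      (lift j).R (fun h : (((PUnit.{u + 2} × V) × V) × V) × V => h.1.2.1 = F h.1.1.1.2.1)
        (fun h : (((PUnit.{u + 2} × V) × V) × V) × V => h.1.2.1 = F h.1.1.1.2.1) →
      (lift j).R (fun h : (((PUnit.{u + 2} × V) × V) × V) × V => h.2.1 = F h.1.1.2.1)
        (fun h : (((PUnit.{u + 2} × V) × V) × V) × V => h.2.1 = F h.1.1.2.1) →
      PreservesUn (fun x y : V => ZFSet.pair x.1 y.1 ∈ j.ext k.gr) F := by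
    intro F hF h1 h2 x x' y y'
    let Φ (G : El N) (h : (((PUnit.{u + 2} × V) × V) × V) × V) : Prop :=
      ZFSet.pair h.1.1.1.2.1 h.1.1.2.1 ∈ G.1 → ZFSet.pair h.1.2.1 h.2.1 ∈ G.1 →
        h.1.2.1 = F h.1.1.1.2.1 → h.2.1 = F h.1.1.2.1
    have h : (lift j).R (Φ k.grN) (Φ (j.extN k.grN)) := by unfold Φ; infer_instance
    exact LiftRel.forall_of_forall h.out (fun g => hF _ _ _ _) ((((⟨⟩, x), x'), y), y')
  have bin : ∀ {F : ZFSet.{u} → ZFSet.{u} → ZFSet.{u}},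
      PreservesBin (fun x y : V => ZFSet.pair x.1 y.1 ∈ k.gr) F →
      (lift j).R (fun h : (((((PUnit.{u + 2} × V) × V) × V) × V) × V) × V =>
          h.1.2.1 = F h.1.1.1.1.1.2.1 h.1.1.1.2.1)
        (fun h : (((((PUnit.{u + 2} × V) × V) × V) × V) × V) × V =>
          h.1.2.1 = F h.1.1.1.1.1.2.1 h.1.1.1.2.1) →
      (lift j).R (fun h : (((((PUnit.{u + 2} × V) × V) × V) × V) × V) × V =>
          h.2.1 = F h.1.1.1.1.2.1 h.1.1.2.1)
        (fun h : (((((PUnit.{u + 2} × V) × V) × V) × V) × V) × V =>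
          h.2.1 = F h.1.1.1.1.2.1 h.1.1.2.1) →
      PreservesBin (fun x y : V => ZFSet.pair x.1 y.1 ∈ j.ext k.gr) F := by
    intro F hF h1 h2 x x' y y' z z'
    let Φ (G : El N) (h : (((((PUnit.{u + 2} × V) × V) × V) × V) × V) × V) : Prop :=
      ZFSet.pair h.1.1.1.1.1.2.1 h.1.1.1.1.2.1 ∈ G.1 →
      ZFSet.pair h.1.1.1.2.1 h.1.1.2.1 ∈ G.1 → ZFSet.pair h.1.2.1 h.2.1 ∈ G.1 →
      h.1.2.1 = F h.1.1.1.1.1.2.1 h.1.1.1.2.1 → h.2.1 = F h.1.1.1.1.2.1 h.1.1.2.1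
    have h : (lift j).R (Φ k.grN) (Φ (j.extN k.grN)) := by unfold Φ; infer_instance
    exact LiftRel.forall_of_forall h.out (fun g => hF _ _ _ _ _ _)
      ((((((⟨⟩, x), x'), y), y'), z), z')
  exact
    { total := fun x => by
        have h : (lift j).R
          (fun h : (PUnit.{u + 2} × V) × V => ZFSet.pair h.1.2.1 h.2.1 ∈ k.grN.1)
          (fun h : (PUnit.{u + 2} × V) × V => ZFSet.pair h.1.2.1 h.2.1 ∈ (j.extN k.grN).1) :=
          inferInstance
        refine LiftRel.forall_of_forall (LiftRel.ex_of_bounded h.out fun y hy => ?_)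
          (fun g => hk.total g.2) (⟨⟩, x)
        obtain ⟨b, hb, hl, hyb⟩ := LimitLevel.exists_level N hy
        refine ⟨k b, k.map_mem hb, fun g hg hx => ⟨k.sub g.2, ?_, pair_mem_gr.2 ⟨g.2.2, rfl⟩⟩⟩
        rw [tup_cons] at hg
        exact (k.map_mem_map g.2.2 hb).2
          (hl.isTransitive.of_pair_mem (hl.isTransitive _ hyb hg)).2
      functional := fun x y z => by
        let Φ (G : El N) (h : ((PUnit.{u + 2} × V) × V) × V) : Prop :=
          ZFSet.pair h.1.1.2.1 h.1.2.1 ∈ G.1 → ZFSet.pair h.1.1.2.1 h.2.1 ∈ G.1 → h.1.2 = h.2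
        have h : (lift j).R (Φ k.grN) (Φ (j.extN k.grN)) := by unfold Φ; infer_instance
        exact LiftRel.forall_of_forall h.out (fun g => hk.functional _ _ _) (((⟨⟩, x), y), z)
      sdiff := bin hk.sdiff inferInstance inferInstance
      prod := bin hk.prod inferInstance inferInstance
      dom := un hk.dom inferInstance inferInstance
      singleton := un hk.singleton inferInstance inferInstance
      memPart := un hk.memPart inferInstance inferInstance
      eqPart := un hk.eqPart inferInstance inferInstance
      insPart := bin hk.insPart inferInstance inferInstance
      pw := un hk.pw inferInstance inferInstance }

/-- The application of an embedding `j` to an embedding `k`: its graph is the canonical extension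
of `j` at the graph of `k`. -/
noncomputable def Emb.app (j k : Emb N V) : Emb N V := (j.exists_app k).choose

namespace Emb

variable (j k l : Emb N V)

theorem gr_app : (j.app k).gr = j.ext k.gr := (j.exists_app k).choose_spec

theorem grN_app : j.extN k.grN = (j.app k).grN := Subtype.ext (gr_app j k).symm

theorem pair_mem_grN {x y : V} : ZFSet.pair x.1 y.1 ∈ k.grN.1 ↔ y.1 = k x.1 := by
  rw [show k.grN.1 = k.gr from rfl, pair_mem_gr, and_iff_right x.2]

theorem app_map {x : ZFSet.{u}} (hx : x ∈ V) : j.app k (j x) = j (k x) := by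
  have h : ZFSet.pair x (k x) ∈ k.gr := pair_mem_gr.2 ⟨hx, rfl⟩
  rw [← j.map_mem_ext k.gr_mem (LimitLevel.pair N hx (k.map_mem hx)),
    j.map_pair hx (k.map_mem hx), ← gr_app] at h
  exact (pair_mem_gr.1 h).2.symm

/-- A first-order form of the definition of the canonical extension. -/
theorem mem_ext_iff_of_eq_inter {A y : ZFSet.{u}} (hA : A ∈ N) {b w : V} (hy : y ∈ k b.1)
    (hw : (∀ z : V, z.1 ∈ w.1 → z.1 ∈ b.1 ∧ z.1 ∈ A) ∧
      ∀ z : V, z.1 ∈ b.1 → z.1 ∈ A → z.1 ∈ w.1) : y ∈ k.ext A ↔ y ∈ k w.1 := by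
  rw [k.mem_ext_iff hA b.2 hy]
  suffices A ∩ b.1 = w.1 by rw [this]
  ext z
  rw [mem_inter]
  exact ⟨fun h => hw.2 ⟨z, LimitLevel.trans N b.2 h.2⟩ h.2 h.1,
    fun h => (hw.1 ⟨z, LimitLevel.trans N w.2 h⟩ h).symm⟩

/-- Locally, `k.ext A` is described by a universal statement: if `w = A ∩ b` and `y ∈ k b`, then `y
∈ k.ext A ↔ y ∈ k w`. Its image under `j` says the same of `j.app k`, `j.ext A` and `j.ext (k.ext
A)`. -/
theorem ext_ext {A : ZFSet.{u}} (hA : A ∈ N) : j.ext (k.ext A) = (j.app k).ext (j.ext A) := by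
  set E : El N := ⟨k.ext A, k.ext_mem hA⟩ with hE
  set A' : El N := ⟨A, hA⟩ with hA'
  let Φ (G A' E : El N) (h : ((((PUnit.{u + 2} × V) × V) × V) × V) × V) : Prop :=
    ZFSet.pair h.1.1.1.1.2.1 h.1.1.1.2.1 ∈ G.1 → ZFSet.pair h.1.1.2.1 h.1.2.1 ∈ G.1 →
    h.2.1 ∈ h.1.1.1.2.1 → ((∀ z : V, z.1 ∈ h.1.1.2.1 → z.1 ∈ h.1.1.1.1.2.1 ∧ z.1 ∈ A'.1) ∧
    ∀ z : V, z.1 ∈ h.1.1.1.1.2.1 → z.1 ∈ A'.1 → z.1 ∈ h.1.1.2.1) →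
    (h.2.1 ∈ E.1 ↔ h.2.1 ∈ h.1.2.1)
  have h : (lift j).R (Φ k.grN A' E) (Φ (j.extN k.grN) (j.extN A') (j.extN E)) := by
    unfold Φ; infer_instance
  have h' := LiftRel.forall_of_forall h.out (fun g => show Φ k.grN A' E g from fun h1 h2 hy hw => by
    rw [pair_mem_grN] at h1 h2
    rw [h1] at hy
    rw [h2]
    exact k.mem_ext_iff_of_eq_inter hA hy hw)
  ext y
  by_cases hy : y ∈ V
  swap
  · exact ⟨fun h => absurd (j.ext_subset _ h) hy, fun h => absurd (Emb.ext_subset _ _ h) hy⟩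
  obtain ⟨b, hb, hl, -, hyb⟩ := (j.app k).exists_mem_map hy
  have hw : j.ext A ∩ b ∈ V := inter_mem_V (j.ext_mem hA) hb
  have := h' (((((⟨⟩, ⟨b, hb⟩), (j.app k).sub ⟨b, hb⟩), ⟨_, hw⟩), (j.app k).sub ⟨_, hw⟩), ⟨y, hy⟩)
  unfold Φ at this
  rw [grN_app, pair_mem_grN, pair_mem_grN] at this
  rw [(j.app k).mem_ext_iff (j.ext_mem hA) hb hyb]
  refine this rfl rfl hyb ⟨fun z hz => ?_, fun z hz hzA => ?_⟩
  · exact (mem_inter.1 hz).symm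
  · exact mem_inter.2 ⟨hzA, hz⟩

/-- The left-distributive law: `ext_ext` for the graph of `l`. -/
theorem app_app : j.app (k.app l) = (j.app k).app (j.app l) := by
  refine toFun_eq_of_gr_eq ?_
  rw [gr_app, gr_app, gr_app, gr_app, ext_ext _ _ l.gr_mem]

/-- The iterates of an embedding under self-application. -/
noncomputable def it : ℕ → Emb N V
  | 0 => j
  | n + 1 => (it n).app (it n)

/-- By left distributivity `j · (j_n · j_n) = (j · j_n) · (j · j_n)`. So `j` shifts the sequence of
its iterates by one; both fixed point arguments below rest on this shift. -/
theorem app_it (n : ℕ) : j.app (j.it n) = j.it (n + 1) := by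
  induction n with
  | zero => rfl
  | succ n ih =>
    rw [it, app_app, ih]
    rfl

theorem it_add (m n : ℕ) : (j.it m).it n = j.it (m + n) := by
  induction n with
  | zero => rfl
  | succ n ih => rw [it, ih]; rfl

end Emb

end

end RankEmbedding

namespace RankEmbedding

open ZFSet

set_option linter.unusedSectionVars false
set_option synthInstance.maxSize 5000
set_option synthInstance.maxHeartbeats 400000

variable {N : Set ZFSet.{u}} {V : ZFSet.{u}}

section

variable [hN : Fact (IsTransitiveZFModel N)] [hV : LimitLevel N V] [tV : TransCl fun x => x ∈ V]

/-! ## Embeddings map levels to levels -/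

namespace LimitLevel

include hN hV

variable (N) in
theorem level_mem_of_rank {x : ZFSet.{u}} (hx : x ∈ V) : level N (rank x) ∈ V := by
  rw [← rk_eq_rank (LimitLevel.isTransitive N) hx]
  exact lrank_mem N hV.mem (fun _ h => h) hx

variable (N) in
theorem subset_level_rank {x : ZFSet.{u}} (hx : x ∈ V) : x ⊆ level N (rank x) :=
  (subset_level_iff (mem_N N hx)).2 le_rfl

theorem lt_of_level_mem {γ δ : Ordinal.{u}} (h : V = level N δ) (hγ : level N γ ∈ V) : γ < δ :=
  lt_of_level_mem_level (h ▸ hγ)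

variable (N) in
theorem level_mem_of_toZFSet {γ : Ordinal.{u}} (h : γ.toZFSet ∈ V) : level N γ ∈ V := by
  simpa using level_mem_of_rank N h

theorem level_mem_of_le {γ γ' : Ordinal.{u}} (h : level N γ ∈ V) (hγ : γ' ≤ γ) :
    level N γ' ∈ V := by
  obtain ⟨δ, hδ, e, h'⟩ := hV.exists_eq
  have h1 : γ' < δ := hγ.trans_lt (lt_of_level_mem e h)
  exact level_mem_of_toZFSet N (e ▸ mem_level.2 ⟨by simpa using h1, h' γ' h1⟩)

end LimitLevel

/-- The union of the power sets of the elements of `a` is `v`. -/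
def IsUnionPw (a v : V) : Prop :=
  (∀ z : V, z.1 ∈ v.1 → ∃ w : V, w.1 ∈ a.1 ∧ z.1 ⊆ w.1) ∧
    ∀ w : V, w.1 ∈ a.1 → ∀ z : V, z.1 ⊆ w.1 → z.1 ∈ v.1

/-- The set `a` witnesses that `v` is a level. -/
def IsLevelWitness (a v : V) : Prop :=
  IsUnionPw a v ∧ ∀ w : V, w.1 ∈ a.1 →
    (∀ z : V, z.1 ∈ w.1 → ∃ w' : V, w'.1 ∈ a.1 ∧ w'.1 ∈ w.1 ∧ z.1 ⊆ w'.1) ∧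
    ∀ w' : V, w'.1 ∈ a.1 → w'.1 ∈ w.1 → ∀ z : V, z.1 ⊆ w'.1 → z.1 ∈ w.1

/-- A union of power sets of levels is the level whose height is its rank. -/
theorem isLevel_of_subset_levels {v : ZFSet.{u}} (hv : v ∈ V)
    (h : ∀ z : V, z.1 ∈ v → ∃ w : V, IsLevel N w.1 ∧ z.1 ⊆ w.1 ∧ ∀ z : V, z.1 ⊆ w.1 → z.1 ∈ v) :
    IsLevel N v := by
  refine ⟨rank v, ZFSet.ext fun z => ?_⟩
  rw [mem_level]
  refine ⟨fun hz => ⟨rank_lt_of_mem hz, LimitLevel.mem_N N (LimitLevel.trans N hv hz)⟩, ?_⟩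
  rintro ⟨hz, hzN⟩
  obtain ⟨y, hy, hzy⟩ := lt_rank_iff.1 hz
  obtain ⟨w, ⟨γ, hγ⟩, hyw, h'⟩ := h ⟨y, LimitLevel.trans N hv hy⟩ hy
  rw [hγ, subset_level_iff (LimitLevel.mem_N N (LimitLevel.trans N hv hy))] at hyw
  have hzw : z ⊆ w.1 := by rw [hγ, subset_level_iff hzN]; exact hzy.trans hyw
  exact h' ⟨z, LimitLevel.mem_of_subset N w.2 hzN hzw⟩ hzw

theorem exists_level_mem {v z : ZFSet.{u}} (hv : v ∈ V) (hl : IsLevel N v) (hz : z ∈ v) :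
    ∃ w : V, IsLevel N w.1 ∧ w.1 ∈ v ∧ z ⊆ w.1 := by
  have hzV := LimitLevel.trans N hv hz
  refine ⟨⟨_, LimitLevel.level_mem_of_rank N hzV⟩, ⟨_, rfl⟩, ?_, LimitLevel.subset_level_rank N hzV⟩
  obtain ⟨γ, rfl⟩ := hl
  exact level_mem_level (mem_level.1 hz).1
    (LimitLevel.mem_N N (LimitLevel.level_mem_of_rank N hzV))

/-- The witness is the set of all levels in `v`; conversely, `∈`-induction shows that the elements
of a witness are levels. All quantifiers range over elements or subsets of given sets, so every
embedding preserves levels, exact or not. -/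
theorem isLevel_iff_exists_witness (v : V) :
    IsLevel N v.1 ↔ ∃ a : V, a.1 ⊆ v.1 ∧ IsLevelWitness a v := by
  constructor
  · intro hl
    have ha : levels N V ∩ v.1 ∈ V := Emb.inter_mem_V levels_mem v.2
    have mema : ∀ w : V, w.1 ∈ levels N V ∩ v.1 ↔ IsLevel N w.1 ∧ w.1 ∈ v.1 := fun w => by
      rw [mem_inter, mem_levels, and_iff_right w.2]
    refine ⟨⟨_, ha⟩, fun w hw => (mem_inter.1 hw).2, ⟨fun z hz => ?_, fun w hw z hz => ?_⟩,
      fun w hw => ⟨fun z hz => ?_, fun w' hw' hw'w z hz => ?_⟩⟩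
    · obtain ⟨w, h1, h2, h3⟩ := exists_level_mem v.2 hl hz
      exact ⟨w, (mema w).2 ⟨h1, h2⟩, h3⟩
    · exact hl.mem_of_subset ((mema w).1 hw).2 (LimitLevel.mem_N N z.2) hz
    · obtain ⟨h1, h2⟩ := (mema w).1 hw
      obtain ⟨w', h3, h4, h5⟩ := exists_level_mem w.2 h1 hz
      exact ⟨w', (mema w').2 ⟨h3, hl.isTransitive _ h2 h4⟩, h4, h5⟩
    · exact ((mema w).1 hw).1.mem_of_subset hw'w (LimitLevel.mem_N N z.2) hz
  · rintro ⟨a, -, ⟨h1, h2⟩, h3⟩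
    have key : ∀ w ∈ a.1, IsLevel N w := by
      intro w
      induction w using ZFSet.inductionOn with
      | _ w ih =>
        intro hw
        obtain ⟨h4, h5⟩ := h3 ⟨w, LimitLevel.trans N a.2 hw⟩ hw
        refine isLevel_of_subset_levels (LimitLevel.trans N a.2 hw) fun z hz => ?_
        obtain ⟨w', hw'a, hw'w, hz⟩ := h4 z hz
        exact ⟨w', ih _ hw'w hw'a, hz, fun z hz => h5 w' hw'a hw'w z hz⟩
    refine isLevel_of_subset_levels v.2 fun z hz => ?_
    obtain ⟨w, hw, hz⟩ := h1 z hz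
    exact ⟨w, key _ hw, hz, fun z hz => h2 w hw z hz⟩

variable {Γ : Type (u + 1)} [c : Cxt PUnit.{u + 2} V Γ] {k : Emb N V} {s s' t t' : Γ → V}

instance lift.isLevel [(lift k).T s s'] :
    (lift k).R (fun g => IsLevel N (s g).1) (fun g => IsLevel N (s' g).1) := by
  refine Logic.R.congr (P := fun g => ∃ a : V, a.1 ⊆ (s g).1 ∧ IsLevelWitness a (s g))
    (P' := fun g => ∃ a : V, a.1 ⊆ (s' g).1 ∧ IsLevelWitness a (s' g)) ?_
    (fun _ => isLevel_iff_exists_witness _) (fun _ => isLevel_iff_exists_witness _)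
  unfold IsLevelWitness IsUnionPw
  infer_instance

/-- A closed statement is preserved by embeddings. -/
theorem lift.iff {P P' : Prop} (h : (lift k).R (fun _ : PUnit.{u + 2} => P)
    (fun _ : PUnit.{u + 2} => P')) : P ↔ P' := LiftRel.iff h.out

namespace Emb

variable (k)

theorem isLevel_map_iff {v : ZFSet.{u}} (hv : v ∈ V) : IsLevel N (k v) ↔ IsLevel N v :=
  (lift.iff (k := k) (P := IsLevel N (⟨v, hv⟩ : V).1) (P' := IsLevel N (k.sub ⟨v, hv⟩).1)
    inferInstance).symm

theorem isLevel_map {v : ZFSet.{u}} (hv : v ∈ V) (h : IsLevel N v) : IsLevel N (k v) :=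
  (k.isLevel_map_iff hv).2 h

/-! ## The critical level -/

/-- Induction on the rank: `x` is a subset of the level of height `rank x`, and this level and its
elements are fixed. Hence a nontrivial embedding moves a level, and `crit` is meaningful. -/
theorem map_eq_of_rank_lt {γ : Ordinal.{u}}
    (h : ∀ γ' < γ, level N γ' ∈ V → k (level N γ') = level N γ') {x : ZFSet.{u}} (hx : x ∈ V)
    (hxγ : rank x < γ) : k x = x := by
  induction x using WellFounded.induction (InvImage.wf rank wellFounded_lt) with
  | _ x ih =>
    have hl := LimitLevel.level_mem_of_rank N hx
    have hs := LimitLevel.subset_level_rank N hx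
    have key : ∀ y ∈ level N (rank x), k y = y := fun y hy =>
      ih y (mem_level.1 hy).1 (LimitLevel.trans N hl hy) ((mem_level.1 hy).1.trans hxγ)
    ext y
    constructor
    · intro hy
      have hy' : y ∈ level N (rank x) := by
        rw [← h _ hxγ hl]
        exact k.map_subset hx hl hs hy
      rwa [← k.map_mem_map (LimitLevel.trans N hl hy') hx, key y hy']
    · intro hy
      have := (k.map_mem_map (LimitLevel.trans N hx hy) hx).2 hy
      rwa [key y (hs hy)] at this

/-- The embedding `k` is not the identity. -/
def NonTriv (k : Emb N V) : Prop := ∃ x ∈ V, k x ≠ x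

/-- The level of height `γ` is moved by `k`. -/
def Moves (k : Emb N V) (γ : Ordinal.{u}) : Prop := level N γ ∈ V ∧ k (level N γ) ≠ level N γ

theorem NonTriv.exists_moves {k : Emb N V} (h : k.NonTriv) : ∃ γ, k.Moves γ := by
  by_contra! h'
  obtain ⟨x, hx, hne⟩ := h
  refine hne (k.map_eq_of_rank_lt (γ := Order.succ (rank x)) (fun γ _ hγ => ?_) hx
    (Order.lt_succ _))
  by_contra h2
  exact h' γ ⟨hγ, h2⟩

/-- The height of the least level that is moved by `k`. -/
noncomputable def crit (k : Emb N V) : Ordinal.{u} := sInf {γ | k.Moves γ}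

theorem NonTriv.moves_crit {k : Emb N V} (h : k.NonTriv) : k.Moves k.crit :=
  csInf_mem (s := {γ | k.Moves γ}) h.exists_moves

theorem crit_le {γ : Ordinal.{u}} (h : k.Moves γ) : k.crit ≤ γ := csInf_le' h

theorem mem_map_of_level {v : ZFSet.{u}} (hv : v ∈ V) (hl : IsLevel N v) (hne : k v ≠ v) :
    v ∈ k v :=
  hl.mem_of_ssubset (k.isLevel_map hv hl) (LimitLevel.mem_N N hv) (LimitLevel.mem_N N (k.map_mem hv))
    (k.level_subset_map hv hl) (Ne.symm hne)

/-! ## Levels of finite height -/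

include hN hV in
theorem _root_.RankEmbedding.level_nat_mem (n : ℕ) : level N n ∈ V := by
  induction n with
  | zero =>
    have : level N (0 : ℕ) = ∅ := (eq_empty _).2 fun y hy => by simpa using (mem_level.1 hy).1
    rw [this]; exact empty_mem (N := N)
  | succ n ih => rw [Nat.cast_succ, level_add_one]; exact LimitLevel.pw N ih

theorem _root_.RankEmbedding.level_nat_zero : level N (0 : ℕ) = ∅ :=
  (eq_empty _).2 fun y hy => by simpa using (mem_level.1 hy).1

theorem map_level_nat (n : ℕ) : k (level N n) = level N n := by
  induction n with
  | zero => rw [level_nat_zero, k.map_empty]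
  | succ n ih => rw [Nat.cast_succ, level_add_one, k.map_pw (level_nat_mem n), ih]

theorem not_moves_nat (n : ℕ) : ¬ k.Moves n := fun h => h.2 (k.map_level_nat n)

theorem NonTriv.level_omega_mem {k : Emb N V} (h : k.NonTriv) : level N Ordinal.omega0 ∈ V := by
  have h1 : Ordinal.omega0 ≤ k.crit := by
    by_contra! h'
    obtain ⟨n, hn⟩ := Ordinal.lt_omega0.1 h'
    exact k.not_moves_nat n (hn ▸ h.moves_crit)
  exact LimitLevel.level_mem_of_le h.moves_crit.1 h1

/-- Otherwise `V_ω ∈ k(V_ω)`. Every nonempty level in `V_ω` is the power set of one of its elements,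
so the same holds in `k(V_ω)`; but `V_ω` itself is not of this form, for reasons of rank. -/
theorem map_level_omega (h : level N Ordinal.omega0 ∈ V) :
    k (level N Ordinal.omega0) = level N Ordinal.omega0 := by
  by_contra hne
  have h1 := k.mem_map_of_level h ⟨_, rfl⟩ hne
  set W : V := ⟨_, h⟩ with hW
  let Φ (W : V) : Prop := ∀ v : V, v.1 ∈ W.1 → IsLevel N v.1 → ∀ z : V, z.1 ∈ v.1 →
    ∃ w : V, w.1 ∈ v.1 ∧ v.1 = pw N w.1
  have h2 : Φ W ↔ Φ (k.sub W) := lift.iff (k := k) (by unfold Φ; infer_instance)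
  have h3 : Φ W := by
    intro v hv hl z hz
    obtain ⟨γ, hγ⟩ := hl
    have hγω : γ < Ordinal.omega0 := lt_of_level_mem_level (hγ ▸ hv)
    obtain ⟨n, rfl⟩ := Ordinal.lt_omega0.1 hγω
    rcases n with _ | n
    · rw [hγ, level_nat_zero] at hz
      exact absurd hz (notMem_empty _)
    · rw [Nat.cast_succ, level_add_one] at hγ
      refine ⟨⟨level N n, level_nat_mem n⟩, ?_, hγ⟩
      rw [hγ, mem_pw]
      exact ⟨fun _ h => h, LimitLevel.mem_N N (level_nat_mem (V := V) n)⟩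
  obtain ⟨w, hw, e⟩ := h2.1 h3 W h1 ⟨_, rfl⟩ ⟨level N (0 : ℕ), level_nat_mem 0⟩
    (level_mem_level (by simp)
      (LimitLevel.mem_N N (level_nat_mem (V := V) 0)))
  have hw' : rank w.1 + 1 < Ordinal.omega0 :=
    Ordinal.isSuccLimit_omega0.succ_lt (mem_level.1 hw).1
  have h4 : rank W.1 ≤ rank w.1 + 1 := by
    rw [e]
    refine (rank_mono (y := powerset w.1) sep_subset).trans ?_
    rw [rank_powerset]; rfl
  refine absurd ?_ (mem_irrefl W.1)
  exact mem_level.2 ⟨h4.trans_lt hw', LimitLevel.mem_N N h⟩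

theorem app_map_eq {j k : Emb N V} {x : ZFSet.{u}} (hx : x ∈ V) (h : j x = x) :
    j.app k x = j (k x) := by
  have := app_map j k hx
  rwa [h] at this

theorem it_map_eq {m n : ℕ} (hmn : m ≤ n) {x : ZFSet.{u}} (hx : x ∈ V) (h : k.it m x = x) :
    k.it n x = x := by
  induction n, hmn using Nat.le_induction with
  | base => exact h
  | succ n _ ih => rw [it, app_map_eq hx ih, ih, ih]

end Emb

/-! ## The sequence of the iterates as a set -/

/-- The graph of the self-application of the embedding with the graph `G`. -/
def IsAppGraph (V G G' : El N) : Prop :=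
  ∀ p : El N, p.1 ∈ G'.1 ↔ ∃ x y : El N, p.1 = pair x.1 y.1 ∧ ∃ z : El N, z.1 ∈ V.1 ∧ z.1 ⊆ G.1 ∧
    ∃ z' : El N, pair z.1 z'.1 ∈ G.1 ∧ p.1 ∈ z'.1

theorem Emb.isAppGraph_iff (k : Emb N V) (G' : El N) :
    IsAppGraph ⟨V, hV.mem⟩ k.grN G' ↔ G' = (k.app k).grN := by
  have h : ∀ p : El N, p.1 ∈ (k.app k).gr ↔ ∃ x y : El N, p.1 = pair x.1 y.1 ∧
      ∃ z : El N, z.1 ∈ V ∧ z.1 ⊆ k.gr ∧ ∃ z' : El N, pair z.1 z'.1 ∈ k.gr ∧ p.1 ∈ z'.1 := by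
    intro p
    constructor
    · intro hp
      obtain ⟨x, hx, y, hy, e⟩ := mem_prod.1 ((k.app k).gr_subset hp)
      rw [gr_app] at hp
      obtain ⟨-, z, hz, hzk, hp⟩ := mem_ext.1 hp
      exact ⟨⟨x, LimitLevel.mem_N N hx⟩, ⟨y, LimitLevel.mem_N N hy⟩, e,
        ⟨z, LimitLevel.mem_N N hz⟩, hz, hzk, (⟨k z, LimitLevel.mem_N N (k.map_mem hz)⟩ : El N),
        pair_mem_gr.2 ⟨hz, rfl⟩, hp⟩
    · rintro ⟨x, y, -, z, hz, hzk, z', hz', hp⟩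
      rw [gr_app]
      rw [(pair_mem_gr.1 hz').2] at hp
      exact mem_ext.2 ⟨LimitLevel.trans N (k.map_mem hz) hp, z, hz, hzk, hp⟩
  constructor
  · intro hG
    refine Subtype.ext (ZFSet.ext fun p => ⟨fun hp => ?_, fun hp => ?_⟩)
    · exact (h ⟨p, mem_of_mem G'.2 hp⟩).2 ((hG ⟨p, mem_of_mem G'.2 hp⟩).1 hp)
    · have hpN := mem_of_mem (k.app k).gr_mem hp
      exact (hG ⟨p, hpN⟩).2 ((h ⟨p, hpN⟩).1 hp)
  · rintro rfl
    exact h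

/-- Approximations to the sequence of the iterates, indexed by the levels of finite height. -/
def IsIterApprox (V G g : El N) : Prop :=
  ∀ v H : El N, pair v.1 H.1 ∈ g.1 → ((∀ z : El N, ¬ z.1 ∈ v.1) ∧ H = G) ∨
    ∃ w H' : El N, pair w.1 H'.1 ∈ g.1 ∧ (∀ z : El N, z.1 ∈ v.1 ↔ z.1 ⊆ w.1) ∧ IsAppGraph V H' H

theorem eq_level_nat_of_mem {v : ZFSet.{u}} (hv : v ∈ level N Ordinal.omega0)
    (hl : IsLevel N v) : ∃ n : ℕ, v = level N n := by
  obtain ⟨γ, rfl⟩ := hl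
  obtain ⟨n, rfl⟩ := Ordinal.lt_omega0.1 (lt_of_level_mem_level hv)
  exact ⟨n, rfl⟩

theorem level_nat_succ (n : ℕ) : level N (n + 1 : ℕ) = pw N (level N n) := by
  rw [Nat.cast_succ, level_add_one]

namespace Emb

variable (k)

theorem eq_of_isIterApprox {g v H : El N} (hg : IsIterApprox ⟨V, hV.mem⟩ k.grN g)
    (h : pair v.1 H.1 ∈ g.1) : ∃ n : ℕ, v.1 = level N n ∧ H = (k.it n).grN := by
  obtain ⟨v, hv⟩ := v
  induction v using ZFSet.inductionOn generalizing H with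
  | _ v ih =>
    rcases hg _ _ h with ⟨h1, h2⟩ | ⟨w, H', h1, h2, h3⟩
    · refine ⟨0, ?_, h2⟩
      rw [level_nat_zero, eq_empty]
      exact fun y hy => h1 ⟨y, mem_of_mem hv hy⟩ hy
    · obtain ⟨n, hn, rfl⟩ := ih w.1 ((h2 w).2 fun _ h => h) w.2 h1
      refine ⟨n + 1, ?_, (isAppGraph_iff _ _).1 h3⟩
      rw [level_nat_succ]
      ext z
      rw [mem_pw, ← hn]
      exact ⟨fun hz => ⟨(h2 ⟨z, mem_of_mem hv hz⟩).1 hz, mem_of_mem hv hz⟩,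
        fun hz => (h2 ⟨z, hz.2⟩).2 hz.1⟩

theorem exists_isIterApprox (n : ℕ) : ∃ g v H : El N, IsIterApprox ⟨V, hV.mem⟩ k.grN g ∧
    v.1 = level N n ∧ H = (k.it n).grN ∧ pair v.1 H.1 ∈ g.1 := by
  induction n with
  | zero =>
    have h0 : level N (0 : ℕ) ∈ N := LimitLevel.mem_N N (level_nat_mem (V := V) 0)
    refine ⟨⟨_, singleton_mem (pair_mem h0 k.gr_mem)⟩, ⟨_, h0⟩, k.grN, fun v H h => Or.inl ?_,
      rfl, rfl, mem_singleton.2 rfl⟩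
    obtain ⟨h1, h2⟩ := pair_inj.1 (mem_singleton.1 h)
    refine ⟨fun z => ?_, Subtype.ext h2⟩
    rw [h1, level_nat_zero]
    exact notMem_empty _
  | succ n ih =>
    obtain ⟨g, v, H, hg, hv, rfl, h⟩ := ih
    have h0 : level N (n + 1 : ℕ) ∈ N := LimitLevel.mem_N N (level_nat_mem (V := V) _)
    refine ⟨⟨_, union_mem g.2 (singleton_mem (pair_mem h0 (k.it (n + 1)).gr_mem))⟩, ⟨_, h0⟩, _,
      fun v' H' h' => ?_, rfl, rfl, mem_union.2 (Or.inr (mem_singleton.2 rfl))⟩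
    rcases mem_union.1 h' with h' | h'
    · refine (hg v' H' h').imp id ?_
      rintro ⟨w, H'', h1, h2⟩
      exact ⟨w, H'', mem_union.2 (Or.inl h1), h2⟩
    · obtain ⟨h1, h2⟩ := pair_inj.1 (mem_singleton.1 h')
      refine Or.inr ⟨v, (k.it n).grN, mem_union.2 (Or.inl h), fun z => ?_,
        (isAppGraph_iff _ _).2 (Subtype.ext h2)⟩
      rw [h1, level_nat_succ, mem_pw, hv]
      exact and_iff_left z.2

/-- The sequence of the iterates of an embedding, as a ternary relation. -/
noncomputable def iter : ZFSet.{u} := ZFSet.sep (fun q => ∃ (n : ℕ) (x : V),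
  q = pair (level N n) (pair x.1 (k.it n x.1))) V

theorem mem_iter {v x y : ZFSet.{u}} : pair v (pair x y) ∈ k.iter ↔
    ∃ n : ℕ, v = level N n ∧ x ∈ V ∧ y = k.it n x := by
  rw [iter, mem_sep]
  constructor
  · rintro ⟨-, n, x', h⟩
    obtain ⟨h1, h2⟩ := pair_inj.1 h
    obtain ⟨h3, h4⟩ := pair_inj.1 h2
    exact ⟨n, h1, h3 ▸ x'.2, by rw [h4, h3]⟩
  · rintro ⟨n, rfl, hx, rfl⟩
    exact ⟨LimitLevel.pair N (level_nat_mem n) (LimitLevel.pair N hx ((k.it n).map_mem hx)),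
      n, ⟨x, hx⟩, rfl⟩

variable (V) in
include hN hV in
theorem level_nat_inj {m n : ℕ} : level N m = level N n ↔ m = n := by
  refine ⟨fun h => ?_, fun h => h ▸ rfl⟩
  rcases lt_trichotomy m n with h' | h' | h'
  · have := level_mem_level (N := N) (Nat.cast_lt.2 h' : (m : Ordinal.{u}) < n)
      (LimitLevel.mem_N N (level_nat_mem (V := V) _))
    exact absurd (h ▸ this) (mem_irrefl _)
  · exact h'
  · have := level_mem_level (N := N) (Nat.cast_lt.2 h' : (n : Ordinal.{u}) < m)
      (LimitLevel.mem_N N (level_nat_mem (V := V) _))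
    exact absurd (h ▸ this) (mem_irrefl _)

/-- The recursion takes place outside `N`, but its finite approximations are in `N` and
self-application is definable there. As an element of `N`, the sequence of the iterates can be moved
by canonical extensions. -/
theorem iter_mem : k.iter ∈ N :=
  sep_mem_of_definable hV.mem _ (fun q => ∃ v p : El N, q.1 = pair v.1 p.1 ∧ ∃ g H : El N,
    (∀ v H : El N, pair v.1 H.1 ∈ g.1 → ((∀ z : El N, ¬ z.1 ∈ v.1) ∧ H = k.grN) ∨
      ∃ w H' : El N, pair w.1 H'.1 ∈ g.1 ∧ (∀ z : El N, z.1 ∈ v.1 ↔ z.1 ⊆ w.1) ∧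
      ∀ p : El N, p.1 ∈ H.1 ↔ ∃ x y : El N, p.1 = pair x.1 y.1 ∧
        ∃ z : El N, z.1 ∈ (⟨V, hV.mem⟩ : El N).1 ∧ z.1 ⊆ H'.1 ∧
        ∃ z' : El N, pair z.1 z'.1 ∈ H'.1 ∧ p.1 ∈ z'.1) ∧ pair v.1 H.1 ∈ g.1 ∧ p.1 ∈ H.1)
    fun q _ => by
    constructor
    · rintro ⟨n, x, e⟩
      obtain ⟨g, v, H, hg, hv, rfl, h⟩ := k.exists_isIterApprox n
      have hp : pair x.1 (k.it n x.1) ∈ (k.it n).gr := pair_mem_gr.2 ⟨x.2, rfl⟩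
      exact ⟨v, ⟨_, mem_of_mem (k.it n).gr_mem hp⟩, by rw [e, hv], g, _, hg, h, hp⟩
    · rintro ⟨v, p, e, g, H, hg, h, hp⟩
      obtain ⟨n, hv, rfl⟩ := k.eq_of_isIterApprox hg h
      obtain ⟨x, hx⟩ := mem_range.1 (show p.1 ∈ (k.it n).gr from hp)
      exact ⟨n, x, by rw [e, hv, ← hx]⟩

/-- The sequence of the iterates as an element of the type of the elements of `N`. -/
noncomputable def iterN : El N := ⟨k.iter, k.iter_mem⟩

instance _root_.RankEmbedding.lift.triple {r r' : Γ → V} [(lift k).T s s'] [(lift k).T t t']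
    [(lift k).T r r'] (A : El N) :
    (lift k).R (fun g => ZFSet.pair (s g).1 (ZFSet.pair (t g).1 (r g).1) ∈ A.1)
      (fun g => ZFSet.pair (s' g).1 (ZFSet.pair (t' g).1 (r' g).1) ∈ (k.extN A).1) :=
  (inferInstance : (lift k).R
    (fun g => ZFSet.pair (s g).1 (lift.pairV N (t g) (r g)).1 ∈ A.1)
    (fun g => ZFSet.pair (s' g).1 (lift.pairV N (t' g) (r' g)).1 ∈ (k.extN A).1))

/-- A correspondence between the section of `f` at `a` and `G` is preserved. -/
theorem ext_section {f a G : ZFSet.{u}} (hf : f ∈ N) (ha : a ∈ V) (hG : G ∈ N)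
    (h : ∀ x y : V, pair a (pair x.1 y.1) ∈ f ↔ pair x.1 y.1 ∈ G) (x y : V) :
    pair (k a) (pair x.1 y.1) ∈ k.ext f ↔ pair x.1 y.1 ∈ k.ext G := by
  let Φ (f G : El N) (a : V) (h : (PUnit.{u + 2} × V) × V) : Prop :=
    pair a.1 (pair h.1.2.1 h.2.1) ∈ f.1 ↔ pair h.1.2.1 h.2.1 ∈ G.1
  have h' : (lift k).R (Φ ⟨f, hf⟩ ⟨G, hG⟩ ⟨a, ha⟩)
    (Φ (k.extN ⟨f, hf⟩) (k.extN ⟨G, hG⟩) (k.sub ⟨a, ha⟩)) := by unfold Φ; infer_instance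
  exact LiftRel.forall_of_forall h'.out (fun g => h g.1.2 g.2) ((⟨⟩, x), y)

/-- Since `k` fixes the index `V_n`, the section there of the moved sequence is `k^+` of the graph
of `k_n`, which is the graph of `k · k_n = k_{n+1}`. -/
theorem mem_ext_iter {n : ℕ} (x y : V) :
    pair (level N n) (pair x.1 y.1) ∈ k.ext k.iter ↔ y.1 = k.it (n + 1) x.1 := by
  have := k.ext_section k.iter_mem (level_nat_mem n) (k.it n).gr_mem (fun x y => by
    rw [mem_iter, pair_mem_gr]
    constructor
    · rintro ⟨m, h, hx⟩
      obtain rfl := (level_nat_inj V).1 h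
      exact hx
    · exact fun hx => ⟨n, rfl, hx⟩) x y
  rw [map_level_nat] at this
  rw [this, ← gr_app, app_it, pair_mem_gr, and_iff_right x.2]

/-- Every level is fixed by some iterate. -/
theorem NonTriv.exists_it_eq {k : Emb N V} (hk : k.NonTriv) {b : ZFSet.{u}} (hb : b ∈ V)
    (hl : IsLevel N b) : ∃ n, k.it n b = b := by
  induction b using ZFSet.inductionOn with
  | _ b ih =>
    by_contra! hne
    have hW := hk.level_omega_mem
    -- For the least counterexample `b`, every level in `b` is fixed by some iterate, whose index is
    -- a level in `V_ω`. Applying `k`, every level in `k b` is fixed by some `k_{m+1}`; as `k` moves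
    -- `b`, one of these levels is `b` itself.
    let Φ (b W : V) (A : El N) : Prop := ∀ a : V, a.1 ∈ b.1 → IsLevel N a.1 →
      ∃ n : V, n.1 ∈ W.1 ∧ IsLevel N n.1 ∧ pair n.1 (pair a.1 a.1) ∈ A.1
    have h1 : Φ ⟨b, hb⟩ ⟨_, hW⟩ k.iterN ↔ Φ (k.sub ⟨b, hb⟩) (k.sub ⟨_, hW⟩) (k.extN k.iterN) :=
      lift.iff (k := k) (by unfold Φ; infer_instance)
    obtain ⟨n, hn, hln, h⟩ := h1.1 (fun a ha hla => by
      obtain ⟨n, hn⟩ := ih a.1 ha a.2 hla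
      exact ⟨⟨_, level_nat_mem n⟩, level_mem_level (Ordinal.natCast_lt_omega0 n)
        (LimitLevel.mem_N N (level_nat_mem (V := V) n)), ⟨_, rfl⟩, k.mem_iter.2 ⟨n, rfl, a.2, hn.symm⟩⟩)
      ⟨b, hb⟩ (k.mem_map_of_level hb hl (hne 0)) hl
    rw [show (k.sub ⟨_, hW⟩).1 = level N Ordinal.omega0 from k.map_level_omega hW] at hn
    obtain ⟨m, hm⟩ := eq_level_nat_of_mem hn hln
    rw [hm] at h
    exact hne (m + 1) ((k.mem_ext_iter ⟨b, hb⟩ ⟨b, hb⟩).1 h).symm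

end Emb

end

end RankEmbedding

namespace RankEmbedding

open ZFSet

set_option linter.unusedSectionVars false
set_option synthInstance.maxSize 5000
set_option synthInstance.maxHeartbeats 400000

variable {N : Set ZFSet.{u}} {V : ZFSet.{u}}

section

variable [hN : Fact (IsTransitiveZFModel N)] [hV : LimitLevel N V] [tV : TransCl fun x => x ∈ V]

/-! ## Isomorphisms for the inclusion order -/

/-- The relation `e` is an isomorphism between `X` and `Y`, ordered by inclusion. -/
def IsIso (X Y e : V) : Prop :=
  (∀ x : V, x.1 ∈ X.1 → ∃ y : V, y.1 ∈ Y.1 ∧ pair x.1 y.1 ∈ e.1) ∧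
  (∀ y : V, y.1 ∈ Y.1 → ∃ x : V, x.1 ∈ X.1 ∧ pair x.1 y.1 ∈ e.1) ∧
  ∀ x y : V, pair x.1 y.1 ∈ e.1 → (x.1 ∈ X.1 ∧ y.1 ∈ Y.1) ∧
    ∀ x' y' : V, pair x'.1 y'.1 ∈ e.1 → (x.1 ⊆ x'.1 ↔ y.1 ⊆ y'.1)

/-- The sets `X` and `Y` are isomorphic, for the inclusion order. -/
def Iso (X Y : V) : Prop := ∃ e, IsIso X Y e

instance lift.isIso {Γ : Type (u + 1)} [c : Cxt PUnit.{u + 2} V Γ] {k : Emb N V}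
    {s s' t t' r r' : Γ → V} [(lift k).T s s'] [(lift k).T t t'] [(lift k).T r r'] :
    (lift k).R (fun g => IsIso (s g) (t g) (r g)) (fun g => IsIso (s' g) (t' g) (r' g)) := by
  unfold IsIso
  infer_instance

/-- A definable relation between elements of `V` is a set. -/
theorem exists_rel (X Y : V) (P : ZFSet.{u} → ZFSet.{u} → Prop) (Q : El N → El N → Prop)
    (hPQ : ∀ x y : El N, P x.1 y.1 ↔ Q x y)
    [(definable (fun x => x ∈ N) 1).R
      (fun v : Fin 1 → El N => ∃ x y : El N, (v 0).1 = pair x.1 y.1 ∧ Q x y)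
      (fun v : Fin 1 → El N => ∃ x y : El N, (v 0).1 = pair x.1 y.1 ∧ Q x y)] :
    ∃ e : V, e.1 ⊆ prod X.1 Y.1 ∧
      ∀ x y : ZFSet.{u}, pair x y ∈ e.1 ↔ x ∈ X.1 ∧ y ∈ Y.1 ∧ P x y := by
  have hp := LimitLevel.prod N X.2 Y.2
  have h := sep_mem_of_definable (LimitLevel.mem_N N hp)
    (fun q => ∃ x y : El N, q = pair x.1 y.1 ∧ Q x y)
    (fun q => ∃ x y : El N, q.1 = pair x.1 y.1 ∧ Q x y) fun _ _ => Iff.rfl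
  have hs : ZFSet.sep (fun q => ∃ x y : El N, q = pair x.1 y.1 ∧ Q x y) (prod X.1 Y.1) ⊆
    prod X.1 Y.1 := sep_subset
  refine ⟨⟨_, LimitLevel.mem_of_subset N hp h hs⟩, hs, fun x y => ?_⟩
  rw [mem_sep, pair_mem_prod, and_assoc]
  refine and_congr_right fun hx => and_congr_right fun hy => ?_
  have hxN := LimitLevel.mem_N N (LimitLevel.trans N X.2 hx)
  have hyN := LimitLevel.mem_N N (LimitLevel.trans N Y.2 hy)
  constructor
  · rintro ⟨x', y', e, h⟩
    obtain ⟨rfl, rfl⟩ := pair_inj.1 e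
    exact (hPQ _ _).2 h
  · exact fun h => ⟨⟨x, hxN⟩, ⟨y, hyN⟩, rfl, (hPQ ⟨x, hxN⟩ ⟨y, hyN⟩).1 h⟩

namespace Iso

variable {X Y Z : V}

variable (N) in
include hN hV in
theorem exists_subset (h : Iso X Y) : ∃ e : V, e.1 ⊆ prod X.1 Y.1 ∧ IsIso X Y e := by
  obtain ⟨e, h1, h2, h3⟩ := h
  have he : e.1 ∈ N := LimitLevel.mem_N N e.2
  obtain ⟨e', h, h'⟩ := exists_rel (N := N) X Y (fun x y => pair x y ∈ e.1)
    (fun x y => pair x.1 y.1 ∈ (⟨e.1, he⟩ : El N).1) fun _ _ => Iff.rfl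
  refine ⟨e', h, fun x hx => ?_, fun y hy => ?_, fun x y hxy => ?_⟩
  · obtain ⟨y, hy, hxy⟩ := h1 x hx
    exact ⟨y, hy, (h' _ _).2 ⟨hx, hy, hxy⟩⟩
  · obtain ⟨x, hx, hxy⟩ := h2 y hy
    exact ⟨x, hx, (h' _ _).2 ⟨hx, hy, hxy⟩⟩
  · obtain ⟨hx, hy, hxy⟩ := (h' _ _).1 hxy
    exact ⟨⟨hx, hy⟩, fun x' y' hxy' => (h3 x y hxy).2 x' y' ((h' _ _).1 hxy').2.2⟩

variable (N) in
include hN hV in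
theorem symm (h : Iso X Y) : Iso Y X := by
  obtain ⟨e, h1, h2, h3⟩ := h
  have he : e.1 ∈ N := LimitLevel.mem_N N e.2
  obtain ⟨e', -, h'⟩ := exists_rel (N := N) Y X (fun y x => pair x y ∈ e.1)
    (fun y x => pair x.1 y.1 ∈ (⟨e.1, he⟩ : El N).1) fun _ _ => Iff.rfl
  refine ⟨e', fun y hy => ?_, fun x hx => ?_, fun y x hyx => ?_⟩
  · obtain ⟨x, hx, hxy⟩ := h2 y hy
    exact ⟨x, hx, (h' _ _).2 ⟨hy, hx, hxy⟩⟩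
  · obtain ⟨y, hy, hxy⟩ := h1 x hx
    exact ⟨y, hy, (h' _ _).2 ⟨hy, hx, hxy⟩⟩
  · obtain ⟨hy, hx, hxy⟩ := (h' _ _).1 hyx
    exact ⟨⟨hy, hx⟩, fun y' x' hyx' => ((h3 x y hxy).2 x' y' ((h' _ _).1 hyx').2.2).symm⟩

variable (N) in
include hN hV in
theorem trans (h : Iso X Y) (h' : Iso Y Z) : Iso X Z := by
  obtain ⟨e, h1, h2, h3⟩ := h
  obtain ⟨f, h4, h5, h6⟩ := h'
  have he : e.1 ∈ N := LimitLevel.mem_N N e.2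
  have hf : f.1 ∈ N := LimitLevel.mem_N N f.2
  obtain ⟨e', -, h'⟩ := exists_rel (N := N) X Z
    (fun x z => ∃ y : El N, pair x y.1 ∈ e.1 ∧ pair y.1 z ∈ f.1)
    (fun x z => ∃ y : El N, pair x.1 y.1 ∈ (⟨e.1, he⟩ : El N).1 ∧
      pair y.1 z.1 ∈ (⟨f.1, hf⟩ : El N).1) fun _ _ => Iff.rfl
  refine ⟨e', fun x hx => ?_, fun z hz => ?_, fun x z hxz => ?_⟩
  · obtain ⟨y, hy, hxy⟩ := h1 x hx
    obtain ⟨z, hz, hyz⟩ := h4 y hy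
    exact ⟨z, hz, (h' _ _).2 ⟨hx, hz, ⟨y.1, LimitLevel.mem_N N y.2⟩, hxy, hyz⟩⟩
  · obtain ⟨y, hy, hyz⟩ := h5 z hz
    obtain ⟨x, hx, hxy⟩ := h2 y hy
    exact ⟨x, hx, (h' _ _).2 ⟨hx, hz, ⟨y.1, LimitLevel.mem_N N y.2⟩, hxy, hyz⟩⟩
  · obtain ⟨hx, hz, y, hxy, hyz⟩ := (h' _ _).1 hxz
    refine ⟨⟨hx, hz⟩, fun x' z' hxz' => ?_⟩
    obtain ⟨hx', hz', y', hxy', hyz'⟩ := (h' _ _).1 hxz'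
    have hy : y.1 ∈ V := ((LimitLevel.pair_mem_iff N).1 (LimitLevel.trans N e.2 hxy)).2
    have hy' : y'.1 ∈ V := ((LimitLevel.pair_mem_iff N).1 (LimitLevel.trans N e.2 hxy')).2
    exact ((h3 x ⟨y.1, hy⟩ hxy).2 x' ⟨y'.1, hy'⟩ hxy').trans
      ((h6 ⟨y.1, hy⟩ z hyz).2 ⟨y'.1, hy'⟩ z' hyz')

theorem map (k : Emb N V) (h : Iso X Y) : Iso (k.sub X) (k.sub Y) := by
  obtain ⟨e, he⟩ := h
  exact ⟨k.sub e, (lift.iff (k := k) (P := IsIso X Y e)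
    (P' := IsIso (k.sub X) (k.sub Y) (k.sub e)) inferInstance).1 he⟩

end Iso

/-! ## Chains that are isomorphic to an initial segment of the levels -/

/-- The relation `h` is an isomorphism between `S`, ordered by inclusion, and the levels of height
less than `β`. -/
structure IsCollapse (N : Set ZFSet.{u}) (V S h : ZFSet.{u}) (β : Ordinal.{u}) : Prop where
  mem : h ∈ N
  mem_of_pair_mem {s v : ZFSet.{u}} : pair s v ∈ h → s ∈ S ∧ v ∈ V ∧ ∃ γ < β, v = level N γ
  total {s : ZFSet.{u}} : s ∈ S → ∃ v, pair s v ∈ h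
  surj {γ : Ordinal.{u}} : γ < β → ∃ s, pair s (level N γ) ∈ h
  subset_iff {s v t w : ZFSet.{u}} : pair s v ∈ h → pair t w ∈ h → (s ⊆ t ↔ v ⊆ w)

/-- The proper subsets of `s` in `S`. -/
noncomputable def below (S s : ZFSet.{u}) : ZFSet.{u} := ZFSet.sep (fun t => t ⊆ s ∧ ¬ t = s) S

theorem mem_below {S s t : ZFSet.{u}} : t ∈ below S s ↔ t ∈ S ∧ t ⊆ s ∧ ¬ t = s := mem_sep

theorem below_mem {S s : ZFSet.{u}} (hS : S ∈ N) (hs : s ∈ N) : below S s ∈ N :=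
  sep_mem_of_definable hS _ (fun t => t.1 ⊆ (⟨s, hs⟩ : El N).1 ∧ ¬ t.1 = (⟨s, hs⟩ : El N).1)
    fun _ _ => Iff.rfl

theorem level_mem_level_iff {γ γ' : Ordinal.{u}} (h : level N γ ∈ V) :
    level N γ ∈ level N γ' ↔ γ < γ' :=
  ⟨lt_of_level_mem_level, fun h' => level_mem_level h' (LimitLevel.mem_N N h)⟩

theorem level_subset_level_iff {γ γ' : Ordinal.{u}} (h' : level N γ' ∈ V) :
    level N γ ⊆ level N γ' ↔ γ ≤ γ' :=
  ⟨fun h2 => not_lt.1 fun h3 => mem_irrefl _ (h2 ((level_mem_level_iff (V := V) h').2 h3)),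
    level_mono⟩

theorem IsCollapse.below {S h s : ZFSet.{u}} {β γ : Ordinal.{u}} (hc : IsCollapse N V S h β)
    (hS : S ∈ N) (hs : pair s (level N γ) ∈ h) :
    ∃ h', IsCollapse N V (below S s) h' γ := by
  have hsN : s ∈ N := left_mem_of_pair_mem (p := fun x => x ∈ N) hc.mem hs
  have hb := below_mem hS hsN
  have hγV := (hc.mem_of_pair_mem hs).2.1
  have mem : ∀ t w, pair t w ∈ ZFSet.sep (fun p => ∃ t w : El N, p = pair t.1 w.1 ∧
      t.1 ∈ RankEmbedding.below S s) h ↔ pair t w ∈ h ∧ t ∈ RankEmbedding.below S s := by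
    intro t w
    rw [mem_sep]
    refine and_congr_right fun ht => ⟨?_, fun h' => ?_⟩
    · rintro ⟨t', w', e, h'⟩
      obtain ⟨rfl, rfl⟩ := pair_inj.1 e
      exact h'
    · exact ⟨⟨t, left_mem_of_pair_mem (p := fun x => x ∈ N) hc.mem ht⟩,
        ⟨w, right_mem_of_pair_mem (p := fun x => x ∈ N) hc.mem ht⟩, rfl, h'⟩
  refine ⟨_, sep_mem_of_definable hc.mem _ (fun p => ∃ t w : El N, p.1 = pair t.1 w.1 ∧
    t.1 ∈ (⟨_, hb⟩ : El N).1) fun _ _ => Iff.rfl, fun {t w} h => ?_, fun {t} ht => ?_,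
    fun {γ'} hγ => ?_, fun h h' => hc.subset_iff ((mem _ _).1 h).1 ((mem _ _).1 h').1⟩
  · obtain ⟨h1, h2⟩ := (mem _ _).1 h
    obtain ⟨h3, h4, γ', h5, rfl⟩ := hc.mem_of_pair_mem h1
    refine ⟨h2, h4, γ', ?_, rfl⟩
    obtain ⟨h6, h7, h8⟩ := mem_below.1 h2
    by_contra! h9
    exact h8 ((Logic.eq_iff_subset _ _).2 ⟨h7, (hc.subset_iff hs h1).2 (level_mono h9)⟩)
  · obtain ⟨w, hw⟩ := hc.total (mem_below.1 ht).1
    exact ⟨w, (mem _ _).2 ⟨hw, ht⟩⟩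
  · obtain ⟨t, ht⟩ := hc.surj (hγ.trans (by
      obtain ⟨-, -, γ'', h1, h2⟩ := hc.mem_of_pair_mem hs
      have : γ ≤ γ'' := (level_subset_level_iff (N := N) (h2 ▸ hγV)).1 h2.subset
      exact this.trans_lt h1))
    refine ⟨t, (mem _ _).2 ⟨ht, mem_below.2 ⟨(hc.mem_of_pair_mem ht).1,
      (hc.subset_iff ht hs).2 (level_mono hγ.le), ?_⟩⟩⟩
    rintro rfl
    have h1 := (hc.subset_iff hs ht).1 fun _ h => h
    exact absurd ((level_subset_level_iff (hc.mem_of_pair_mem ht).2.1).1 h1) (not_le.2 hγ)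

/-! ### Iterates that fix a well-ordered chain up to isomorphism -/

namespace Emb

theorem NonTriv.it {k : Emb N V} (hk : k.NonTriv) (n : ℕ) : (k.it n).NonTriv := by
  induction n with
  | zero => exact hk
  | succ n ih =>
    obtain ⟨x, hx, hne⟩ := ih
    refine ⟨_, (k.it n).map_mem hx, fun h => hne ?_⟩
    rw [Emb.it, app_map _ _ hx] at h
    exact ((k.it n).map_inj ((k.it n).map_mem hx) hx).1 h

/-- The proper initial segments of `S` are isomorphic to their images under some iterates. -/
def IterFixesSegments (S W b c : V) (A : El N) : Prop :=
  ∀ s : V, s.1 ∈ S.1 → ∃ n : V, n.1 ∈ W.1 ∧ IsLevel N n.1 ∧ ∃ T : V, T.1 ∈ b.1 ∧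
    (∀ t : V, t.1 ∈ T.1 → t.1 ∈ S.1 ∧ t.1 ⊆ s.1 ∧ ¬ t.1 = s.1) ∧
    (∀ t : V, t.1 ∈ S.1 → t.1 ⊆ s.1 → ¬ t.1 = s.1 → t.1 ∈ T.1) ∧
    ∃ T' : V, T'.1 ∈ b.1 ∧ pair n.1 (pair T.1 T'.1) ∈ A.1 ∧ ∃ e : V, e.1 ⊆ c.1 ∧ IsIso T' T e

/-- The set `S` is well-ordered by inclusion. -/
def IsWellOrderedChain (S : V) : Prop :=
  (∀ s : V, s.1 ∈ S.1 → ∀ t : V, t.1 ∈ S.1 → s.1 ⊆ t.1 ∨ t.1 ⊆ s.1) ∧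
  ∀ y : V, y.1 ⊆ S.1 → (∃ s : V, s.1 ∈ y.1 ∧ s = s) →
    ∃ s : V, s.1 ∈ y.1 ∧ ∀ t : V, t.1 ∈ y.1 → s.1 ⊆ t.1

/-- The bounded properties of the pairs in a collapse. -/
def IsCollapsePair (N : Set ZFSet.{u}) (S : V) (h : El N) (s v : V) : Prop :=
  pair s.1 v.1 ∈ h.1 → s.1 ∈ S.1 ∧ IsLevel N v.1 ∧
    (∀ t : V, t.1 ∈ S.1 → t.1 ⊆ s.1 → ∃ w : V, w.1 ⊆ v.1 ∧ pair t.1 w.1 ∈ h.1) ∧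
    ∀ w : V, w.1 ∈ v.1 → IsLevel N w.1 → ∃ t : V, t.1 ∈ S.1 ∧ pair t.1 w.1 ∈ h.1

end Emb

theorem IsCollapse.isWellOrderedChain {S : V} {h : El N} {β : Ordinal.{u}}
    (hc : IsCollapse N V S.1 h.1 β) : Emb.IsWellOrderedChain S := by
  refine ⟨fun s hs t ht => ?_, fun y hy hne => ?_⟩
  · obtain ⟨v, hv⟩ := hc.total hs
    obtain ⟨w, hw⟩ := hc.total ht
    obtain ⟨-, -, γ, -, rfl⟩ := hc.mem_of_pair_mem hv
    obtain ⟨-, -, γ', -, rfl⟩ := hc.mem_of_pair_mem hw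
    rw [hc.subset_iff hv hw, hc.subset_iff hw hv]
    exact (le_total γ γ').imp level_mono level_mono
  · obtain ⟨s, hs, -⟩ := hne
    obtain ⟨v, hv⟩ := hc.total (hy hs)
    obtain ⟨-, -, γ, -, rfl⟩ := hc.mem_of_pair_mem hv
    induction γ using WellFoundedLT.induction generalizing s with
    | _ γ ih =>
      by_contra! hne
      obtain ⟨t, ht, hst⟩ := hne s hs
      obtain ⟨w, hw⟩ := hc.total (hy ht)
      obtain ⟨-, -, γ', -, rfl⟩ := hc.mem_of_pair_mem hw
      have hlt : γ' < γ := by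
        by_contra! h'
        exact hst ((hc.subset_iff hv hw).2 (level_mono h'))
      obtain ⟨s', hs', h'⟩ := ih γ' hlt t ht hw
      obtain ⟨t', ht', h2⟩ := hne s' hs'
      exact h2 (h' t' ht')

theorem IsCollapse.isCollapsePair {S : V} {h : El N} {β : Ordinal.{u}}
    (hc : IsCollapse N V S.1 h.1 β) (s v : V) : Emb.IsCollapsePair N S h s v := by
  intro hsv
  obtain ⟨hs, hv, γ, hγ, e⟩ := hc.mem_of_pair_mem hsv
  refine ⟨hs, ⟨γ, e⟩, fun t ht hts => ?_, fun w hw hlw => ?_⟩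
  · obtain ⟨w, hw⟩ := hc.total ht
    exact ⟨⟨w, (hc.mem_of_pair_mem hw).2.1⟩, (hc.subset_iff hw hsv).1 hts, hw⟩
  · obtain ⟨γ', e'⟩ := hlw
    rw [e, e'] at hw
    obtain ⟨t, ht⟩ := hc.surj ((lt_of_level_mem_level hw).trans hγ)
    exact ⟨⟨t, LimitLevel.trans N S.2 (hc.mem_of_pair_mem ht).1⟩, (hc.mem_of_pair_mem ht).1,
      by rw [e']; exact ht⟩

namespace Emb

/-- The analogue of `exists_it_eq` for order types, which need not be represented by ordinals in
`V`. By induction on `β`, proper initial segments of `S` are fixed up to isomorphism by iterates;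
applying `k`, those of `k S` are fixed by iterates `k_{m+1}`. If `k S` is not isomorphic to `S`,
then `S` is isomorphic to a proper initial segment `T` of `k S`, and `k_{m+1} S ≅ k_{m+1} T ≅ T ≅
S`. The level `b`, fixed by all iterates, bounds the quantifiers. -/
theorem NonTriv.exists_iso_it {k : Emb N V} (hk : k.NonTriv) {b : V} (hl : IsLevel N b.1)
    (hb : ∀ n, k.it n b.1 = b.1) {S : V} {h : El N} {β : Ordinal.{u}} (hS : S.1 ∈ b.1)
    (hc : IsCollapse N V S.1 h.1 β) : ∃ n, Iso ((k.it n).sub S) S := by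
  induction β using WellFoundedLT.induction generalizing S h with
  | _ β ih =>
  by_contra! hne
  have hW := hk.level_omega_mem
  have hbb := LimitLevel.prod N b.2 b.2
  have hSN : S.1 ∈ N := LimitLevel.mem_N N S.2
  -- proper initial segments
  have h1 : IterFixesSegments S ⟨_, hW⟩ b ⟨_, hbb⟩ k.iterN := by
    intro s hs
    obtain ⟨v, hv⟩ := hc.total hs
    obtain ⟨-, hvV, γ, hγ, rfl⟩ := hc.mem_of_pair_mem hv
    obtain ⟨h', hc'⟩ := hc.below hSN hv
    have hbel : RankEmbedding.below S.1 s.1 ∈ b.1 :=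
      hl.mem_of_subset hS (below_mem hSN (LimitLevel.mem_N N s.2)) sep_subset
    have hbelV := LimitLevel.trans N b.2 hbel
    obtain ⟨n, hn⟩ := ih γ hγ (S := ⟨_, hbelV⟩) (h := ⟨h', hc'.mem⟩) hbel hc'
    have himg : ((k.it n).sub ⟨_, hbelV⟩).1 ∈ b.1 := by
      rw [← hb n]; exact ((k.it n).map_mem_map hbelV b.2).2 hbel
    obtain ⟨e, he, he'⟩ := hn.exists_subset N
    refine ⟨⟨_, level_nat_mem n⟩, level_mem_level (Ordinal.natCast_lt_omega0 n)
      (LimitLevel.mem_N N (level_nat_mem (V := V) n)), ⟨_, rfl⟩, ⟨_, hbelV⟩, hbel,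
      fun t ht => mem_below.1 ht, fun t h1 h2 h3 => mem_below.2 ⟨h1, h2, h3⟩, _, himg,
      k.mem_iter.2 ⟨n, rfl, hbelV, rfl⟩, e, fun p hp => ?_, he'⟩
    obtain ⟨x, hx, y, hy, rfl⟩ := mem_prod.1 (he hp)
    exact pair_mem_prod.2 ⟨hl.isTransitive _ himg hx, hl.isTransitive _ hbel hy⟩
  have h2 : IterFixesSegments (k.sub S) (k.sub ⟨_, hW⟩) (k.sub b) (k.sub ⟨_, hbb⟩)
      (k.extN k.iterN) :=
    (lift.iff (k := k) (by unfold IterFixesSegments; infer_instance)).1 h1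
  have h3 : IsWellOrderedChain (k.sub S) :=
    (lift.iff (k := k) (by unfold IsWellOrderedChain; infer_instance)).1 hc.isWellOrderedChain
  have h4 : ∀ s v : V, IsCollapsePair N (k.sub S) (k.extN h) s v := fun s v => by
    have : (lift k).R
        (fun h' : (PUnit.{u + 2} × V) × V => IsCollapsePair N S h h'.1.2 h'.2)
        (fun h' : (PUnit.{u + 2} × V) × V =>
          IsCollapsePair N (k.sub S) (k.extN h) h'.1.2 h'.2) := by
      unfold IsCollapsePair; infer_instance
    exact LiftRel.forall_of_forall this.out (fun g => hc.isCollapsePair g.1.2 g.2) ((⟨⟩, s), v)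
  have h5 : ∀ s v t w : V, pair s.1 v.1 ∈ k.ext h.1 → pair t.1 w.1 ∈ k.ext h.1 →
      (s.1 ⊆ t.1 ↔ v.1 ⊆ w.1) := fun s v t w => by
    let Φ (h : El N) (g : (((PUnit.{u + 2} × V) × V) × V) × V) : Prop :=
      pair g.1.1.1.2.1 g.1.1.2.1 ∈ h.1 → pair g.1.2.1 g.2.1 ∈ h.1 →
      (g.1.1.1.2.1 ⊆ g.1.2.1 ↔ g.1.1.2.1 ⊆ g.2.1)
    have : (lift k).R (Φ h) (Φ (k.extN h)) := by unfold Φ; infer_instance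
    exact LiftRel.forall_of_forall this.out (fun g => hc.subset_iff) ((((⟨⟩, s), v), t), w)
  have hHN : k.ext h.1 ∈ N := k.ext_mem h.2
  have h6 : ∀ γ < β, ∃ t, t ∈ k S.1 ∧ pair t (level N γ) ∈ k.ext h.1 := by
    intro γ hγ
    obtain ⟨s, hs⟩ := hc.surj hγ
    obtain ⟨hsS, hvV, -⟩ := hc.mem_of_pair_mem hs
    have hsV := LimitLevel.trans N S.2 hsS
    have hs' : pair (k s) (k (level N γ)) ∈ k.ext h.1 := by
      rw [← k.map_pair hsV hvV]
      exact (k.map_mem_ext h.2 (LimitLevel.pair N hsV hvV)).2 hs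
    obtain ⟨h7, h8, -, h9⟩ := h4 (k.sub ⟨s, hsV⟩) (k.sub ⟨_, hvV⟩) hs'
    -- If `k` moves the level of height `γ`, this level is an element of its image, and the moved
    -- collapse attains it because its values are closed downward.
    by_cases hm : k (level N γ) = level N γ
    · exact ⟨_, h7, hm ▸ hs'⟩
    · obtain ⟨t, ht, ht'⟩ := h9 ⟨_, hvV⟩ (k.mem_map_of_level hvV ⟨_, rfl⟩ hm) ⟨_, rfl⟩
      exact ⟨_, ht, ht'⟩
  -- the initial segment of the image that is isomorphic to `S`
  set T := ZFSet.sep (fun t => ∃ v s : El N, pair t v.1 ∈ k.ext h.1 ∧ pair s.1 v.1 ∈ h.1) (k S.1)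
    with hT
  have hTN : T ∈ N := sep_mem_of_definable (LimitLevel.mem_N N (k.map_mem S.2)) _
    (fun t => ∃ v s : El N, pair t.1 v.1 ∈ (⟨_, hHN⟩ : El N).1 ∧ pair s.1 v.1 ∈ h.1)
    fun _ _ => Iff.rfl
  have hkSb : k S.1 ∈ b.1 := by
    have := (k.map_mem_map S.2 b.2).2 hS
    rwa [show k b.1 = b.1 from hb 0] at this
  have hTb : T ∈ b.1 := hl.mem_of_subset hkSb hTN sep_subset
  have hTV := LimitLevel.trans N b.2 hTb
  have hTS : Iso ⟨T, hTV⟩ S := by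
    obtain ⟨e, -, he⟩ := exists_rel (N := N) ⟨T, hTV⟩ S
      (fun t s => ∃ v : El N, pair t v.1 ∈ k.ext h.1 ∧ pair s v.1 ∈ h.1)
      (fun t s => ∃ v : El N, pair t.1 v.1 ∈ (⟨_, hHN⟩ : El N).1 ∧ pair s.1 v.1 ∈ h.1)
      fun _ _ => Iff.rfl
    refine ⟨e, fun t ht => ?_, fun s hs => ?_, fun t s hts => ?_⟩
    · obtain ⟨-, v, s, h7, h8⟩ := mem_sep.1 (show t.1 ∈ T from ht)
      have hs := (hc.mem_of_pair_mem h8).1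
      exact ⟨⟨s.1, LimitLevel.trans N S.2 hs⟩, hs, (he _ _).2 ⟨ht, hs, v, h7, h8⟩⟩
    · obtain ⟨v, hv⟩ := hc.total hs
      obtain ⟨-, hvV, γ, hγ, rfl⟩ := hc.mem_of_pair_mem hv
      obtain ⟨t, htS, ht⟩ := h6 γ hγ
      have hvN := LimitLevel.mem_N N hvV
      have htT : t ∈ T := mem_sep.2 ⟨htS, ⟨_, hvN⟩, ⟨s.1, LimitLevel.mem_N N s.2⟩, ht, hv⟩
      exact ⟨⟨t, LimitLevel.trans N hTV htT⟩, htT, (he _ _).2 ⟨htT, hs, ⟨_, hvN⟩, ht, hv⟩⟩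
    · obtain ⟨ht, hs, v, h7, h8⟩ := (he _ _).1 hts
      refine ⟨⟨ht, hs⟩, fun t' s' hts' => ?_⟩
      obtain ⟨ht', hs', v', h7', h8'⟩ := (he _ _).1 hts'
      rw [hc.subset_iff h8 h8']
      exact h5 t ⟨v.1, (hc.mem_of_pair_mem h8).2.1⟩ t' ⟨v'.1, (hc.mem_of_pair_mem h8').2.1⟩ h7 h7'
  have hTdown : ∀ s ∈ T, ∀ t ∈ k S.1, t ⊆ s → t ∈ T := by
    intro s hs t ht hts
    obtain ⟨hsS, v, s', h7, h8⟩ := mem_sep.1 hs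
    obtain ⟨-, hvV, γ, hγ, hv⟩ := hc.mem_of_pair_mem h8
    have hsV := LimitLevel.trans N (k.map_mem S.2) hsS
    have htV := LimitLevel.trans N (k.map_mem S.2) ht
    obtain ⟨w, hwv, hw⟩ := (h4 ⟨s, hsV⟩ ⟨v.1, hvV⟩ h7).2.2.1 ⟨t, htV⟩ ht hts
    obtain ⟨-, ⟨γ', hw'⟩, -⟩ := h4 ⟨t, htV⟩ w hw
    have hγ' : γ' ≤ γ := by
      rw [hv, hw'] at hwv
      exact (level_subset_level_iff (N := N) (hv ▸ hvV)).1 hwv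
    obtain ⟨s'', hs''⟩ := hc.surj (hγ'.trans_lt hγ)
    rw [← hw'] at hs''
    exact mem_sep.2 ⟨ht, ⟨w.1, LimitLevel.mem_N N w.2⟩,
      ⟨s'', LimitLevel.mem_N N (LimitLevel.trans N S.2 (hc.mem_of_pair_mem hs'').1)⟩, hw, hs''⟩
  -- If `T` were all of `k S`, the index `0` would contradict the assumption.
  have hTne : T ≠ k S.1 := fun e => hne 0 (by
    have : (⟨T, hTV⟩ : V) = (k.it 0).sub S := Subtype.ext e
    exact this ▸ hTS)
  have hy : k S.1 \ T ∈ V := LimitLevel.sdiff N (k.map_mem S.2) hTN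
  -- With `z` the least element outside `T`, the set `T` becomes the segment of `k S` strictly below
  -- `z`, as required to use `h2`.
  obtain ⟨z, hz, hzmin⟩ := h3.2 ⟨_, hy⟩ (fun x hx => (mem_sdiff.1 hx).1) (by
    by_contra! h'
    refine hTne ((Logic.eq_iff_subset _ _).2 ⟨sep_subset, fun x hx => ?_⟩)
    by_contra hxT
    exact h' ⟨x, LimitLevel.trans N (k.map_mem S.2) hx⟩ (mem_sdiff.2 ⟨hx, hxT⟩) rfl)
  obtain ⟨hzS, hzT⟩ := mem_sdiff.1 hz
  have hTz : ∀ t : V, t.1 ∈ T ↔ t.1 ∈ k S.1 ∧ t.1 ⊆ z.1 ∧ ¬ t.1 = z.1 := by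
    intro t
    constructor
    · intro ht
      have htS := (mem_sep.1 ht).1
      refine ⟨htS, (h3.1 t htS z hzS).resolve_right fun h' => hzT (hTdown _ ht _ hzS h'), ?_⟩
      intro e
      exact hzT (e ▸ ht)
    · rintro ⟨htS, h7, h8⟩
      by_contra htT
      exact h8 ((Logic.eq_iff_subset _ _).2 ⟨h7, hzmin t (mem_sdiff.2 ⟨htS, htT⟩)⟩)
  obtain ⟨n, hn, hln, T', hT'b, h7, h8, T'', -, h9, e, -, he⟩ := h2 z hzS
  rw [show (k.sub ⟨_, hW⟩).1 = level N Ordinal.omega0 from k.map_level_omega hW] at hn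
  obtain ⟨m, hm⟩ := eq_level_nat_of_mem hn hln
  rw [hm] at h9
  have e1 : T' = ⟨T, hTV⟩ := by
    refine Subtype.ext (ZFSet.ext fun t => ⟨fun ht => ?_, fun ht => ?_⟩)
    · have := h7 ⟨t, LimitLevel.trans N T'.2 ht⟩ ht
      exact (hTz ⟨t, LimitLevel.trans N T'.2 ht⟩).2 this
    · obtain ⟨h10, h11, h12⟩ := (hTz ⟨t, LimitLevel.trans N hTV ht⟩).1 ht
      exact h8 ⟨t, LimitLevel.trans N hTV ht⟩ h10 h11 h12
  have e2 : T'' = (k.it (m + 1)).sub ⟨T, hTV⟩ :=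
    Subtype.ext (by rw [(k.mem_ext_iter T' T'').1 h9, e1]; rfl)
  have h10 : Iso ((k.it (m + 1)).sub ⟨T, hTV⟩) ⟨T, hTV⟩ := by
    rw [← e2, ← e1]; exact ⟨e, he⟩
  exact hne (m + 1) (((hTS.map (k.it (m + 1))).symm N).trans N (h10.trans N hTS))

end Emb

end

end RankEmbedding

namespace RankEmbedding

open ZFSet

set_option linter.unusedSectionVars false
set_option synthInstance.maxSize 5000
set_option synthInstance.maxHeartbeats 400000

variable {N : Set ZFSet.{u}} {V : ZFSet.{u}}

section

variable [hN : Fact (IsTransitiveZFModel N)] [hV : LimitLevel N V] [tV : TransCl fun x => x ∈ V]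

/-! ## A condition for exactness -/

/-- The embedding is cofinal in a chain whose image is isomorphic to it. -/
theorem Emb.exists_subset_map_of_iso (k : Emb N V) {S : V} {h : El N} {β : Ordinal.{u}}
    (hc : IsCollapse N V S.1 h.1 β) (hi : Iso (k.sub S) S) {t : V} (ht : t.1 ∈ k S.1) :
    ∃ s : V, s.1 ∈ S.1 ∧ t.1 ⊆ k s.1 := by
  have hw : IsWellOrderedChain (k.sub S) :=
    (lift.iff (k := k) (by unfold IsWellOrderedChain; infer_instance)).1 hc.isWellOrderedChain
  obtain ⟨e, h1, h2, h3⟩ := hi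
  have hkS : ∀ s : V, s.1 ∈ S.1 → k s.1 ∈ k S.1 := fun s hs => (k.map_mem_map s.2 S.2).2 hs
  by_contra! hne
  -- The map `s ↦ e(k(s))` preserves the order of the well-ordered set `S`, so it moves no element
  -- down.
  have key : ∀ γ : Ordinal.{u}, ∀ s : V, pair s.1 (level N γ) ∈ h.1 → ∀ s' : V,
      pair (k s.1) s'.1 ∈ e.1 → s.1 ⊆ s'.1 := by
    intro γ
    induction γ using WellFoundedLT.induction with
    | _ γ ih =>
      intro s hs s' hss'
      have hsS := (hc.mem_of_pair_mem hs).1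
      have hs'S := (h3 (k.sub s) s' hss').1.2
      by_contra hns
      obtain ⟨v, hv⟩ := hc.total hs'S
      obtain ⟨-, hvV, γ', -, rfl⟩ := hc.mem_of_pair_mem hv
      have hlt : γ' < γ := by
        by_contra! h'
        exact hns ((hc.subset_iff hs hv).2 (level_mono h'))
      obtain ⟨s'', hs''S, hs''⟩ := h1 (k.sub s') (hkS s' hs'S)
      have h4 := ih γ' hlt s' hv s'' hs''
      have h5 := ((h3 (k.sub s) s' hss').2 (k.sub s') s'' hs'').2 h4
      refine hns fun x hx => ?_
      have hxV := LimitLevel.trans N s.2 hx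
      exact (k.map_mem_map hxV s'.2).1 (h5 ((k.map_mem_map hxV s.2).2 hx))
  obtain ⟨t₀, ht₀S, ht₀⟩ := h1 t ht
  obtain ⟨v, hv⟩ := hc.total ht₀S
  obtain ⟨-, -, γ, -, rfl⟩ := hc.mem_of_pair_mem hv
  obtain ⟨s, -, hs⟩ := h1 (k.sub t₀) (hkS t₀ ht₀S)
  -- For `t₀ = e(t)` this gives `e(t) ⊆ e(k(t₀))`, and so `t ⊆ k(t₀)`.
  exact hne t₀ ht₀S (((h3 t t₀ ht₀).2 (k.sub t₀) s hs).2 (key γ t₀ hv s hs))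

/-- The chain `S` measures the failure of a uniform bound for the relation `C`. -/
structure IsUnboundedChain (V C S : ZFSet.{u}) : Prop where
  bounded {s : ZFSet.{u}} : s ∈ S → ∃ d ∈ V, ∀ t ∈ s, ∃ x ∈ d, pair t x ∈ C
  unbounded {v : ZFSet.{u}} : v ∈ V → ∃ s ∈ S, ∃ t ∈ s, ∀ x ∈ v, pair t x ∉ C

/-- A set `z ⊆ dom C'` is the union of an increasing family of pieces indexed by `S`, such that the
`C'`-witnesses for each piece have a bound in `V`. As `k` is cofinal in `k S`, each element of `k z`
lies in the image of one such piece, where the bounded case applies. -/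
theorem Emb.exact_of_iso (k : Emb N V) {S : V} {h : El N} {β : Ordinal.{u}}
    (hc : IsCollapse N V S.1 h.1 β) {C : ZFSet.{u}} (hC : C ∈ N) (hS : IsUnboundedChain V C S.1)
    (hi : Iso (k.sub S) S) : Exact k := by
  refine ⟨fun C' hC' hC'V => ?_⟩
  ext t
  refine ⟨fun ht => ?_, fun ht => k.dom_ext_subset ht⟩
  obtain ⟨htV, z, hz, hzC, ht⟩ := mem_ext.1 ht
  -- `Q` relates `s` to `t` if some level is too small to contain `C`-witnesses for all of `s`, but
  -- contains a `C'`-witness for `t`. So a level that suffices for `s` contains `C'`-witnesses for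
  -- all such `t`.
  obtain ⟨Q, -, hQ⟩ := exists_rel (N := N) S ⟨z, hz⟩
    (fun s t => ∃ d : El N, d.1 ∈ levels N V ∧
      (∃ t₀ : El N, t₀.1 ∈ s ∧ ∀ x : El N, x.1 ∈ d.1 → ¬ pair t₀.1 x.1 ∈ C) ∧
      ∃ x : El N, x.1 ∈ d.1 ∧ pair t x.1 ∈ C')
    (fun s t => ∃ d : El N, d.1 ∈ (⟨levels N V, levels_mem⟩ : El N).1 ∧
      (∃ t₀ : El N, t₀.1 ∈ s.1 ∧ ∀ x : El N, x.1 ∈ d.1 → ¬ pair t₀.1 x.1 ∈ (⟨C, hC⟩ : El N).1) ∧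
      ∃ x : El N, x.1 ∈ d.1 ∧ pair t.1 x.1 ∈ (⟨C', hC'⟩ : El N).1)
    fun _ _ => Iff.rfl
  let Φ (S z Q : V) : Prop := (∀ t : V, t.1 ∈ z.1 → ∃ s : V, s.1 ∈ S.1 ∧ pair s.1 t.1 ∈ Q.1) ∧
    ∀ s t : V, pair s.1 t.1 ∈ Q.1 → ∀ s' : V, s'.1 ∈ S.1 → s.1 ⊆ s'.1 → pair s'.1 t.1 ∈ Q.1
  have h1 : Φ S ⟨z, hz⟩ Q := by
    constructor
    · intro t ht
      obtain ⟨x, hx⟩ := mem_dom.1 (hzC ht)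
      have hxV := ((LimitLevel.pair_mem_iff N).1 (hC'V hx)).2
      obtain ⟨d, hd, hl, hxd⟩ := LimitLevel.exists_level N hxV
      obtain ⟨s, hs, t₀, ht₀, h'⟩ := hS.unbounded hd
      have hsV := LimitLevel.trans N S.2 hs
      exact ⟨⟨s, hsV⟩, hs, (hQ _ _).2 ⟨hs, ht, ⟨d, LimitLevel.mem_N N hd⟩, mem_levels.2 ⟨hd, hl⟩,
        ⟨⟨t₀, LimitLevel.mem_N N (LimitLevel.trans N hsV ht₀)⟩, ht₀, fun x hx => h' x.1 hx⟩,
        ⟨x, LimitLevel.mem_N N hxV⟩, hxd, hx⟩⟩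
    · intro s t hst s' hs' hss'
      obtain ⟨-, ht, d, hd, ⟨t₀, ht₀, h2⟩, h3⟩ := (hQ _ _).1 hst
      exact (hQ _ _).2 ⟨hs', ht, d, hd, ⟨t₀, hss' ht₀, h2⟩, h3⟩
  obtain ⟨h2, h3⟩ : Φ (k.sub S) (k.sub ⟨z, hz⟩) (k.sub Q) :=
    (lift.iff (k := k) (by unfold Φ; infer_instance)).1 h1
  obtain ⟨s, hs, hst⟩ := h2 ⟨t, htV⟩ ht
  obtain ⟨s', hs', hss'⟩ := k.exists_subset_map_of_iso hc hi hs
  have h4 := h3 s ⟨t, htV⟩ hst (k.sub s') ((k.map_mem_map s'.2 S.2).2 hs') hss'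
  have hQN := LimitLevel.mem_N N Q.2
  have hz' : ZFSet.sep (fun t => pair s'.1 t ∈ Q.1) z ∈ N :=
    sep_mem_of_definable (LimitLevel.mem_N N hz) _
      (fun t => pair (⟨s'.1, LimitLevel.mem_N N s'.2⟩ : El N).1 t.1 ∈ (⟨Q.1, hQN⟩ : El N).1)
      fun _ _ => Iff.rfl
  have hz'V := LimitLevel.mem_of_subset N hz hz' sep_subset
  let Ψ (z z' s Q : V) : Prop := ∀ t : V, t.1 ∈ z.1 → pair s.1 t.1 ∈ Q.1 → t.1 ∈ z'.1
  have h5 : Ψ ⟨z, hz⟩ ⟨_, hz'V⟩ s' Q := fun t ht h =>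
    (mem_sep (p := fun t => pair s'.1 t ∈ Q.1)).2 ⟨ht, h⟩
  have h6 : Ψ (k.sub ⟨z, hz⟩) (k.sub ⟨_, hz'V⟩) (k.sub s') (k.sub Q) :=
    (lift.iff (k := k) (by unfold Ψ; infer_instance)).1 h5
  obtain ⟨d, hd, hdb⟩ := hS.bounded hs'
  obtain ⟨w, hw, hl, hdw⟩ := LimitLevel.exists_level_subset N hd
  refine k.mem_dom_ext_of_bounded hC' hz'V hw (fun t' ht' => ?_) (h6 ⟨t, htV⟩ ht h4)
  obtain ⟨-, -, v, hv, ⟨t₀, ht₀, h7⟩, x, hx, h8⟩ := (hQ _ _).1 (mem_sep.1 ht').2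
  obtain ⟨x₀, hx₀, h9⟩ := hdb t₀.1 ht₀
  refine ⟨x.1, ?_, h8⟩
  rcases (mem_levels.1 hv).2.total hl with h' | h'
  · exact h' hx
  · exact absurd h9 (h7 ⟨x₀, LimitLevel.mem_N N (LimitLevel.trans N hd hx₀)⟩ (h' (hdw hx₀)))

/-! ## The existence of a suitable chain -/

theorem rk_mono {X x y : ZFSet.{u}} (h : x ⊆ y) : rk X x ≤ rk X y :=
  le_of_forall_lt fun _ hγ =>
    let ⟨z, hz, h'⟩ := lt_rk.1 hγ
    lt_rk.2 ⟨z, h hz, h'⟩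

/-- The relative ranks leave no gaps, which makes the collapse surjective. -/
theorem exists_rk_eq {X x : ZFSet.{u}} {γ : Ordinal.{u}} (h : γ < rk X x) :
    ∃ y ∈ X, rk X y = γ := by
  induction x using ZFSet.inductionOn with
  | _ x ih =>
    obtain ⟨y, hy, hyX, h'⟩ := lt_rk.1 h
    rcases h'.eq_or_lt with h' | h'
    · exact ⟨y, hyX, h'.symm⟩
    · exact ih y hy h'

/-- The elements of `y` that have a witness in `d` for the relation `C`. -/
noncomputable def witnessed (C y d : ZFSet.{u}) : ZFSet.{u} :=
  ZFSet.sep (fun t => ∃ x ∈ d, pair t x ∈ C) y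

theorem mem_witnessed {C y d t : ZFSet.{u}} :
    t ∈ witnessed C y d ↔ t ∈ y ∧ ∃ x ∈ d, pair t x ∈ C := mem_sep

/-- The level `d` is the least one that contains a witness for some element of `y`. -/
def IsLeastWitness (N : Set ZFSet.{u}) (C y d : ZFSet.{u}) : Prop :=
  ∃ t ∈ y, (∃ x ∈ d, pair t x ∈ C) ∧ ∀ d' ∈ d, IsLevel N d' → ∀ x ∈ d', pair t x ∉ C

theorem exists_isLeastWitness {C y t x : ZFSet.{u}} (ht : t ∈ y) (hx : x ∈ V)
    (h : pair t x ∈ C) : ∃ d ∈ V, IsLevel N d ∧ IsLeastWitness N C y d ∧ t ∈ witnessed C y d := by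
  obtain ⟨d, hd, ⟨γ, rfl⟩, hxd⟩ := LimitLevel.exists_level N hx
  induction γ using WellFoundedLT.induction generalizing x with
  | _ γ ih =>
    by_cases h' : ∀ d' ∈ level N γ, IsLevel N d' → ∀ x ∈ d', pair t x ∉ C
    · exact ⟨_, hd, ⟨_, rfl⟩, ⟨t, ht, ⟨x, hxd, h⟩, h'⟩, mem_witnessed.2 ⟨ht, x, hxd, h⟩⟩
    · push Not at h'
      obtain ⟨d', hd', ⟨γ', rfl⟩, x', hx', h2⟩ := h'
      have hV' := LimitLevel.trans N hd hd'
      exact ih γ' (lt_of_level_mem_level hd') (LimitLevel.trans N hV' hx') h2 hV' hx'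

/-- By leastness, `d` has a witness for some `t` that no smaller level has, so the chain of the
witnessed parts is ordered like the levels themselves. -/
theorem witnessed_subset_iff {C y d d' : ZFSet.{u}} (hd : d ∈ V) (hl : IsLevel N d) (hd' : d' ∈ V)
    (hl' : IsLevel N d') (h : IsLeastWitness N C y d) :
    witnessed C y d ⊆ witnessed C y d' ↔ d ⊆ d' := by
  constructor
  · intro hs
    rcases hl.mem_or_eq_or_mem hl' (LimitLevel.mem_N N hd) (LimitLevel.mem_N N hd') with h' | h' | h'
    · exact hl'.isTransitive _ h'
    · exact h'.subset
    · obtain ⟨t, ht, hx, hmin⟩ := h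
      obtain ⟨-, x, hx, hx'⟩ := mem_witnessed.1 (hs (mem_witnessed.2 ⟨ht, hx⟩))
      exact absurd hx' (hmin d' h' hl' x hx)
  · intro hs t ht
    obtain ⟨hty, x, hx, h'⟩ := mem_witnessed.1 ht
    exact mem_witnessed.2 ⟨hty, x, hs hx, h'⟩

/-- The least witnessing levels `d` form a set `D` that is unbounded in `V`. Passing from `d` to the
part of `y` witnessed in `d` keeps the order but yields subsets of `y`, so the resulting chain is an
element of `V`. It is collapsed by sending the part for `d` to the level of height `rk D d`. -/
theorem exists_isUnboundedChain {C y : ZFSet.{u}} (hC : C ∈ N) (hCV : C ⊆ V) (hy : y ∈ V)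
    (hyC : ∀ w ∈ V, ∃ t ∈ y, t ∈ dom C ∧ ∀ x ∈ w, pair t x ∉ C) :
    ∃ (S : V) (h : El N) (β : Ordinal.{u}), IsCollapse N V S.1 h.1 β ∧
      IsUnboundedChain V C S.1 := by
  have hyN := LimitLevel.mem_N N hy
  set D := ZFSet.sep (IsLeastWitness N C y) (levels N V) with hD
  have hDN : D ∈ N := sep_mem_of_definable levels_mem _ (fun d => ∃ t : El N,
    t.1 ∈ (⟨y, hyN⟩ : El N).1 ∧ (∃ x : El N, x.1 ∈ d.1 ∧ pair t.1 x.1 ∈ (⟨C, hC⟩ : El N).1) ∧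
    ∀ d' : El N, d'.1 ∈ d.1 → d'.1 ∈ (⟨levels N V, levels_mem⟩ : El N).1 →
      ∀ x : El N, x.1 ∈ d'.1 → ¬ pair t.1 x.1 ∈ (⟨C, hC⟩ : El N).1) fun d hd => by
    have hdV := (mem_levels.1 hd).1
    constructor
    · rintro ⟨t, ht, ⟨x, hx, hx'⟩, h⟩
      exact ⟨⟨t, mem_of_mem hyN ht⟩, ht, ⟨⟨x, mem_of_mem d.2 hx⟩, hx, hx'⟩,
        fun d' hd' hl x hx => h d'.1 hd' (mem_levels.1 hl).2 x.1 hx⟩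
    · rintro ⟨t, ht, ⟨x, hx, hx'⟩, h⟩
      refine ⟨t.1, ht, ⟨x.1, hx, hx'⟩, fun d' hd' hl x hx => ?_⟩
      have hd'N := mem_of_mem d.2 hd'
      exact h ⟨d', hd'N⟩ hd' (mem_levels.2 ⟨LimitLevel.trans N hdV hd', hl⟩)
        ⟨x, mem_of_mem hd'N hx⟩ hx
  have memD : ∀ {d}, d ∈ D ↔ (d ∈ V ∧ IsLevel N d) ∧ IsLeastWitness N C y d := fun {d} => by
    rw [hD, mem_sep, mem_levels]
  have hDV : D ⊆ V := fun d hd => (memD.1 hd).1.1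
  have hg := LimitLevel.lrankGraph_mem N hDN hDV
  set S := ZFSet.sep (fun s => ∃ d ∈ D, s = witnessed C y d) (pw N y) with hS
  have eq_iff : ∀ s d : El N, s.1 ⊆ y → (s.1 = witnessed C y d.1 ↔ ∀ t : El N, t.1 ∈ y →
      (t.1 ∈ s.1 ↔ ∃ x : El N, x.1 ∈ d.1 ∧ pair t.1 x.1 ∈ C)) := by
    intro s d hsy
    constructor
    · intro e t ht
      rw [e, mem_witnessed, and_iff_right ht]
      exact ⟨fun ⟨x, hx, h⟩ => ⟨⟨x, mem_of_mem d.2 hx⟩, hx, h⟩, fun ⟨x, hx, h⟩ => ⟨x.1, hx, h⟩⟩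
    · intro h
      ext t
      rw [mem_witnessed]
      constructor
      · intro ht
        obtain ⟨x, hx, h'⟩ := (h ⟨t, mem_of_mem s.2 ht⟩ (hsy ht)).1 ht
        exact ⟨hsy ht, x.1, hx, h'⟩
      · rintro ⟨ht, x, hx, h'⟩
        exact (h ⟨t, mem_of_mem hyN ht⟩ ht).2 ⟨⟨x, mem_of_mem d.2 hx⟩, hx, h'⟩
  have hSN : S ∈ N := sep_mem_of_definable (pw_mem hyN) _ (fun s => ∃ d : El N,
    d.1 ∈ (⟨D, hDN⟩ : El N).1 ∧ ∀ t : El N, t.1 ∈ (⟨y, hyN⟩ : El N).1 →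
      (t.1 ∈ s.1 ↔ ∃ x : El N, x.1 ∈ d.1 ∧ pair t.1 x.1 ∈ (⟨C, hC⟩ : El N).1)) fun s hs => by
    have hsy := (mem_pw.1 hs).1
    constructor
    · rintro ⟨d, hd, e⟩
      exact ⟨⟨d, mem_of_mem hDN hd⟩, hd, (eq_iff s ⟨d, mem_of_mem hDN hd⟩ hsy).1 e⟩
    · rintro ⟨d, hd, e⟩
      exact ⟨d.1, hd, (eq_iff s d hsy).2 e⟩
  have hSV : S ∈ V := LimitLevel.mem_of_subset N (LimitLevel.pw N hy) hSN sep_subset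
  have witN : ∀ d ∈ D, witnessed C y d ∈ N := fun d hd =>
    sep_mem_of_definable hyN _ (fun t => ∃ x : El N, x.1 ∈ (⟨d, mem_of_mem hDN hd⟩ : El N).1 ∧
      pair t.1 x.1 ∈ (⟨C, hC⟩ : El N).1) fun t _ =>
      ⟨fun ⟨x, hx, h⟩ => ⟨⟨x, mem_of_mem (mem_of_mem hDN hd) hx⟩, hx, h⟩,
        fun ⟨x, hx, h⟩ => ⟨x.1, hx, h⟩⟩
  have memS : ∀ {s}, s ∈ S ↔ ∃ d ∈ D, s = witnessed C y d := fun {s} => by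
    rw [hS, mem_sep, and_iff_right_iff_imp]
    rintro ⟨d, hd, rfl⟩
    exact mem_pw.2 ⟨sep_subset, witN d hd⟩
  set h := ZFSet.sep (fun p => ∃ s d v : El N, p = pair s.1 v.1 ∧ d.1 ∈ D ∧
    s.1 = witnessed C y d.1 ∧ v.1 = lrank N D d.1) (prod S V) with hh
  have hhN : h ∈ N := by
    refine sep_mem_of_definable (prod_mem hSN hV.mem) _ (fun p => ∃ s d v : El N,
      p.1 = pair s.1 v.1 ∧ (s.1 ⊆ (⟨y, hyN⟩ : El N).1 ∧ ∀ t : El N, t.1 ∈ (⟨y, hyN⟩ : El N).1 →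
        (t.1 ∈ s.1 ↔ ∃ x : El N, x.1 ∈ d.1 ∧ pair t.1 x.1 ∈ (⟨C, hC⟩ : El N).1)) ∧
      pair d.1 v.1 ∈ (⟨_, hg⟩ : El N).1) fun p _ => ?_
    refine exists_congr fun s => exists_congr fun d => exists_congr fun v =>
      and_congr_right fun _ => ?_
    constructor
    · rintro ⟨h1, h2, h3⟩
      have hsy : s.1 ⊆ y := h2 ▸ sep_subset
      exact ⟨⟨hsy, (eq_iff s d hsy).1 h2⟩, pair_mem_lrankGraph.2 ⟨h1, h3⟩⟩
    · rintro ⟨⟨h1, h2⟩, h3⟩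
      obtain ⟨h4, h5⟩ := pair_mem_lrankGraph.1 h3
      exact ⟨h4, (eq_iff s d h1).2 h2, h5⟩
  have memh : ∀ {s v}, pair s v ∈ h ↔ ∃ d ∈ D, s = witnessed C y d ∧ v = lrank N D d := by
    intro s v
    rw [hh, mem_sep, pair_mem_prod]
    constructor
    · rintro ⟨-, s', d, v', e, hd, h1, h2⟩
      obtain ⟨rfl, rfl⟩ := pair_inj.1 e
      exact ⟨d.1, hd, h1, h2⟩
    · rintro ⟨d, hd, rfl, rfl⟩
      exact ⟨⟨memS.2 ⟨d, hd, rfl⟩, LimitLevel.lrank_mem N hDN hDV hd⟩, ⟨_, witN d hd⟩,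
        ⟨d, mem_of_mem hDN hd⟩, ⟨_, LimitLevel.lrank_mem_N N hDN hDV hd⟩, rfl, hd, rfl, rfl⟩
  have rk_iff : ∀ d ∈ D, ∀ d' ∈ D, d ⊆ d' ↔ rk D d ≤ rk D d' := by
    intro d hd d' hd'
    refine ⟨rk_mono, fun h => ?_⟩
    obtain ⟨⟨h1, h2⟩, -⟩ := memD.1 hd
    obtain ⟨⟨h3, h4⟩, -⟩ := memD.1 hd'
    rcases h4.mem_or_eq_or_mem h2 (LimitLevel.mem_N N h3) (LimitLevel.mem_N N h1) with h' | h' | h'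
    · exact absurd h (not_le.2 (lt_rk.2 ⟨d', h', hd', le_rfl⟩))
    · exact h'.symm.subset
    · exact h4.isTransitive _ h'
  refine ⟨⟨S, hSV⟩, ⟨h, hhN⟩, rk D D, ⟨hhN, fun hsv => ?_, fun hs => ?_, fun hγ => ?_,
    fun hsv htw => ?_⟩, ⟨fun hs => ?_, fun {v} hv => ?_⟩⟩
  · obtain ⟨d, hd, rfl, rfl⟩ := memh.1 hsv
    exact ⟨memS.2 ⟨d, hd, rfl⟩, LimitLevel.lrank_mem N hDN hDV hd, _,
      lt_rk.2 ⟨d, hd, hd, le_rfl⟩, rfl⟩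
  · obtain ⟨d, hd, rfl⟩ := memS.1 hs
    exact ⟨_, memh.2 ⟨d, hd, rfl, rfl⟩⟩
  · obtain ⟨d, hd, rfl⟩ := exists_rk_eq hγ
    exact ⟨_, memh.2 ⟨d, hd, rfl, rfl⟩⟩
  · obtain ⟨d, hd, rfl, rfl⟩ := memh.1 hsv
    obtain ⟨d', hd', rfl, rfl⟩ := memh.1 htw
    obtain ⟨⟨h1, h2⟩, h3⟩ := memD.1 hd
    obtain ⟨⟨h4, h5⟩, -⟩ := memD.1 hd'
    rw [witnessed_subset_iff h1 h2 h4 h5 h3, rk_iff d hd d' hd', lrank, lrank,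
      level_subset_level_iff (V := V) (LimitLevel.lrank_mem N hDN hDV hd')]
  · obtain ⟨d, hd, rfl⟩ := memS.1 hs
    exact ⟨d, hDV hd, fun t ht => (mem_witnessed.1 ht).2⟩
  · obtain ⟨t, ht, htC, hx⟩ := hyC v hv
    obtain ⟨x, hx'⟩ := mem_dom.1 htC
    have hxV := ((LimitLevel.pair_mem_iff N).1 (hCV hx')).2
    obtain ⟨d, hd, hl, hlw, htd⟩ := exists_isLeastWitness (N := N) ht hxV hx'
    exact ⟨_, memS.2 ⟨d, memD.2 ⟨⟨hd, hl⟩, hlw⟩, rfl⟩, t, htd, hx⟩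

variable (N V) in
/-- There is a chain that controls exactness. -/
theorem exists_chain_exact : ∃ S : V, (∀ k : Emb N V, Iso (k.sub S) S → Exact k) ∧
    ∀ k : Emb N V, k.NonTriv → ∃ n, Iso ((k.it n).sub S) S := by
  -- If Collection holds over `V`, all embeddings are exact, and the empty chain will do.
  by_cases hb : ∀ C ∈ N, C ⊆ V → ∀ y ∈ V, ∃ w ∈ V, ∀ t ∈ y, t ∈ dom C → ∃ x ∈ w, pair t x ∈ C
  · have h0 : (∅ : ZFSet) ∈ V := Emb.empty_mem (N := N)
    refine ⟨⟨∅, h0⟩, fun k _ => ⟨fun C hC hCV => k.domExact_of_bounded hC (hb C hC hCV)⟩,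
      fun k _ => ⟨0, ⟨∅, h0⟩, fun x hx => ?_, fun y hy => absurd hy (notMem_empty _),
        fun x y h => absurd h (notMem_empty _)⟩⟩
    rw [show ((k.it 0).sub ⟨∅, h0⟩).1 = ∅ from k.map_empty] at hx
    exact absurd hx (notMem_empty _)
  · push Not at hb
    obtain ⟨C, hC, hCV, y, hy, hyC⟩ := hb
    obtain ⟨S, h, β, hc, hS⟩ := exists_isUnboundedChain hC hCV hy hyC
    refine ⟨S, fun k hi => k.exact_of_iso hc hC hS hi, fun k hk => ?_⟩
    -- An iterate `k_m` that fixes a level around `S` is taken first; its own iterates are later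
    -- iterates of `k` and fix this level too.
    obtain ⟨b, hb, hl, hSb⟩ := LimitLevel.exists_level N S.2
    obtain ⟨m, hm⟩ := hk.exists_it_eq hb hl
    obtain ⟨n, hn⟩ := (hk.it m).exists_iso_it (b := ⟨b, hb⟩) hl
      (fun n => by rw [Emb.it_add]; exact Emb.it_map_eq k (Nat.le_add_right m n) hb hm) hSb hc
    exact ⟨m + n, by rwa [Emb.it_add] at hn⟩

end

end RankEmbedding

namespace RankEmbedding

open ZFSet

set_option linter.unusedSectionVars false
set_option synthInstance.maxSize 5000
set_option synthInstance.maxHeartbeats 400000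

variable {N : Set ZFSet.{u}} {V : ZFSet.{u}}

section

variable [hN : Fact (IsTransitiveZFModel N)] [hV : LimitLevel N V] [tV : TransCl fun x => x ∈ V]

/-! ## Embeddings are not sections of their own canonical extensions -/

theorem isEmbRel_iff (G : V → V → Prop) : IsEmbRel N G ↔
    (∀ x, ∃ y, G x y) ∧ (∀ x y z, G x y → G x z → y = z) ∧
    (PreservesBin G fun x y => x \ y) ∧ (PreservesBin G fun x y => ZFSet.prod x y) ∧
    (PreservesUn G fun x => dom x) ∧ (PreservesUn G fun x => {x}) ∧
    (PreservesUn G fun x => memPart x) ∧ (PreservesUn G fun x => eqPart x) ∧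
    (PreservesBin G fun x y => insPart x y) ∧ (PreservesUn G fun x => pw N x) :=
  ⟨fun ⟨h1, h2, h3, h4, h5, h6, h7, h8, h9, h10⟩ => ⟨h1, h2, h3, h4, h5, h6, h7, h8, h9, h10⟩,
    fun ⟨h1, h2, h3, h4, h5, h6, h7, h8, h9, h10⟩ => ⟨h1, h2, h3, h4, h5, h6, h7, h8, h9, h10⟩⟩

/-- Totality of the section has an existential quantifier over all of `V`, hence the exactness. -/
instance lift.isEmbRel {Γ : Type (u + 1)} [c : Cxt PUnit.{u + 2} V Γ] {k : Emb N V} [Exact k]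
    {t t' : Γ → V} [(lift k).T t t'] (F : El N) :
    (lift k).R (fun g => IsEmbRel N fun x y : V => ZFSet.pair (t g).1 (ZFSet.pair x.1 y.1) ∈ F.1)
      (fun g => IsEmbRel N fun x y : V =>
        ZFSet.pair (t' g).1 (ZFSet.pair x.1 y.1) ∈ (k.extN F).1) := by
  refine Logic.R.congr ?_ (fun _ => isEmbRel_iff _) (fun _ => isEmbRel_iff _)
  unfold PreservesUn PreservesBin
  infer_instance

/-! ### The descent on the critical level -/

/-- Some section of `F` at an element of `b` is an embedding that moves a level in `v`, that maps
the chain `S` to an isomorphic one, and for which `F` is an image. -/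
def HasEmbSection (N : Set ZFSet.{u}) (F : El N) (S b v : V) : Prop :=
  ∃ x : V, x.1 ∈ b.1 ∧ (IsEmbRel N fun y z : V => pair x.1 (pair y.1 z.1) ∈ F.1) ∧
    (∃ S' : V, pair x.1 (pair S.1 S'.1) ∈ F.1 ∧ ∃ e : V, IsIso S' S e) ∧
    (∀ y y' : V, pair x.1 (pair y.1 y'.1) ∈ F.1 → ∃ w w' : V, pair x.1 (pair w.1 w'.1) ∈ F.1 ∧
      ∀ z : V, z.1 ∈ w'.1 ↔ z.1 ∈ y'.1 ∧ z.1 ∈ F.1) ∧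
    ∃ w : V, w.1 ∈ v.1 ∧ IsLevel N w.1 ∧ ∃ w' : V, pair x.1 (pair w.1 w'.1) ∈ F.1 ∧ ¬ w' = w

namespace Emb

/-- The section at `a` is `k` itself. It moves its critical level, which is an element of the image
of that level, and it maps `k S` to an isomorphic set by the image of `hi`. The clause on
intersections holds because `k(y) ∩ k^+(f) = k(f ∩ y)`. -/
theorem hasEmbSection {k : Emb N V} (hk : k.NonTriv) {S : V} (hi : Iso (k.sub S) S) {f : El N}
    {a b : V} (hab : a.1 ∈ k b.1)
    (h : ∀ x y : V, pair a.1 (pair x.1 y.1) ∈ k.ext f.1 ↔ pair x.1 y.1 ∈ k.gr) :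
    HasEmbSection N (k.extN f) (k.sub S) (k.sub b) (k.sub ⟨_, hk.moves_crit.1⟩) := by
  have h' : ∀ x y : V, pair a.1 (pair x.1 y.1) ∈ (k.extN f).1 ↔ y.1 = k x.1 := fun x y => by
    rw [show (k.extN f).1 = k.ext f.1 from rfl, h, pair_mem_gr, and_iff_right x.2]
  have hc := hk.moves_crit
  refine ⟨a, hab, ?_, ⟨_, (h' _ _).2 rfl, hi.map k⟩, fun y y' hy => ?_,
    ⟨_, hc.1⟩, k.mem_map_of_level hc.1 ⟨_, rfl⟩ hc.2, ⟨_, rfl⟩, k.sub _, (h' _ _).2 rfl,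
    fun e => hc.2 (congrArg Subtype.val e)⟩
  · convert k.isEmbRel using 3
    exact h _ _
  · have hw : f.1 ∩ y.1 ∈ V := inter_mem_V f.2 y.2
    refine ⟨⟨_, hw⟩, k.sub ⟨_, hw⟩, (h' _ _).2 rfl, fun z => ?_⟩
    rw [(h' _ _).1 hy]
    constructor
    · intro hz
      have hz' : z.1 ∈ k y.1 := k.map_subset hw y.2 (fun x hx => (mem_inter.1 hx).2) hz
      exact ⟨hz', (k.mem_ext_iff f.2 y.2 hz').2 hz⟩
    · rintro ⟨hz, hzF⟩
      exact (k.mem_ext_iff f.2 y.2 hz).1 hzF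

/-- Induction on the critical height. Pulling `hasEmbSection` back along the exact `k` gives an
embedding `i = f_x` with a smaller critical height and `i(S) ≅ S`, and a `g` with `f = i^+(g)`. Then
`i` is a section of `i^+(g)`. -/
theorem not_section_of_iso {S : V} (hS : ∀ k : Emb N V, Iso (k.sub S) S → Exact k)
    {k : Emb N V} (hk : k.NonTriv) (hi : Iso (k.sub S) S) {f : ZFSet.{u}} (hf : f ∈ N) {a : V} :
    ¬ ∀ x y : V, pair a.1 (pair x.1 y.1) ∈ k.ext f ↔ pair x.1 y.1 ∈ k.gr := by
  intro h
  have key : ∀ γ : Ordinal.{u}, ∀ k : Emb N V, k.NonTriv → k.crit = γ → Iso (k.sub S) S →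
      ∀ (f : El N) (a : V),
      ¬ ∀ x y : V, pair a.1 (pair x.1 y.1) ∈ k.ext f.1 ↔ pair x.1 y.1 ∈ k.gr := by
    intro γ
    induction γ using WellFoundedLT.induction with
    | _ γ ih =>
      intro k hk hγ hi f a h
      have := hS k hi
      obtain ⟨b, hb, -, -, hab⟩ := k.exists_mem_map a.2
      have h1 := hasEmbSection hk hi (b := ⟨b, hb⟩) hab h
      have hT : HasEmbSection N f S ⟨b, hb⟩ ⟨_, hk.moves_crit.1⟩ ↔ HasEmbSection N (k.extN f)
          (k.sub S) (k.sub ⟨b, hb⟩) (k.sub ⟨_, hk.moves_crit.1⟩) :=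
        lift.iff (k := k) (by unfold HasEmbSection; infer_instance)
      -- The backward direction of elementarity: what holds of `k.ext f` holds of `f`.
      obtain ⟨x, -, hx, ⟨S', hS', hi'⟩, himg, w, hw, ⟨ε, hε⟩, w', hw', hne⟩ := hT.2 h1
      have hG : ∃ i : Emb N V, ∀ y z : V, pair x.1 (pair y.1 z.1) ∈ f.1 ↔ z.1 = i y.1 := by
        obtain ⟨G, hGV, hG⟩ : ∃ G ∈ N, G ⊆ prod V V ∧
            ∀ y z : V, pair y.1 z.1 ∈ G ↔ pair x.1 (pair y.1 z.1) ∈ f.1 := by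
          have hxN := LimitLevel.mem_N N x.2
          refine ⟨ZFSet.sep (fun p => pair x.1 p ∈ f.1) (prod V V),
            sep_mem_of_definable (prod_mem hV.mem hV.mem) _
              (fun p => pair (⟨x.1, hxN⟩ : El N).1 p.1 ∈ f.1) fun _ _ => Iff.rfl,
            sep_subset, fun y z => ?_⟩
          rw [mem_sep, pair_mem_prod]
          exact and_iff_right ⟨y.2, z.2⟩
        have hGE : IsEmbRel N fun y z : V => pair y.1 z.1 ∈ G := by
          convert hx using 3
          exact hG.2 _ _
        obtain ⟨i, rfl⟩ := exists_emb_gr_eq hGV hG.1 hGE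
        exact ⟨i, fun y z => by rw [← hG.2, pair_mem_gr, and_iff_right y.2]⟩
      obtain ⟨i, hix⟩ := hG
      have hmov : i.Moves ε := by
        refine ⟨hε ▸ w.2, fun e => hne (Subtype.ext ?_)⟩
        rw [(hix _ _).1 hw', hε, e]
      have hcrit : i.crit < γ := by
        refine (i.crit_le hmov).trans_lt ?_
        rw [← hγ]
        exact lt_of_level_mem_level (N := N) (hε ▸ hw)
      have hiS : Iso (i.sub S) S := by
        have : S' = i.sub S := Subtype.ext ((hix _ _).1 hS')
        exact this ▸ hi'
      -- The preimage of `f` under `i`. By `himg` the sets `i(u) ∩ f` are values of `i`, necessarily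
      -- at `g ∩ u`; hence `f` and `i^+(g)` have the same elements in `V`.
      set g := ZFSet.sep (fun p => ∃ q : El N, pair p q.1 ∈ i.gr ∧ q.1 ∈ f.1) V with hg
      have hgN : g ∈ N := sep_mem_of_definable hV.mem _
        (fun p => ∃ q : El N, pair p.1 q.1 ∈ i.grN.1 ∧ q.1 ∈ f.1) fun _ _ => Iff.rfl
      have memg : ∀ p ∈ V, p ∈ g ↔ i p ∈ f.1 := by
        intro p hp
        rw [hg, mem_sep, and_iff_right hp]
        constructor
        · rintro ⟨q, hq, hqf⟩
          rwa [← (pair_mem_gr.1 hq).2]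
        · exact fun h => ⟨⟨i p, mem_of_mem f.2 h⟩, pair_mem_gr.2 ⟨hp, rfl⟩, h⟩
      have hext : ∀ z ∈ V, z ∈ i.ext g ↔ z ∈ f.1 := by
        intro z hz
        obtain ⟨u, hu, -, -, hzu⟩ := i.exists_mem_map hz
        obtain ⟨w, w', hw, hw'⟩ := himg ⟨u, hu⟩ (i.sub ⟨u, hu⟩) ((hix _ _).2 rfl)
        have e := (hix _ _).1 hw
        have hwu : w.1 = g ∩ u := by
          ext p
          rw [mem_inter]
          have hpw : ∀ hp : p ∈ V, p ∈ w.1 ↔ p ∈ u ∧ i p ∈ f.1 := fun hp => by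
            rw [← i.map_mem_map hp w.2, ← e, ← i.map_mem_map hp hu]
            exact hw' (i.sub ⟨p, hp⟩)
          constructor
          · intro hp
            have hpV := LimitLevel.trans N w.2 hp
            obtain ⟨h2, h3⟩ := (hpw hpV).1 hp
            exact ⟨(memg p hpV).2 h3, h2⟩
          · rintro ⟨h2, h3⟩
            have hpV := LimitLevel.trans N hu h3
            exact (hpw hpV).2 ⟨h3, (memg p hpV).1 h2⟩
        rw [i.mem_ext_iff hgN hu hzu, ← hwu, ← e, hw' ⟨z, hz⟩]
        exact and_iff_right hzu
      refine ih _ hcrit i ⟨_, hmov⟩ rfl hiS ⟨g, hgN⟩ x fun y z => ?_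
      rw [hext _ (LimitLevel.pair N x.2 (LimitLevel.pair N y.2 z.2)), hix, pair_mem_gr,
        and_iff_right y.2]
  exact key _ k hk rfl hi ⟨f, hf⟩ a h

/-- If `k_n = k_n^+(f)_a`, applying `k_n` gives `k_{n+1} = k_{n+1}^+(k_n^+(f))_{k_n(a)}` by
`ext_ext`. So the property reaches an iterate that fixes the chain up to isomorphism. -/
theorem NonTriv.not_section {k : Emb N V} (hk : k.NonTriv) {f : ZFSet.{u}} (hf : f ∈ N) {a : V} :
    ¬ ∀ x y : V, pair a.1 (pair x.1 y.1) ∈ k.ext f ↔ pair x.1 y.1 ∈ k.gr := by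
  intro h
  obtain ⟨S, hS, hiso⟩ := exists_chain_exact N V
  obtain ⟨n, hn⟩ := hiso k hk
  have key : ∀ n, ∃ f ∈ N, ∃ a : V, ∀ x y : V,
      pair a.1 (pair x.1 y.1) ∈ (k.it n).ext f ↔ pair x.1 y.1 ∈ (k.it n).gr := by
    intro n
    induction n with
    | zero => exact ⟨f, hf, a, h⟩
    | succ n ih =>
      obtain ⟨f, hf, a, h⟩ := ih
      refine ⟨_, (k.it n).ext_mem hf, (k.it n).sub a, fun x y => ?_⟩
      rw [Emb.it, ← ext_ext _ _ hf, gr_app]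
      exact (k.it n).ext_section ((k.it n).ext_mem hf) a.2 (k.it n).gr_mem h x y
  obtain ⟨f, hf, a, h⟩ := key n
  exact not_section_of_iso hS (hk.it n) hn hf h

end Emb

end

end RankEmbedding

namespace RankEmbedding

open ZFSet

set_option linter.unusedSectionVars false
set_option synthInstance.maxSize 5000
set_option synthInstance.maxHeartbeats 400000

variable {N : Set ZFSet.{u}} {V : ZFSet.{u}}

section

variable [hN : Fact (IsTransitiveZFModel N)] [hV : LimitLevel N V] [tV : TransCl fun x => x ∈ V]

/-! ## Embeddings are not definable from parameters -/

section

open Language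

theorem lift.term {Γ : Type (u + 1)} [c : Cxt PUnit.{u + 2} V Γ] {k : Emb N V} {α : Type*}
    (t : LSet.Term α) (v : Γ → α → V) (hv : ∀ a, (lift k).T (fun g => v g a) (fun g => v g a)) :
    (lift k).T (fun g => t.realize (v g)) (fun g => t.realize (v g)) := by
  cases t with
  | var a => exact hv a
  | func f => exact Empty.elim f

/-- Exact embeddings are elementary for all formulas. -/
theorem lift.formula {k : Emb N V} [Exact k] {α : Type*} {m : ℕ} (φ : LSet.BoundedFormula α m)
    {Γ : Type (u + 1)} [c : Cxt PUnit.{u + 2} V Γ] (v : Γ → α → V) (xs : Γ → Fin m → V)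
    (hv : ∀ a, (lift k).T (fun g => v g a) (fun g => v g a))
    (hxs : ∀ a, (lift k).T (fun g => xs g a) (fun g => xs g a)) :
    (lift k).R (fun g => φ.Realize (v g) (xs g)) (fun g => φ.Realize (v g) (xs g)) := by
  have hterm : ∀ {m : ℕ} {Γ : Type (u + 1)} [c : Cxt PUnit.{u + 2} V Γ] (v : Γ → α → V)
      (xs : Γ → Fin m → V) (_ : ∀ a, (lift k).T (fun g => v g a) (fun g => v g a))
      (_ : ∀ a, (lift k).T (fun g => xs g a) (fun g => xs g a)) (t : LSet.Term (α ⊕ Fin m)),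
      (lift k).T (fun g => t.realize (Sum.elim (v g) (xs g)))
        (fun g => t.realize (Sum.elim (v g) (xs g))) := fun v xs hv hxs t =>
    lift.term t _ fun a => by
      cases a with
      | inl a => exact hv a
      | inr a => exact hxs a
  induction φ generalizing Γ with
  | falsum =>
    refine Logic.R.congr (P := fun _ => ∀ x : V, ¬ x = x) (P' := fun _ => ∀ x : V, ¬ x = x)
      inferInstance (fun g => ?_) (fun g => ?_) <;>
    exact ⟨False.elim, fun h => h ⟨∅, Emb.empty_mem (N := N)⟩ rfl⟩
  | equal t₁ t₂ =>
    have h1 := hterm v xs hv hxs t₁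
    have h2 := hterm v xs hv hxs t₂
    exact (inferInstance : (lift k).R
      (fun g => t₁.realize (Sum.elim (v g) (xs g)) = t₂.realize (Sum.elim (v g) (xs g)))
      (fun g => t₁.realize (Sum.elim (v g) (xs g)) = t₂.realize (Sum.elim (v g) (xs g))))
  | rel r ts =>
    cases r with
    | mem =>
      have h1 := hterm v xs hv hxs (ts 0)
      have h2 := hterm v xs hv hxs (ts 1)
      exact (inferInstance : (lift k).R
        (fun g => ((ts 0).realize (Sum.elim (v g) (xs g))).1 ∈
          ((ts 1).realize (Sum.elim (v g) (xs g))).1)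
        (fun g => ((ts 0).realize (Sum.elim (v g) (xs g))).1 ∈
          ((ts 1).realize (Sum.elim (v g) (xs g))).1))
  | imp φ ψ ih₁ ih₂ =>
    have h1 := ih₁ v xs hv hxs
    have h2 := ih₂ v xs hv hxs
    exact (inferInstance : (lift k).R
      (fun g => φ.Realize (v g) (xs g) → ψ.Realize (v g) (xs g))
      (fun g => φ.Realize (v g) (xs g) → ψ.Realize (v g) (xs g)))
  | all φ ih =>
    have h := ih (fun h : Γ × V => v h.1) (fun h : Γ × V => Fin.snoc (xs h.1) h.2)
      (fun a => ⟨(lift k).weak (hv a).out⟩) (fun a => by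
        induction a using Fin.lastCases with
        | last => simp only [Fin.snoc_last]; infer_instance
        | cast a => simp only [Fin.snoc_castSucc]; exact ⟨(lift k).weak (hxs a).out⟩)
    exact (inferInstance : (lift k).R
      (fun g => ∀ x : V, φ.Realize (v g) (Fin.snoc (xs g) x))
      (fun g => ∀ x : V, φ.Realize (v g) (Fin.snoc (xs g) x)))

end

/-- Provides variables for the parameters of a formula; their number is known only after the formula
is given. -/
theorem lift.exists_cxt (k : Emb N V) (m : ℕ) : ∃ (Γ : Type (u + 1))
    (_ : Cxt PUnit.{u + 2} V Γ) (e : Fin m → Γ → V), (∀ q, (lift k).T (e q) (e q)) ∧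
    ∀ p : Fin m → V, ∃ g, ∀ q, e q g = p q := by
  induction m with
  | zero => exact ⟨PUnit, inferInstance, Fin.elim0, fun q => q.elim0, fun _ => ⟨⟨⟩, fun q => q.elim0⟩⟩
  | succ m ih =>
    obtain ⟨Γ, c, e, he, hp⟩ := ih
    refine ⟨Γ × V, inferInstance, Fin.snoc (α := fun _ => Γ × V → V) (fun q h => e q h.1)
      (fun h => h.2), fun q => ?_, fun p => ?_⟩
    · induction q using Fin.lastCases with
      | last => simp only [Fin.snoc_last]; infer_instance
      | cast q => simp only [Fin.snoc_castSucc]; exact ⟨(lift k).weak (he q).out⟩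
    · obtain ⟨g, hg⟩ := hp (Fin.init p)
      refine ⟨(g, p (Fin.last m)), fun q => ?_⟩
      induction q using Fin.lastCases with
      | last => simp only [Fin.snoc_last]
      | cast q => simp only [Fin.snoc_castSucc, hg]; rfl

/-! ### Sections of invariant relations -/

/-- The embedding `l` is a section of a relation that is invariant under `k`. -/
def IsInvariantSection (k l : Emb N V) : Prop := ∃ A ∈ N, ∃ a : V,
  (∀ b x y : V, pair b.1 (pair x.1 y.1) ∈ k.ext A ↔ pair b.1 (pair x.1 y.1) ∈ A) ∧
  ∀ x y : V, pair a.1 (pair x.1 y.1) ∈ A ↔ y.1 = l x.1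

/-- If `P` corresponds to itself, its code `C` is fixed by `k.ext`. The relation `A` regroups the
triples `((b, x), y)` in `C` as `(b, (x, y))`, and the section is taken at the code `b` of `g`. -/
theorem isInvariantSection_of_liftRel {k l : Emb N V} {Γ : Type (u + 1)}
    [c : Cxt PUnit.{u + 2} V Γ] {P : (Γ × V) × V → Prop} (h : LiftRel k P P) (g : Γ)
    (hg : ∀ x y : V, P ((g, x), y) ↔ y.1 = l x.1) : IsInvariantSection k l := by
  obtain ⟨C, hC, hCt, h1, h2⟩ := h
  have hCC : k.ext C = C := by
    ext w
    constructor
    · intro hw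
      have hwt := k.ext_mono hCt hw
      rw [k.ext_tuples] at hwt
      obtain ⟨g, rfl⟩ := exists_tup hwt
      exact (h1 g).1 ((h2 g).2 hw)
    · intro hw
      obtain ⟨g, rfl⟩ := exists_tup (hCt hw)
      exact (h2 g).1 ((h1 g).2 hw)
  set A := ZFSet.sep (fun q => ∃ b x y : El N, q = pair b.1 (pair x.1 y.1) ∧
    pair (pair b.1 x.1) y.1 ∈ C) V with hA
  have hAN : A ∈ N := sep_mem_of_definable hV.mem _ (fun q => ∃ b x y : El N,
      (∃ p : El N, p.1 = pair x.1 y.1 ∧ q.1 = pair b.1 p.1) ∧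
      ∃ p : El N, p.1 = pair b.1 x.1 ∧ pair p.1 y.1 ∈ (⟨C, hC⟩ : El N).1) fun q _ => by
    refine exists_congr fun b => exists_congr fun x => exists_congr fun y => and_congr ?_ ?_
    · exact ⟨fun h => ⟨⟨_, pair_mem x.2 y.2⟩, rfl, h⟩, fun ⟨p, h, h'⟩ => h ▸ h'⟩
    · exact ⟨fun h => ⟨⟨_, pair_mem b.2 x.2⟩, rfl, h⟩, fun ⟨p, h, h'⟩ => h ▸ h'⟩
  have memA : ∀ b x y : V, pair b.1 (pair x.1 y.1) ∈ A ↔ pair (pair b.1 x.1) y.1 ∈ C := by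
    intro b x y
    rw [hA, mem_sep, and_iff_right (LimitLevel.pair N b.2 (LimitLevel.pair N x.2 y.2))]
    constructor
    · rintro ⟨b', x', y', e, h⟩
      obtain ⟨e1, e2⟩ := pair_inj.1 e
      obtain ⟨e2, e3⟩ := pair_inj.1 e2
      rwa [e1, e2, e3]
    · intro h
      exact ⟨⟨_, LimitLevel.mem_N N b.2⟩, ⟨_, LimitLevel.mem_N N x.2⟩,
        ⟨_, LimitLevel.mem_N N y.2⟩, rfl, h⟩
  refine ⟨A, hAN, ⟨tup V g, LiftRel.tup_mem_V N g⟩, fun b x y => ?_, fun x y => ?_⟩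
  · let Φ (A C : El N) (h : ((PUnit.{u + 2} × V) × V) × V) : Prop :=
      pair h.1.1.2.1 (pair h.1.2.1 h.2.1) ∈ A.1 ↔
        pair (lift.pairV N h.1.1.2 h.1.2).1 h.2.1 ∈ C.1
    have h3 : (lift k).R (Φ ⟨A, hAN⟩ ⟨C, hC⟩) (Φ (k.extN ⟨A, hAN⟩) (k.extN ⟨C, hC⟩)) := by
      unfold Φ; infer_instance
    have h4 := LiftRel.forall_of_forall h3.out (fun g => memA g.1.1.2 g.1.2 g.2)
      (((⟨⟩, b), x), y)
    rw [memA]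
    refine h4.trans ?_
    rw [show (k.extN ⟨C, hC⟩).1 = C from hCC]
    rfl
  · rw [memA ⟨tup V g, LiftRel.tup_mem_V N g⟩, ← hg, h1, tup_cons, tup_cons]

/-- The self-application of a section is uniformly definable over `(V, A)`. An exact `k` carries
this definition to `(V, k^+(A))`, which agrees with `(V, A)` on the relevant triples, so the
relation defined is invariant as well. -/
theorem IsInvariantSection.app {k l : Emb N V} [Exact k] (h : IsInvariantSection k l) :
    IsInvariantSection k (l.app l) := by
  obtain ⟨A, hA, a, h1, h2⟩ := h
  let P (A : El N) (h : ((PUnit.{u + 2} × V) × V) × V) : Prop := ∃ z z' : V,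
    (∀ p : V, p.1 ∈ z.1 → ∃ x y : V, p.1 = pair x.1 y.1 ∧
      pair h.1.1.2.1 (pair x.1 y.1) ∈ A.1) ∧
    pair h.1.1.2.1 (pair z.1 z'.1) ∈ A.1 ∧ pair h.1.2.1 h.2.1 ∈ z'.1
  have h3 : (lift k).R (P ⟨A, hA⟩) (P (k.extN ⟨A, hA⟩)) := by unfold P; infer_instance
  have h4 : P (k.extN ⟨A, hA⟩) = P ⟨A, hA⟩ := by
    funext h
    have : ∀ b x y : V, pair b.1 (pair x.1 y.1) ∈ (k.extN ⟨A, hA⟩).1 ↔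
      pair b.1 (pair x.1 y.1) ∈ A := h1
    simp only [P, this]
  rw [h4] at h3
  refine isInvariantSection_of_liftRel h3.out (⟨⟩, a) fun x y => ?_
  have h5 : y.1 = l.app l x.1 ↔ pair x.1 y.1 ∈ (l.app l).gr := by
    rw [Emb.pair_mem_gr, and_iff_right x.2]
  rw [h5, Emb.gr_app, Emb.mem_ext, and_iff_right (LimitLevel.pair N x.2 y.2)]
  constructor
  · rintro ⟨z, z', hz, hzz', hp⟩
    refine ⟨z.1, z.2, fun p hp => ?_, ?_⟩
    · obtain ⟨x, y, e, hxy⟩ := hz ⟨p, LimitLevel.trans N z.2 hp⟩ hp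
      rw [show p = pair x.1 y.1 from e, Emb.pair_mem_gr]
      exact ⟨x.2, (h2 _ _).1 hxy⟩
    · rwa [← (h2 _ _).1 hzz']
  · rintro ⟨z, hz, hzl, hp⟩
    refine ⟨⟨z, hz⟩, l.sub ⟨z, hz⟩, fun p hp => ?_, (h2 _ _).2 rfl, hp⟩
    obtain ⟨x, hx, y, hy, e⟩ := mem_prod.1 (l.gr_subset (hzl hp))
    refine ⟨⟨x, hx⟩, ⟨y, hy⟩, e, (h2 ⟨x, hx⟩ ⟨y, hy⟩).2 ?_⟩
    exact (Emb.pair_mem_gr.1 (e ▸ hzl hp)).2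

/-- The parameters become variables, so the relation is given by a formula without parameters and is
invariant even if `k` moves the parameters. They return as the place where the section is taken. -/
theorem isInvariantSection_of_isDefinable {k l : Emb N V} [Exact k]
    (h : IsDefinableFromParameters l.sub) : IsInvariantSection k l := by
  obtain ⟨F, -, h⟩ := Set.definable_iff_finitely_definable.1 h
  obtain ⟨φ, hφ⟩ := Set.definable_iff_exists_formula_sum.1 h
  obtain ⟨m, ⟨r⟩⟩ : ∃ m : ℕ, Nonempty ((F : Set V) ≃ Fin m) :=
    ⟨_, ⟨Finite.equivFin _⟩⟩
  obtain ⟨Γ, c, e, he, hp⟩ := lift.exists_cxt k m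
  obtain ⟨g, hg⟩ := hp fun q => (r.symm q).1
  let v (h : (Γ × V) × V) : (F : Set V) ⊕ Fin 2 → V :=
    Sum.elim (fun q => e (r q) h.1.1) ![h.1.2, h.2]
  have h1 := lift.formula (k := k) φ v (fun _ => default) (fun a => by
    rcases a with a | a
    · have := he (r a)
      exact (inferInstance : (lift k).T (fun h : (Γ × V) × V => e (r a) h.1.1)
        (fun h : (Γ × V) × V => e (r a) h.1.1))
    · fin_cases a
      · exact (inferInstance : (lift k).T (fun h : (Γ × V) × V => h.1.2)
          (fun h : (Γ × V) × V => h.1.2))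
      · exact (inferInstance : (lift k).T (fun h : (Γ × V) × V => h.2)
          (fun h : (Γ × V) × V => h.2))) (fun a => a.elim0)
  refine isInvariantSection_of_liftRel h1.out g fun x y => ?_
  have h2 : ![x, y] ∈ {w : Fin 2 → V | l.sub (w 0) = w 1} ↔ _ := iff_of_eq (congrArg (![x, y] ∈ ·) hφ)
  have h3 : v ((g, x), y) = Sum.elim (fun q => q.1) ![x, y] := by
    funext a
    rcases a with a | a
    · simp [v, hg]
    · rfl
  rw [h3]
  refine (h2.symm.trans ?_)
  exact (Subtype.ext_iff).trans eq_comm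

/-- Let `k_n` be exact. By induction on `m`, each `k_m` is a section of a relation `A` that `k_n^+`
leaves invariant. For `m = n` this makes `k_n` a section of `k_n^+(A)`. -/
theorem Emb.NonTriv.not_isDefinable {k : Emb N V} (hk : k.NonTriv) :
    ¬ IsDefinableFromParameters k.sub := by
  intro h
  obtain ⟨S, hS, hiso⟩ := exists_chain_exact N V
  obtain ⟨n, hn⟩ := hiso k hk
  have := hS _ hn
  have key : ∀ m, IsInvariantSection (k.it n) (k.it m) := by
    intro m
    induction m with
    | zero => exact isInvariantSection_of_isDefinable h
    | succ m ih => exact ih.app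
  obtain ⟨A, hA, a, h1, h2⟩ := key n
  refine Emb.not_section_of_iso hS (hk.it n) hn hA (a := a) fun x y => ?_
  rw [h1, h2, pair_mem_gr, and_iff_right x.2]

end

end RankEmbedding

namespace RankEmbedding

open ZFSet

set_option linter.unusedSectionVars false
set_option synthInstance.maxSize 5000
set_option synthInstance.maxHeartbeats 400000

variable {N : Set ZFSet.{u}} {V : ZFSet.{u}}

/-! ## `Σ₁`-elementary maps are embeddings -/

section

open Language

variable {p : ZFSet.{u} → Prop} {k : ℕ}

theorem exists_formula_of_sigma0 {P : (Fin k → Subtype p) → Prop} (h : (sigma0 p k).R P P) :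
    ∃ φ : LSet.Formula (Fin k), IsSigma1 φ ∧ ∀ s, φ.Realize s ↔ P s := by
  obtain ⟨-, φ, hφ, h⟩ := h.out
  refine ⟨φ, .of_sigma0 hφ, fun s => Iff.trans (iff_of_eq ?_) (h s)⟩
  exact congrArg (fun t => BoundedFormula.Realize φ s t)
    (Subsingleton.elim (α := Fin 0 → Subtype p) _ _)

theorem exists_formula_of_sigma0_ex {P : (Fin k → Subtype p) × Subtype p → Prop}
    (h : (sigma0 p k).R P P) :
    ∃ φ : LSet.Formula (Fin k), IsSigma1 φ ∧ ∀ s, φ.Realize s ↔ ∃ x, P (s, x) := by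
  obtain ⟨-, φ, hφ, h⟩ := h.out
  refine ⟨φ.ex, .ex (.of_sigma0 hφ), fun s => ?_⟩
  refine BoundedFormula.realize_ex.trans (exists_congr fun x => Iff.trans (iff_of_eq ?_) (h (s, x)))
  exact congrArg (fun t => φ.Realize s (Fin.snoc t x))
    (Subsingleton.elim (α := Fin 0 → Subtype p) _ _)

end

theorem IsSigma1Elementary.iff_of_sigma0 {j : V → V} (hj : IsSigma1Elementary j) {k : ℕ}
    {P : (Fin k → V) → Prop} (h : (sigma0 (fun x => x ∈ V) k).R P P) (s : Fin k → V) :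
    P s ↔ P (j ∘ s) := by
  obtain ⟨φ, hφ, e⟩ := exists_formula_of_sigma0 h
  exact (e s).symm.trans ((hj k φ hφ s).trans (e _))

theorem IsSigma1Elementary.exists_iff_of_sigma0 {j : V → V} (hj : IsSigma1Elementary j) {k : ℕ}
    {P : (Fin k → V) × V → Prop} (h : (sigma0 (fun x => x ∈ V) k).R P P) (s : Fin k → V) :
    (∃ x, P (s, x)) ↔ ∃ x, P (j ∘ s, x) := by
  obtain ⟨φ, hφ, e⟩ := exists_formula_of_sigma0_ex h
  exact (e s).symm.trans ((hj k φ hφ s).trans (e _))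

theorem pair_mem_graph {v w : ZFSet.{u}} {f : v → w} {x : v} {y : ZFSet.{u}} :
    pair x.1 y ∈ graph f ↔ y = (f x).1 := by
  simp only [graph, mem_range, pair_inj]
  exact ⟨fun ⟨z, h, h'⟩ => by rw [← h', Subtype.ext h], fun h => ⟨x, rfl, h.symm⟩⟩

section

variable [hN : Fact (IsTransitiveZFModel N)] [hV : LimitLevel N V] [tV : TransCl fun x => x ∈ V]

theorem isEmbRel_of_isSigma1Elementary {j : V → V} (hj : IsSigma1Elementary j) :
    IsEmbRel N fun x y : V => pair x.1 y.1 ∈ graph j := by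
  have un : ∀ F : ZFSet.{u} → ZFSet.{u},
      (sigma0 (fun x => x ∈ V) 2).R (fun s : Fin 2 → V => (s 1).1 = F (s 0).1)
        (fun s : Fin 2 → V => (s 1).1 = F (s 0).1) →
      PreservesUn (fun x y : V => pair x.1 y.1 ∈ graph j) F := by
    intro F hF x x' y y' hx hy e
    rw [pair_mem_graph] at hx hy
    rw [hx, hy]
    exact (hj.iff_of_sigma0 hF ![x, y]).1 e
  have bin : ∀ F : ZFSet.{u} → ZFSet.{u} → ZFSet.{u},
      (sigma0 (fun x => x ∈ V) 3).R (fun s : Fin 3 → V => (s 2).1 = F (s 0).1 (s 1).1)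
        (fun s : Fin 3 → V => (s 2).1 = F (s 0).1 (s 1).1) →
      PreservesBin (fun x y : V => pair x.1 y.1 ∈ graph j) F := by
    intro F hF x x' y y' z z' hx hy hz e
    rw [pair_mem_graph] at hx hy hz
    rw [hx, hy, hz]
    exact (hj.iff_of_sigma0 hF ![x, y, z]).1 e
  exact
    { total := fun x => ⟨j x, pair_mem_graph.2 rfl⟩
      functional := fun x y z hy hz =>
        Subtype.ext ((pair_mem_graph.1 hy).trans (pair_mem_graph.1 hz).symm)
      sdiff := bin _ inferInstance
      prod := bin _ inferInstance
      dom := un _ inferInstance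
      singleton := un _ inferInstance
      memPart := un _ inferInstance
      eqPart := un _ inferInstance
      insPart := bin _ inferInstance
      pw := by
        intro x x' y y' hx hy e
        rw [pair_mem_graph] at hx hy
        rw [hx, hy]
        rw [lift.eq_pw_iff] at e ⊢
        refine ⟨(hj.iff_of_sigma0 (P := fun s : Fin 2 → V => ∀ z : V, z.1 ∈ (s 1).1 →
          z.1 ⊆ (s 0).1) inferInstance ![x, y]).1 e.1, ?_⟩
        -- That `y` contains all subsets of `x` is the negation of a `Σ₁` statement; here
        -- `Σ₀`-elementarity would not suffice.
        have h := (hj.exists_iff_of_sigma0 (P := fun h : (Fin 2 → V) × V => h.2.1 ⊆ (h.1 0).1 ∧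
          h.2.1 ∉ (h.1 1).1) inferInstance ![x, y]).not
        push Not at h
        exact h.1 e.2 }

theorem exists_emb_sub_eq {j : V → V} (hjN : graph j ∈ N) (hj : IsSigma1Elementary j) :
    ∃ k : Emb N V, k.sub = j ∧ k.gr = graph j := by
  obtain ⟨k, hk⟩ := exists_emb_gr_eq hjN (fun p hp => by
    obtain ⟨x, rfl⟩ := mem_range.1 hp
    exact pair_mem_prod.2 ⟨x.2, (j x).2⟩) (isEmbRel_of_isSigma1Elementary hj)
  refine ⟨k, funext fun x => Subtype.ext ?_, hk⟩
  have h : pair x.1 (k x.1) ∈ k.gr := Emb.pair_mem_gr.2 ⟨x.2, rfl⟩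
  rw [hk] at h
  exact pair_mem_graph.1 h

theorem codeRel_mem {w : ZFSet.{u}} {f : V → w} (hf : graph f ∈ N) : codeRel f ∈ N :=
  sep_mem_of_definable (prod_mem hV.mem hV.mem) _ (fun q => ∃ x z y : El N,
    q.1 = pair x.1 y.1 ∧ x.1 ∈ (⟨V, hV.mem⟩ : El N).1 ∧
      pair x.1 z.1 ∈ (⟨graph f, hf⟩ : El N).1 ∧ y.1 ∈ z.1) fun q _ => by
    constructor
    · rintro ⟨x, y, hy, e⟩
      have h : pair x.1 (f x).1 ∈ graph f := pair_mem_graph.2 rfl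
      have hfN : (f x).1 ∈ N := right_mem_of_pair_mem (p := fun x => x ∈ N) hf h
      exact ⟨⟨_, LimitLevel.mem_N N x.2⟩, ⟨_, hfN⟩, ⟨y, mem_of_mem hfN hy⟩, e, x.2, h, hy⟩
    · rintro ⟨x, z, y, e, hx, h, hy⟩
      refine ⟨⟨x.1, hx⟩, y.1, ?_, e⟩
      rwa [← pair_mem_graph (x := (⟨x.1, hx⟩ : V)).1 h]

end

/-- The level is in `N` because it is the domain of a function in `N`. -/
theorem limitLevel_of_isSuccLimit [hN : Fact (IsTransitiveZFModel N)] {δ : Ordinal.{u}}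
    (hδ : Order.IsSuccLimit δ) (hδN : δ.toZFSet ∈ N) {w : ZFSet.{u}} {f : level N δ → w}
    (hf : graph f ∈ N) : LimitLevel N (level N δ) where
  mem := by
    have : dom (graph f) = level N δ := by
      ext x
      rw [mem_dom]
      constructor
      · rintro ⟨y, h⟩
        obtain ⟨z, e⟩ := mem_range.1 h
        exact (pair_inj.1 e).1 ▸ z.2
      · exact fun hx => ⟨_, pair_mem_graph (x := ⟨x, hx⟩).2 rfl⟩
    exact this ▸ dom_mem hf
  exists_eq := ⟨δ, hδ, rfl, fun γ hγ => mem_of_mem hδN (by simpa using hγ)⟩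

/-- The sets `A ∩ V_α` are cofinal among the subsets of `A` in `V_δ`: each such `z` is included in
the one with `α = rank z`. -/
theorem canonicalExtension_sub [hN : Fact (IsTransitiveZFModel N)] {δ : Ordinal.{u}}
    [hV : LimitLevel N (level N δ)] [TransCl fun x => x ∈ level N δ] (k : Emb N (level N δ))
    {A : ZFSet.{u}} (hA : A ∈ N) :
    canonicalExtension δ k.sub A = k.ext A := by
  ext y
  rw [canonicalExtension, mem_sep, Emb.mem_ext]
  refine and_congr_right fun _ => ⟨?_, ?_⟩
  · rintro ⟨α, -, x, hx, hy⟩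
    exact ⟨x.1, x.2, hx ▸ fun z hz => (mem_inter.1 hz).1, hy⟩
  · rintro ⟨z, hz, hzA, hy⟩
    -- Cutting `A` off at a true level or at a level of `N` is the same, since `A ⊆ N` by
    -- transitivity.
    have e : A ∩ vonNeumann (rank z) = A ∩ level N (rank z) := by
      ext a
      simp only [mem_inter, level, mem_sep]
      exact ⟨fun h => ⟨h.1, h.2, mem_of_mem hA h.1⟩, fun h => ⟨h.1, h.2.1⟩⟩
    have hx : A ∩ level N (rank z) ∈ level N δ :=
      Emb.inter_mem_V hA (LimitLevel.level_mem_of_rank N hz)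
    refine ⟨rank z, (mem_level.1 hz).1, ⟨_, hx⟩, e.symm, ?_⟩
    exact k.map_subset hz hx
      (fun a ha => mem_inter.2 ⟨hzA ha, LimitLevel.subset_level_rank N hz ha⟩) hy

end RankEmbedding

open RankEmbedding in
theorem theorem5p6 (N : Set ZFSet.{u}) (hN : RankEmbedding.IsTransitiveZFModel N)
    (δ : Ordinal.{u}) (hδ : Order.IsSuccLimit δ) (hδN : δ.toZFSet ∈ N)
    (j : RankEmbedding.level N δ → RankEmbedding.level N δ)
    (hjN : RankEmbedding.graph j ∈ N)
    (hj : RankEmbedding.IsSigma1Elementary j) (hj_ne : j ≠ id) :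
    ¬ RankEmbedding.IsDefinableFromParameters j ∧
    ¬ ∃ (a : RankEmbedding.level N δ)
        (f : RankEmbedding.level N δ → RankEmbedding.level N (δ + 1)),
        RankEmbedding.graph f ∈ N ∧
        RankEmbedding.canonicalExtensionFun δ j f a = RankEmbedding.graph j := by
  have : Fact (IsTransitiveZFModel N) := ⟨hN⟩
  have := limitLevel_of_isSuccLimit hδ hδN hjN
  have := transCl_of_limitLevel (V := level N δ) N
  obtain ⟨k, rfl, hk⟩ := exists_emb_sub_eq hjN hj
  have hk' : k.NonTriv := by
    by_contra h
    refine hj_ne (funext fun x => Subtype.ext (by_contra fun hx => h ⟨x.1, x.2, hx⟩))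
  refine ⟨hk'.not_isDefinable, ?_⟩
  rintro ⟨a, f, hf, e⟩
  refine hk'.not_section (codeRel_mem hf) (a := a) fun x y => ?_
  rw [hk, ← e, canonicalExtensionFun, canonicalExtension_sub k (codeRel_mem hf), ZFSet.mem_sep,
    and_iff_right (LimitLevel.pair N x.2 y.2)]
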